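/- For a function $f=f(x,v)$ on $\mathbb{R}^6=\mathbb{R}^3\times\mathbb{R}^3$ put $$\rho_f(x)=\int_{\mathbb{R}^3} f(x,v)\,dv,\qquad \phi_f=K*\rho_f,\quad K(x)=-\frac{1}{4\pi|x|},$$ $$\mathcal H(f)=\frac12\int_{\mathbb{R}^6}|v|^2f(x,v)\,dx\,dv-\frac12\int_{\mathbb{R}^3}|\nabla\phi_f(x)|^2\,dx .$$ Call $f$ a steady state (stationary solution) of the gravitational Vlasov–Poisson system if $\operatorname{div}_x(vf)-\operatorname{div}_v(\nabla\phi_f\,f)=0$ weakly, i.e. for all $\psi\in C^1_c(\mathbb{R}^6)$ $$-\int_{\mathbb{R}^6} v\cdot\nabla_x\psi\, f\,dx\,dv+\int_{\mathbb{R}^6}\nabla\phi_f(x)\cdot\nabla_v\psi\, f\,dx\,dv=0 .$$ For $H\in C^2(\mathbb{R}^6)$ let $\Phi_s^H$ be its Hamiltonian flow, $\partial_s\Phi^H_s=(\nabla_vH,-\nabla_xH)(\Phi_s^H)$, $\Phi^H_0=\mathrm{Id}$ (it is globally defined whenever $\nabla H$ is bounded), and put $f_s^H=f\circ\Phi_{-s}^H$.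 Proposition. Let $\bar f:\mathbb{R}^6\to\mathbb{R}$ be a compactly supported steady state with $\bar f\in L^\infty(\mathbb{R}^6)$ and $\bar f\in W^{2,q}(\mathbb{R}^6)$ for some $q>3$. Then there is a constant $C$ depending only on $\bar f$ such that for every $H\in C^2(\mathbb{R}^6)$ for which $\bar f_1^H=\bar f\circ\Phi_{-1}^H$ is also a steady state, $$|\mathcal H(\bar f_1^H)-\mathcal H(\bar f)|\le C\,\|\nabla H\|_{L^\infty}\bigl(\|\nabla H\|_{L^\infty}+\|\nabla^2H\|_{L^\infty}\bigr)^2 ,$$ where the norms take values in $[0,\infty]$ and the estimate is void if the right-hand side is infinite. -/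

import Mathlib

open MeasureTheory Set
open scoped ENNReal NNReal ContDiff

noncomputable section

namespace VlasovPoisson

/-- The position space (and the velocity space) `ℝ³` with its Euclidean norm. -/
abbrev R3 : Type := EuclideanSpace ℝ (Fin 3)

/-- The phase space `ℝ⁶ = ℝ³ × ℝ³` of pairs `(x, v)`, with Lebesgue measure. -/
abbrev Phase : Type := R3 × R3

/-- `g` is the weak (distributional) derivative `∂_e f` of `f` in the direction `e`: both are
locally integrable and `∫ f ∂_e ψ = - ∫ g ψ` for every test function `ψ ∈ C_c^∞`. -/
def HasWeakDeriv (e : Phase) (f g : Phase → ℝ) : Prop :=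
  LocallyIntegrable f volume ∧ LocallyIntegrable g volume ∧
    ∀ ψ : Phase → ℝ, ContDiff ℝ ∞ ψ → HasCompactSupport ψ →
      ∫ z, f z * fderiv ℝ ψ z e = - ∫ z, g z * ψ z

/-- The Sobolev space `W^{2,q}(ℝ⁶)`: `f`, its weak derivatives `∂_e f` and its second weak
derivatives `∂_{e'} ∂_e f` exist and belong to `L^q`. (All directions are used instead of the
coordinate directions; by linearity in `e` this is the same.) -/
def MemW2 (f : Phase → ℝ) (q : ℝ≥0∞) : Prop :=
  MemLp f q volume ∧
    ∀ e : Phase, ∃ g : Phase → ℝ, HasWeakDeriv e f g ∧ MemLp g q volume ∧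
      ∀ e' : Phase, ∃ h : Phase → ℝ, HasWeakDeriv e' g h ∧ MemLp h q volume

/-- The partial gradient `∇ₓ H (x, v)`. -/
def gradX (H : Phase → ℝ) (z : Phase) : R3 := gradient (fun x => H (x, z.2)) z.1

/-- The partial gradient `∇ᵥ H (x, v)`. -/
def gradV (H : Phase → ℝ) (z : Phase) : R3 := gradient (fun v => H (z.1, v)) z.2

/-- The spatial density `ρ_f(x) = ∫ f(x, v) dv`. -/
def density (f : Phase → ℝ) (x : R3) : ℝ := ∫ v, f (x, v)

/-- The kernel `K(x) = - 1 / (4π|x|)`. -/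
def newtonKernel (x : R3) : ℝ := -(1 / (4 * Real.pi * ‖x‖))

/-- The Newtonian potential `φ_f = K * ρ_f`. -/
def potential (f : Phase → ℝ) (x : R3) : ℝ := ∫ y, newtonKernel (x - y) * density f y

/-- The total energy `𝓗(f) = ½ ∫ |v|² f dx dv - ½ ∫ |∇φ_f|² dx`. -/
def energy (f : Phase → ℝ) : ℝ :=
  (1 / 2) * (∫ z : Phase, ‖z.2‖ ^ 2 * f z)
    - (1 / 2) * ∫ x : R3, ‖gradient (potential f) x‖ ^ 2

/-- `f` is a stationary solution of the Vlasov-Poisson system: the equation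
`divₓ (v f) - divᵥ (∇φ_f f) = 0` holds weakly. -/
def IsStationary (f : Phase → ℝ) : Prop :=
  ∀ ψ : Phase → ℝ, ContDiff ℝ 1 ψ → HasCompactSupport ψ →
    - (∫ z : Phase, inner ℝ z.2 (gradX ψ z) * f z)
      + ∫ z : Phase, inner ℝ (gradient (potential f) z.1) (gradV ψ z) * f z = 0

/-- `Φ` is a global flow of the Hamiltonian vector field `J ∇H = (∇ᵥ H, -∇ₓ H)`, with
`Φ 0 = id`. -/
def IsHamiltonianFlow (H : Phase → ℝ) (Φ : ℝ → Phase → Phase) : Prop :=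
  ∀ z : Phase, Φ 0 z = z ∧
    ∀ s : ℝ, HasDerivAt (fun t => Φ t z) (gradV H (Φ s z), - gradX H (Φ s z)) s

open Classical in
/-- The Hamiltonian flow `Φ_s^H`. For `H ∈ C²` a global flow is unique, and it exists whenever
`∇H` is bounded; the value is `id` if there is no global flow. -/
def hamiltonianFlow (H : Phase → ℝ) : ℝ → Phase → Phase :=
  if h : ∃ Φ, IsHamiltonianFlow H Φ then h.choose else fun _ z => z

/-- The variation `f_s^H = f ∘ Φ_{-s}^H` of `f` generated by `H`. -/
def transport (f : Phase → ℝ) (H : Phase → ℝ) (s : ℝ) : Phase → ℝ :=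
  fun z => f (hamiltonianFlow H (-s) z)

/-- `‖∇H‖_{L^∞} ∈ [0, ∞]`, with the operator norm of the derivative, which is
between `|∇H|` and `√2 |∇H|`. -/
def gradSup (H : Phase → ℝ) : ℝ≥0∞ := eLpNorm (fun z => ‖fderiv ℝ H z‖) ∞ volume

/-- `‖∇²H‖_{L^∞} ∈ [0, ∞]`, with the operator norm of the second derivative. It is
equivalent, up to universal factors, to any other norm of the Hessian matrix. -/
def hessSup (H : Phase → ℝ) : ℝ≥0∞ := eLpNorm (fun z => ‖fderiv ℝ (fderiv ℝ H) z‖) ∞ volume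

end VlasovPoisson

end

noncomputable section

namespace VlasovPoisson

open Filter Topology Metric

/-! The energy is a linear plus a symmetric quadratic functional of the density, because `∫ |∇φ|² =
-∫ φ ρ` and the kernel is even. Hence its increment between `f` and `g = f ∘ Φ_{-1}` is exactly the
pairing of `g - f` with the derivative at the midpoint, the particle energy `E = |v|²/2 + (φ_f +
φ_g)/2` (`energy_sub_energy`). With `f_s = f ∘ Φ_{-s}`, the function `s ↦ ∫ E f_s` has derivative `½
∫ (a₀ + a₁) f_s`, where `a₀`, `a₁` are the energy rates in the fields of `f` and `g`. Stationarity
says `∫ a₀ f = 0` and `∫ a₁ g = 0`.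

Pairing `s` with `1 - s`, the increment is governed by `∫ (a₀ + a₁)(f_s + f_{1-s})`, which the two
stationary equations turn into `∫ (a₀ + a₁)(f_s + f_{1-s} - f - g) + ∫ (a₀ - a₁)(g - f)`. Let `ε₁`,
`ε₂` bound the first and second derivatives of `H`. In the first integral the rates are `O(ε₁)` and
the second difference is `O(ε₁(ε₁ + ε₂))` in `L¹`, since `f` has two derivatives in `L¹`. In the
second, `g - f` is `O(ε₁)` in `L¹` and `a₀ - a₁` is `O(ε₁²)`, because the two force fields differ by
`O(ε₁)`: by Hölder, `|x|⁻²` is locally in `L^s` for `s < 3/2`, dual to `∇f ∈ L^p` with `p > 3`. This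
settles `ε₁ + ε₂ ≤ 1` (`abs_energy_sub_le_of_small`).

For `ε₁ + ε₂ ≥ 1` no cancellation is needed. All supports lie in a ball of radius `A = R + 1 + ε₁`,
the force is `O(A²)`, and the increment is `O(ε₁ A²)`, which already has the required growth
(`abs_energy_sub_le_of_grad`).

As `H` is only `C²`, the flow is never differentiated in space. Liouville's theorem is obtained by
testing with Lipschitz functions, and the Sobolev estimates are proved for mollifications of `f` and
passed to the limit by Fatou's lemma. -/

theorem exists_radius_of_hasCompactSupport {E F : Type*} [NormedAddCommGroup E] [Zero F]
    {f : E → F} (hf : HasCompactSupport f) : ∃ R, 0 ≤ R ∧ ∀ z, R < ‖z‖ → f z = 0 := by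
  obtain ⟨R, hR⟩ := hf.isCompact.isBounded.subset_closedBall 0
  refine ⟨max R 0, le_max_right _ _, fun z hz => ?_⟩
  by_contra h0
  have := hR (subset_tsupport _ h0)
  rw [mem_closedBall_zero_iff] at this
  exact absurd ((le_max_left _ _).trans_lt hz) this.not_gt

/-! ### Flows of Lipschitz vector fields and invariance of integrals -/

section AbstractFlow

variable {E : Type*} [NormedAddCommGroup E] [NormedSpace ℝ E]

/-- `Φ` is a global flow of the autonomous vector field `b`. -/
structure IsFlow (b : E → E) (Φ : ℝ → E → E) : Prop where
  zero : ∀ z, Φ 0 z = z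
  deriv : ∀ z s, HasDerivAt (fun t => Φ t z) (b (Φ s z)) s

namespace IsFlow

variable {b : E → E} {Φ : ℝ → E → E} {K : ℝ≥0} {M : ℝ}

theorem add (h : IsFlow b Φ) (hb : LipschitzWith K b) (s t : ℝ) (z : E) :
    Φ (s + t) z = Φ s (Φ t z) := by
  have := ODE_solution_unique_univ (v := fun _ => b) (s := fun _ => univ) (K := K)
    (f := fun s => Φ (s + t) z) (g := fun s => Φ s (Φ t z)) (t₀ := 0)
    (fun _ => hb.lipschitzOnWith)
    (fun s => ⟨by simpa using (h.deriv z (s + t)).comp_add_const s t, mem_univ _⟩)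
    (fun s => ⟨h.deriv _ s, mem_univ _⟩) (by simp [h.zero])
  exact congrFun this s

theorem neg_apply_apply (h : IsFlow b Φ) (hb : LipschitzWith K b) (s : ℝ) (z : E) :
    Φ (-s) (Φ s z) = z := by
  rw [← h.add hb, neg_add_cancel, h.zero]

theorem apply_neg_apply (h : IsFlow b Φ) (hb : LipschitzWith K b) (s : ℝ) (z : E) :
    Φ s (Φ (-s) z) = z := by
  rw [← h.add hb, add_neg_cancel, h.zero]

theorem reverse (h : IsFlow b Φ) : IsFlow (fun z => - b z) (fun t => Φ (-t)) where
  zero z := by simp [h.zero]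
  deriv z s := by
    have := (h.deriv z (-s)).scomp s (hasDerivAt_neg s)
    simpa [Function.comp_def] using this

theorem norm_sub_le (h : IsFlow b Φ) (hM : ∀ z, ‖b z‖ ≤ M) (s t : ℝ) (z : E) :
    ‖Φ s z - Φ t z‖ ≤ M * |s - t| := by
  have := Convex.norm_image_sub_le_of_norm_hasDerivWithin_le (𝕜 := ℝ)
    (f := fun t => Φ t z) (f' := fun s => b (Φ s z)) (s := univ) (x := t) (y := s)
    (fun x _ => (h.deriv z x).hasDerivWithinAt) (fun x _ => hM _) convex_univ
    (mem_univ _) (mem_univ _)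
  simpa using this

theorem norm_sub_self_le (h : IsFlow b Φ) (hM : ∀ z, ‖b z‖ ≤ M) (s : ℝ) (z : E) :
    ‖Φ s z - z‖ ≤ M * |s| := by
  simpa [h.zero] using h.norm_sub_le hM s 0 z

theorem lipschitz_of_nonneg (h : IsFlow b Φ) (hb : LipschitzWith K b) {t : ℝ} (ht : 0 ≤ t) :
    LipschitzWith (Real.exp (K * t)).toNNReal (Φ t) := by
  refine LipschitzWith.of_dist_le_mul fun z w => ?_
  have := dist_le_of_trajectories_ODE (v := fun _ => b) (K := K) (a := 0) (b := t)
    (f := fun t => Φ t z) (g := fun t => Φ t w) (δ := dist z w) (fun _ => hb)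
    (fun s _ => (h.deriv z s).continuousAt.continuousWithinAt)
    (fun s _ => (h.deriv z s).hasDerivWithinAt)
    (fun s _ => (h.deriv w s).continuousAt.continuousWithinAt)
    (fun s _ => (h.deriv w s).hasDerivWithinAt) (by simp [h.zero]) t ⟨ht, le_rfl⟩
  rw [Real.coe_toNNReal _ (Real.exp_pos _).le, mul_comm]
  simpa using this

theorem lipschitz (h : IsFlow b Φ) (hb : LipschitzWith K b) (t : ℝ) :
    LipschitzWith (Real.exp (K * |t|)).toNNReal (Φ t) := by
  rcases le_total 0 t with ht | ht
  · simpa [abs_of_nonneg ht] using h.lipschitz_of_nonneg hb ht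
  · have := h.reverse.lipschitz_of_nonneg (K := K) hb.neg (t := -t) (by linarith)
    simpa [abs_of_nonpos ht] using this

theorem continuous_uncurry (h : IsFlow b Φ) (hb : LipschitzWith K b) (hM : ∀ z, ‖b z‖ ≤ M) :
    Continuous fun p : ℝ × E => Φ p.1 p.2 := by
  refine continuous_prod_of_continuous_lipschitzWith (fun p : ℝ × E => Φ p.1 p.2) M.toNNReal
    (fun t => ?_) (fun z => ?_)
  · exact (h.lipschitz hb t).continuous
  · refine LipschitzWith.of_dist_le_mul fun s t => ?_
    have hM0 : 0 ≤ M := (norm_nonneg _).trans (hM 0)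
    rw [dist_eq_norm, Real.coe_toNNReal _ hM0, Real.dist_eq]
    exact h.norm_sub_le hM s t z

/-- The time `t` map of a flow, as a homeomorphism. -/
def homeomorph (h : IsFlow b Φ) (hb : LipschitzWith K b) (t : ℝ) : E ≃ₜ E where
  toFun := Φ t
  invFun := Φ (-t)
  left_inv := h.neg_apply_apply hb t
  right_inv := h.apply_neg_apply hb t
  continuous_toFun := (h.lipschitz hb t).continuous
  continuous_invFun := (h.lipschitz hb (-t)).continuous

/-- A function vanishing outside a ball, moved by the flow, vanishes outside a bigger ball. -/
theorem comp_eq_zero (h : IsFlow b Φ) (hM : ∀ z, ‖b z‖ ≤ M) {F : Type*} [Zero F] {g : E → F}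
    {R : ℝ} (hg : ∀ z, R < ‖z‖ → g z = 0) (t : ℝ) {z : E} (hz : R + M * |t| < ‖z‖) :
    g (Φ t z) = 0 := by
  apply hg
  have h1 := h.norm_sub_self_le hM t z
  have h2 := norm_sub_norm_le z (Φ t z)
  rw [norm_sub_rev] at h2
  linarith

section Measure

variable [FiniteDimensional ℝ E] [MeasurableSpace E] [BorelSpace E] {μ : Measure E}
  [μ.IsAddHaarMeasure]

/-- Dominated convergence, at time zero only: there `Φ 0 z = z`, and Rademacher's theorem gives
differentiability of `G` at almost every `z`. At another time one would have to know that the flow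
preserves null sets. -/
theorem hasDerivAt_integral_comp_zero (h : IsFlow b Φ) (hb : LipschitzWith K b)
    (hM : ∀ z, ‖b z‖ ≤ M) {G : E → ℝ} {D : ℝ≥0} (hG : LipschitzWith D G)
    (hGc : HasCompactSupport G) (hdiv : ∫ z, fderiv ℝ G z (b z) ∂μ = 0) :
    HasDerivAt (fun t => ∫ z, G (Φ t z) ∂μ) 0 0 := by
  obtain ⟨R, -, hR⟩ := exists_radius_of_hasCompactSupport hGc
  have hM0 : 0 ≤ M := (norm_nonneg _).trans (hM 0)
  -- For `|t| ≤ 1` points move by at most `M`, so `G ∘ Φ t` vanishes off the ball of radius `R + M`;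
  -- on it `t ↦ G (Φ t z)` has Lipschitz constant `D * M`.
  set bound : E → ℝ := (closedBall (0 : E) (R + M)).indicator fun _ => D * M with hbound
  have key := hasDerivAt_integral_of_dominated_loc_of_lip (μ := μ) (𝕜 := ℝ) (x₀ := (0 : ℝ))
    (s := Icc (-1) 1) (F := fun t z => G (Φ t z)) (F' := fun z => fderiv ℝ G z (b z))
    (bound := bound) (Icc_mem_nhds (by norm_num) (by norm_num))
    (Eventually.of_forall fun t =>
      (hG.continuous.comp (h.lipschitz hb t).continuous).aestronglyMeasurable)
    (by
      simp only [h.zero]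
      exact hG.continuous.integrable_of_hasCompactSupport hGc)
    ((isBoundedBilinearMap_apply (𝕜 := ℝ)).continuous.measurable.comp
      ((measurable_fderiv ℝ G).prodMk hb.continuous.measurable)).aestronglyMeasurable ?_ ?_ ?_
  · simpa only [hdiv] using key.2
  · refine Eventually.of_forall fun z => ?_
    refine LipschitzOnWith.of_dist_le_mul fun s hs t ht => ?_
    by_cases hz : z ∈ closedBall (0 : E) (R + M)
    · have e1 : dist (G (Φ s z)) (G (Φ t z)) ≤ D * dist (Φ s z) (Φ t z) := hG.dist_le_mul _ _
      have e2 := h.norm_sub_le hM s t z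
      rw [dist_eq_norm (Φ s z)] at e1
      simp only [hbound, indicator_of_mem hz, Real.coe_nnabs]
      rw [abs_of_nonneg (by positivity), Real.dist_eq s t]
      calc _ ≤ _ := e1
        _ ≤ D * (M * |s - t|) := by gcongr
        _ = _ := by ring
    · have hz' : R + M < ‖z‖ := by simpa using hz
      have hab : ∀ r ∈ Icc (-1 : ℝ) 1, G (Φ r z) = 0 := fun r hr => by
        refine h.comp_eq_zero hM hR r (lt_of_le_of_lt ?_ hz')
        have : |r| ≤ 1 := abs_le.2 hr
        nlinarith
      simp only [hab s hs, hab t ht, dist_self]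
      positivity
  · exact (integrable_indicator_iff measurableSet_closedBall).2
      (integrableOn_const (isCompact_closedBall _ _).measure_lt_top.ne)
  · filter_upwards [hG.ae_differentiableAt (μ := μ)] with z hz
    have h1 := h.deriv z 0
    have h2 : HasFDerivAt G (fderiv ℝ G z) (Φ 0 z) := by rw [h.zero]; exact hz.hasFDerivAt
    have := h2.comp_hasDerivAt (0 : ℝ) h1
    simpa [h.zero, Function.comp_def] using this

/-- The group law reduces time `t` to time zero, since `G ∘ Φ t` is again Lipschitz with compact
support. The derivative in time therefore vanishes identically. -/
theorem integral_comp_eq (h : IsFlow b Φ) (hb : LipschitzWith K b) (hM : ∀ z, ‖b z‖ ≤ M)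
    (hdiv : ∀ (D : ℝ≥0) (G : E → ℝ), LipschitzWith D G → HasCompactSupport G →
      ∫ z, fderiv ℝ G z (b z) ∂μ = 0)
    {G : E → ℝ} {D : ℝ≥0} (hG : LipschitzWith D G) (hGc : HasCompactSupport G) (t : ℝ) :
    ∫ z, G (Φ t z) ∂μ = ∫ z, G z ∂μ := by
  have hd : ∀ t, HasDerivAt (fun t => ∫ z, G (Φ t z) ∂μ) 0 t := fun t => by
    have hGt : LipschitzWith _ (G ∘ Φ t) := hG.comp (h.lipschitz hb t)
    have hGtc : HasCompactSupport (G ∘ Φ t) := hGc.comp_homeomorph (h.homeomorph hb t)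
    have := h.hasDerivAt_integral_comp_zero hb hM hGt hGtc (hdiv _ _ hGt hGtc)
    have h2 : HasDerivAt (fun r => ∫ z, (G ∘ Φ t) (Φ r z) ∂μ) 0 (t - t) := by simpa using this
    have h3 := h2.comp_sub_const t t
    refine h3.congr_of_eventuallyEq (Eventually.of_forall fun r => ?_)
    simp only [Function.comp_apply, ← h.add hb, add_sub_cancel]
  have := is_const_of_deriv_eq_zero (fun t => (hd t).differentiableAt) (fun t => (hd t).deriv) t 0
  simpa [h.zero] using this

end Measure
end IsFlow
end AbstractFlow

/-! ### Measures determined by Lipschitz test functions -/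

/-- Two regular measures which give the same integral to every compactly supported Lipschitz
function are equal. -/
theorem measure_ext_of_forall_lipschitz {E : Type*} [MetricSpace E] [ProperSpace E]
    [MeasurableSpace E] [BorelSpace E] {μ ν : Measure E} [μ.Regular] [ν.Regular]
    (h : ∀ (D : ℝ≥0) (G : E → ℝ), LipschitzWith D G → HasCompactSupport G →
      ∫ z, G z ∂μ = ∫ z, G z ∂ν) : μ = ν := by
  apply Measure.OuterRegular.ext_isOpen
  apply Measure.InnerRegularWRT.eq_of_innerRegularWRT_of_forall_eq Measure.Regular.innerRegular
    Measure.Regular.innerRegular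
  intro K hK
  rcases K.eq_empty_or_nonempty with rfl | hne
  · simp
  obtain ⟨y, hy⟩ := hne
  -- Lipschitz tents decreasing to the indicator of `K`. From `n = 1` on they are supported in the
  -- closed unit neighbourhood `S`; the shift to `n + 1` below discards the tent `n = 0`, which is
  -- constantly one.
  set g : ℕ → E → ℝ := fun n z => max (1 - n * infDist z K) 0 with hg
  have hlip : ∀ n : ℕ, LipschitzWith n (g n) := fun n => by
    refine LipschitzWith.of_dist_le_mul fun x y => ?_
    have e1 := (lipschitz_infDist_pt K).dist_le_mul x y
    rw [Real.dist_eq, NNReal.coe_one, one_mul] at e1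
    rw [Real.dist_eq]
    calc |g n x - g n y| ≤ |(1 - n * infDist x K) - (1 - n * infDist y K)| :=
          abs_max_sub_max_le_abs _ _ _
      _ = n * |infDist x K - infDist y K| := by
          rw [show (1 - (n : ℝ) * infDist x K) - (1 - n * infDist y K)
            = -(n * (infDist x K - infDist y K)) by ring, abs_neg, abs_mul, Nat.abs_cast]
      _ ≤ _ := by simpa using mul_le_mul_of_nonneg_left e1 (Nat.cast_nonneg n)
  set S : Set E := {z | infDist z K ≤ 1} with hS
  have hSc : IsCompact S := by
    refine isCompact_of_isClosed_isBounded
      (isClosed_le (continuous_infDist_pt K) continuous_const) ?_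
    obtain ⟨R, hR⟩ := hK.isBounded.subset_closedBall y
    refine isBounded_closedBall (x := y) (r := 1 + R) |>.subset fun z hz => ?_
    obtain ⟨w, hw, hzw⟩ := hK.exists_infDist_eq_dist ⟨y, hy⟩ z
    have h1 : dist w y ≤ R := hR hw
    have h2 : dist z w ≤ 1 := hzw ▸ hz
    exact (dist_triangle z w y).trans (by linarith)
  have hzero : ∀ n : ℕ, 1 ≤ n → ∀ z, z ∉ S → g n z = 0 := fun n hn z hz => by
    have h1 : 1 < infDist z K := not_le.1 hz
    have h2 : (1 : ℝ) ≤ n := by exact_mod_cast hn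
    exact max_eq_right (by nlinarith)
  have hlim : ∀ z, Tendsto (fun n : ℕ => g (n + 1) z) atTop (𝓝 (K.indicator 1 z)) := fun z => by
    by_cases hz : z ∈ K
    · simp [hg, hz, infDist_zero_of_mem hz]
    · have hpos : 0 < infDist z K := (hK.isClosed.notMem_iff_infDist_pos ⟨y, hy⟩).1 hz
      rw [indicator_of_notMem hz]
      obtain ⟨N, hN⟩ := exists_nat_gt (1 / infDist z K)
      refine tendsto_const_nhds.congr' ?_
      filter_upwards [eventually_ge_atTop N] with n hn
      symm
      apply max_eq_right
      rw [div_lt_iff₀ hpos] at hN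
      have : (N : ℝ) ≤ n := by exact_mod_cast hn
      push_cast
      nlinarith
  have main : ∀ (κ : Measure E) [κ.Regular],
      Tendsto (fun n : ℕ => ∫ z, g (n + 1) z ∂κ) atTop (𝓝 (κ.real K)) := fun κ _ => by
    have := tendsto_integral_of_dominated_convergence (μ := κ)
      (F := fun n : ℕ => g (n + 1)) (f := K.indicator 1) (S.indicator fun _ => (1 : ℝ))
      (fun n => (hlip _).continuous.aestronglyMeasurable)
      ((integrable_indicator_iff hSc.measurableSet).2 (integrableOn_const hSc.measure_lt_top.ne))
      (fun n => Eventually.of_forall fun z => ?_) (Eventually.of_forall hlim)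
    · rwa [integral_indicator_one hK.measurableSet] at this
    · by_cases hz : z ∈ S
      · rw [indicator_of_mem hz, Real.norm_of_nonneg (le_max_right _ _)]
        have := infDist_nonneg (x := z) (s := K)
        exact max_le (by nlinarith [mul_nonneg (Nat.cast_nonneg (α := ℝ) (n + 1)) this]) zero_le_one
      · rw [hzero _ (by omega) z hz, indicator_of_notMem hz, norm_zero]
  have heq : μ.real K = ν.real K := by
    refine tendsto_nhds_unique (main μ) ((main ν).congr fun n => ?_)
    exact (h _ _ (hlip (n + 1)) (HasCompactSupport.intro hSc (hzero _ (by omega)))).symm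
  rwa [measureReal_def, measureReal_def,
    ENNReal.toReal_eq_toReal_iff' hK.measure_lt_top.ne hK.measure_lt_top.ne] at heq

theorem IsFlow.measurePreserving {E : Type*} [NormedAddCommGroup E] [NormedSpace ℝ E]
    [FiniteDimensional ℝ E] [MeasurableSpace E] [BorelSpace E] {μ : Measure E}
    [μ.IsAddHaarMeasure] {b : E → E} {Φ : ℝ → E → E} {K : ℝ≥0} {M : ℝ}
    (h : IsFlow b Φ) (hb : LipschitzWith K b) (hM : ∀ z, ‖b z‖ ≤ M)
    (hdiv : ∀ (D : ℝ≥0) (G : E → ℝ), LipschitzWith D G → HasCompactSupport G →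
      ∫ z, fderiv ℝ G z (b z) ∂μ = 0) (t : ℝ) :
    MeasurePreserving (Φ t) μ μ := by
  have hcont := (h.lipschitz hb t).continuous
  have : ProperSpace E := FiniteDimensional.proper_real E
  have hreg : (μ.map (Φ t)).Regular := Measure.Regular.map (h.homeomorph hb t)
  refine ⟨hcont.measurable, measure_ext_of_forall_lipschitz fun D G hG hGc => ?_⟩
  rw [integral_map hcont.aemeasurable hG.continuous.aestronglyMeasurable]
  exact h.integral_comp_eq hb hM hdiv hG hGc t

/-- A bounded measurable function vanishing outside a ball is integrable. -/
theorem integrable_of_bounded_of_vanish {E F : Type*} [NormedAddCommGroup E] [ProperSpace E]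
    [MeasurableSpace E] [BorelSpace E] [NormedAddCommGroup F] {μ : Measure E}
    [IsFiniteMeasureOnCompacts μ] {f : E → F} {C R : ℝ} (hf : AEStronglyMeasurable f μ)
    (hC : ∀ᵐ z ∂μ, ‖f z‖ ≤ C) (hR : ∀ z, R < ‖z‖ → f z = 0) : Integrable f μ := by
  have hs : Function.support f ⊆ closedBall 0 R := fun z hz => by
    by_contra h
    exact hz (hR z (by simpa using h))
  rw [← integrableOn_iff_integrable_of_support_subset hs]
  exact Measure.integrableOn_of_bounded (isCompact_closedBall _ _).measure_lt_top.ne hf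
    (ae_restrict_of_ae hC)

/-! ### Hamiltonian vector fields and Liouville's theorem -/

instance : (volume : Measure Phase).IsAddHaarMeasure :=
  inferInstanceAs ((volume : Measure R3).prod (volume : Measure R3)).IsAddHaarMeasure

/-- The Hamiltonian vector field `J ∇H = (∇ᵥ H, -∇ₓ H)`. -/
def hamField (H : Phase → ℝ) (z : Phase) : Phase := (gradV H z, - gradX H z)

theorem inner_gradX {H : Phase → ℝ} {z : Phase} (hH : DifferentiableAt ℝ H z) (e : R3) :
    inner ℝ (gradX H z) e = fderiv ℝ H z (e, 0) := by
  have h1 : HasFDerivAt (fun x : R3 => H (x, z.2))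
      ((fderiv ℝ H z).comp (ContinuousLinearMap.inl ℝ R3 R3)) z.1 :=
    HasFDerivAt.comp (f := fun x : R3 => (x, z.2)) z.1 (g := H) hH.hasFDerivAt
      (hasFDerivAt_prodMk_left z.1 z.2)
  rw [gradX, gradient, InnerProductSpace.toDual_symm_apply, h1.fderiv]
  rfl

theorem inner_gradV {H : Phase → ℝ} {z : Phase} (hH : DifferentiableAt ℝ H z) (e : R3) :
    inner ℝ (gradV H z) e = fderiv ℝ H z (0, e) := by
  have h1 : HasFDerivAt (fun v : R3 => H (z.1, v))
      ((fderiv ℝ H z).comp (ContinuousLinearMap.inr ℝ R3 R3)) z.2 :=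
    HasFDerivAt.comp (f := fun v : R3 => (z.1, v)) z.2 (g := H) hH.hasFDerivAt
      (hasFDerivAt_prodMk_right z.1 z.2)
  rw [gradV, gradient, InnerProductSpace.toDual_symm_apply, h1.fderiv]
  rfl

/-- The linear map sending a covector `L` on phase space to `J L`. -/
def symplecticSharp : (Phase →L[ℝ] ℝ) →L[ℝ] Phase :=
  LinearMap.mkContinuous
    { toFun := fun L => ((InnerProductSpace.toDual ℝ R3).symm
          (L.comp (ContinuousLinearMap.inr ℝ R3 R3)),
        - (InnerProductSpace.toDual ℝ R3).symm (L.comp (ContinuousLinearMap.inl ℝ R3 R3)))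
      map_add' := fun L L' => by
        simp only [ContinuousLinearMap.add_comp, map_add, Prod.mk_add_mk, neg_add]
      map_smul' := fun c L => by
        simp [ContinuousLinearMap.smul_comp] } 1
    (fun L => by
      simp only [LinearMap.coe_mk, AddHom.coe_mk, one_mul, Prod.norm_mk, norm_neg,
        LinearIsometryEquiv.norm_map]
      refine max_le ?_ ?_
      · refine ContinuousLinearMap.opNorm_le_bound _ (norm_nonneg _) fun x => ?_
        simpa using L.le_opNorm (0, x)
      · refine ContinuousLinearMap.opNorm_le_bound _ (norm_nonneg _) fun x => ?_
        simpa using L.le_opNorm (x, 0))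

theorem norm_symplecticSharp_le : ‖symplecticSharp‖ ≤ 1 :=
  LinearMap.mkContinuous_norm_le _ zero_le_one _

theorem hamField_eq {H : Phase → ℝ} {z : Phase} (hH : DifferentiableAt ℝ H z) :
    hamField H z = symplecticSharp (fderiv ℝ H z) := by
  refine Prod.ext ?_ ?_
  · refine ext_inner_right ℝ fun e => ?_
    rw [hamField, inner_gradV hH]
    simp [symplecticSharp]
  · refine ext_inner_right ℝ fun e => ?_
    rw [hamField, inner_neg_left, inner_gradX hH]
    simp [symplecticSharp]

section Field

variable {H : Phase → ℝ} {ε₁ ε₂ : ℝ}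

theorem norm_hamField_le (hH : Differentiable ℝ H) (h1 : ∀ z, ‖fderiv ℝ H z‖ ≤ ε₁) (z : Phase) :
    ‖hamField H z‖ ≤ ε₁ := by
  rw [hamField_eq (hH z)]
  exact (symplecticSharp.le_of_opNorm_le norm_symplecticSharp_le _).trans (by simpa using h1 z)

theorem hasFDerivAt_hamField (hH : ContDiff ℝ 2 H) (z : Phase) :
    HasFDerivAt (hamField H) (symplecticSharp.comp (fderiv ℝ (fderiv ℝ H) z)) z := by
  have e : hamField H = fun z => symplecticSharp (fderiv ℝ H z) :=
    funext fun z => hamField_eq (hH.differentiable (by norm_num) z)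
  rw [e]
  exact symplecticSharp.hasFDerivAt.comp z
    (((hH.fderiv_right (m := 1) (by norm_num)).differentiable (by norm_num)) z).hasFDerivAt

theorem contDiff_hamField (hH : ContDiff ℝ 2 H) : ContDiff ℝ 1 (hamField H) := by
  have e : hamField H = fun z => symplecticSharp (fderiv ℝ H z) :=
    funext fun z => hamField_eq (hH.differentiable (by norm_num) z)
  rw [e]
  exact symplecticSharp.contDiff.comp (hH.fderiv_right (m := 1) (by norm_num))

theorem norm_fderiv_hamField_le (hH : ContDiff ℝ 2 H)
    (h2 : ∀ z, ‖fderiv ℝ (fderiv ℝ H) z‖ ≤ ε₂) (z : Phase) :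
    ‖fderiv ℝ (hamField H) z‖ ≤ ε₂ := by
  rw [(hasFDerivAt_hamField hH z).fderiv]
  refine (ContinuousLinearMap.opNorm_comp_le _ _).trans ?_
  calc _ ≤ 1 * ‖fderiv ℝ (fderiv ℝ H) z‖ := by gcongr; exact norm_symplecticSharp_le
    _ ≤ ε₂ := by simpa using h2 z

theorem lipschitzWith_hamField (hH : ContDiff ℝ 2 H)
    (h2 : ∀ z, ‖fderiv ℝ (fderiv ℝ H) z‖ ≤ ε₂) : LipschitzWith ε₂.toNNReal (hamField H) := by
  refine lipschitzWith_of_nnnorm_fderiv_le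
    (fun z => (hasFDerivAt_hamField hH z).differentiableAt) fun z => ?_
  rw [← NNReal.coe_le_coe, coe_nnnorm]
  exact (norm_fderiv_hamField_le hH h2 z).trans (Real.le_coe_toNNReal _)

/-- The Poisson bracket in coordinates, the form in which integration by parts can be applied term
by term. -/
theorem apply_hamField {H : Phase → ℝ} {z : Phase} (hH : DifferentiableAt ℝ H z)
    (L : Phase →L[ℝ] ℝ) :
    L (hamField H z) = ∑ i : Fin 3,
      (L (EuclideanSpace.basisFun (Fin 3) ℝ i, 0) *
          fderiv ℝ H z (0, EuclideanSpace.basisFun (Fin 3) ℝ i)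
        - L (0, EuclideanSpace.basisFun (Fin 3) ℝ i) *
          fderiv ℝ H z (EuclideanSpace.basisFun (Fin 3) ℝ i, 0)) := by
  set e := EuclideanSpace.basisFun (Fin 3) ℝ with he
  have hV : gradV H z = ∑ i, fderiv ℝ H z (0, e i) • e i := by
    conv_lhs => rw [← e.sum_repr' (gradV H z)]
    simp_rw [real_inner_comm, inner_gradV hH]
  have hX : gradX H z = ∑ i, fderiv ℝ H z (e i, 0) • e i := by
    conv_lhs => rw [← e.sum_repr' (gradX H z)]
    simp_rw [real_inner_comm, inner_gradX hH]
  have hsplit : hamField H z = ContinuousLinearMap.inl ℝ R3 R3 (gradV H z)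
      - ContinuousLinearMap.inr ℝ R3 R3 (gradX H z) := by
    simp [hamField]
  rw [hsplit, map_sub, hV, hX]
  simp only [map_sum, map_smul, smul_eq_mul, Finset.sum_sub_distrib,
    ContinuousLinearMap.inl_apply, ContinuousLinearMap.inr_apply, mul_comm]

/-- The Hamiltonian vector field is divergence free. -/
theorem integral_fderiv_hamField_eq_zero (hH : ContDiff ℝ 2 H)
    (h1 : ∀ z, ‖fderiv ℝ H z‖ ≤ ε₁) (h2 : ∀ z, ‖fderiv ℝ (fderiv ℝ H) z‖ ≤ ε₂)
    (D : ℝ≥0) (G : Phase → ℝ) (hG : LipschitzWith D G) (hGc : HasCompactSupport G) :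
    ∫ z, fderiv ℝ G z (hamField H z) = 0 := by
  set e := EuclideanSpace.basisFun (Fin 3) ℝ with he
  have hHd := hH.differentiable (by norm_num)
  have hH1 : ContDiff ℝ 1 (fderiv ℝ H) := hH.fderiv_right (m := 1) (by norm_num)
  have hH2 := hH1.differentiable (by norm_num)
  have hfd : ∀ w z, HasFDerivAt (fun z => fderiv ℝ H z w)
      ((fderiv ℝ (fderiv ℝ H) z).flip w) z := fun w z =>
    ((ContinuousLinearMap.apply ℝ ℝ w).hasFDerivAt.comp z (hH2 z).hasFDerivAt :)
  have hlip : ∀ w, LipschitzWith (ε₂ * ‖w‖).toNNReal fun z => fderiv ℝ H z w := fun w => by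
    refine lipschitzWith_of_nnnorm_fderiv_le (fun z => (hfd w z).differentiableAt) fun z => ?_
    rw [← NNReal.coe_le_coe, coe_nnnorm, (hfd w z).fderiv]
    refine le_trans ?_ (Real.le_coe_toNNReal _)
    refine (ContinuousLinearMap.le_opNorm _ _).trans ?_
    rw [ContinuousLinearMap.opNorm_flip]
    gcongr
    exact h2 z
  have hint : ∀ v w, Integrable fun z => fderiv ℝ G z v * fderiv ℝ H z w := fun v w => by
    obtain ⟨R, -, hR⟩ := exists_radius_of_hasCompactSupport
      ((hGc.fderiv (𝕜 := ℝ)))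
    refine integrable_of_bounded_of_vanish (C := D * ‖v‖ * (ε₁ * ‖w‖)) (R := R) ?_ ?_ ?_
    · exact (((measurable_fderiv_apply_const ℝ G v).mul
        (measurable_fderiv_apply_const ℝ H w))).aestronglyMeasurable
    · refine Eventually.of_forall fun z => ?_
      rw [norm_mul]
      have e1 : ‖fderiv ℝ G z v‖ ≤ D * ‖v‖ :=
        ContinuousLinearMap.le_of_opNorm_le _ (norm_fderiv_le_of_lipschitz ℝ hG) v
      have e2 : ‖fderiv ℝ H z w‖ ≤ ε₁ * ‖w‖ :=
        ContinuousLinearMap.le_of_opNorm_le _ (h1 z) w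
      gcongr
    · intro z hz
      simp [hR z hz]
  -- The derivative is moved from `G` onto `∂_w H`, which is Lipschitz by the Hessian bound. For `G`
  -- itself, Rademacher's theorem identifies line derivatives with `fderiv` almost everywhere.
  have hparts : ∀ v w, ∫ z, fderiv ℝ G z v * fderiv ℝ H z w
      = - ∫ z, fderiv ℝ (fderiv ℝ H) z v w * G z := fun v w => by
    have := LipschitzWith.integral_lineDeriv_mul_eq (μ := volume) (hlip w) hG hGc v
    have e1 : ∀ z, lineDeriv ℝ (fun z => fderiv ℝ H z w) z v
        = fderiv ℝ (fderiv ℝ H) z v w := fun z => by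
      rw [(hfd w z).differentiableAt.lineDeriv_eq_fderiv, (hfd w z).fderiv]
      rfl
    simp only [e1] at this
    rw [this, ← integral_neg]
    refine integral_congr_ae ?_
    filter_upwards [hG.ae_differentiableAt (μ := volume)] with z hz
    rw [hz.lineDeriv_eq_fderiv]
    simp
  simp_rw [fun z => apply_hamField (hHd z)]
  rw [integral_finsetSum]
  swap
  · exact fun i _ => (hint _ _).sub (hint _ _)
  refine Finset.sum_eq_zero fun i _ => ?_
  -- Both terms now contain a mixed second derivative of `H`, in opposite orders; they cancel by
  -- symmetry.
  rw [integral_sub (hint _ _) (hint _ _), hparts, hparts, sub_eq_zero]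
  congr 2
  ext z
  congr 1
  exact (hH.contDiffAt.isSymmSndFDerivAt (by simp)) _ _

theorem IsHamiltonianFlow.isFlow {Φ : ℝ → Phase → Phase} (h : IsHamiltonianFlow H Φ) :
    IsFlow (hamField H) Φ :=
  ⟨fun z => (h z).1, fun z => (h z).2⟩

/-- Liouville's theorem: a Hamiltonian flow preserves the Lebesgue measure. -/
theorem IsHamiltonianFlow.measurePreserving {Φ : ℝ → Phase → Phase} (h : IsHamiltonianFlow H Φ)
    (hH : ContDiff ℝ 2 H) (h1 : ∀ z, ‖fderiv ℝ H z‖ ≤ ε₁)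
    (h2 : ∀ z, ‖fderiv ℝ (fderiv ℝ H) z‖ ≤ ε₂) (t : ℝ) :
    MeasurePreserving (Φ t) volume volume :=
  h.isFlow.measurePreserving (lipschitzWith_hamField hH h2)
    (norm_hamField_le (hH.differentiable (by norm_num)) h1)
    (integral_fderiv_hamField_eq_zero hH h1 h2) t

end Field

/-! ### First and second differences along a flow -/

theorem enorm_sub_le_lintegral_deriv {γ γ' : ℝ → ℝ} (h : ∀ s, HasDerivAt γ (γ' s) s)
    (hc : Continuous γ') {a b : ℝ} (ha : a ∈ Icc (0 : ℝ) 1) (hb : b ∈ Icc (0 : ℝ) 1) :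
    ‖γ b - γ a‖ₑ ≤ ∫⁻ s in Icc (0 : ℝ) 1, ‖γ' s‖ₑ := by
  rw [← intervalIntegral.integral_eq_sub_of_hasDerivAt (fun s _ => h s)
    (hc.intervalIntegrable a b), intervalIntegral.intervalIntegral_eq_integral_uIoc, enorm_smul]
  have : ‖(if a ≤ b then (1 : ℝ) else -1)‖ₑ = 1 := by split_ifs <;> simp
  rw [this, one_mul]
  refine (enorm_integral_le_lintegral_enorm _).trans (lintegral_mono_set ?_)
  exact uIoc_subset_uIcc.trans (uIcc_subset_Icc ha hb)

/-- Trapezoidal second difference of a `C²` function of time. -/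
theorem enorm_second_difference_le {γ γ' γ'' : ℝ → ℝ} (h : ∀ s, HasDerivAt γ (γ' s) s)
    (h' : ∀ s, HasDerivAt γ' (γ'' s) s) (hc : Continuous γ'') {s : ℝ} (hs : s ∈ Icc (0 : ℝ) 1) :
    ‖γ s + γ (1 - s) - γ 0 - γ 1‖ₑ ≤ ∫⁻ τ in Icc (0 : ℝ) 1, ‖γ'' τ‖ₑ := by
  have hγc : Continuous γ := continuous_iff_continuousAt.2 fun s => (h s).continuousAt
  rcases hs.1.eq_or_lt with rfl | h0
  · simp
  -- Mean value theorem on `[0, s]` and `[1 - s, 1]`. Both intervals have length `s`, so the second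
  -- difference is `s` times a difference of values of `γ'`, controlled by the integral of `γ''`.
  obtain ⟨a, ha, hae⟩ := exists_hasDerivAt_eq_slope γ γ' h0 hγc.continuousOn fun x _ => h x
  obtain ⟨b, hb, hbe⟩ := exists_hasDerivAt_eq_slope γ γ' (show 1 - s < 1 by linarith)
    hγc.continuousOn fun x _ => h x
  have e : γ s + γ (1 - s) - γ 0 - γ 1 = s * (γ' a - γ' b) := by
    rw [hae, hbe, sub_zero, sub_sub_cancel, ← sub_div, mul_div_cancel₀ _ h0.ne']; ring
  have hs1 : ‖s‖ₑ ≤ 1 := by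
    rw [← ofReal_norm, Real.norm_of_nonneg hs.1]
    exact ENNReal.ofReal_le_one.2 hs.2
  rw [e, enorm_mul]
  calc _ ≤ 1 * ‖γ' a - γ' b‖ₑ := by gcongr
    _ ≤ _ := by
      rw [one_mul]
      exact enorm_sub_le_lintegral_deriv h' hc ⟨by linarith [hb.1, hs.2], hb.2.le⟩
        ⟨ha.1.le, ha.2.le.trans hs.2⟩

namespace IsFlow

variable {E : Type*} [NormedAddCommGroup E] [NormedSpace ℝ E]
  {b : E → E} {Φ : ℝ → E → E} {K : ℝ≥0} {M ε : ℝ}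

theorem hasDerivAt_comp (h : IsFlow b Φ) {F : E → ℝ} (hF : Differentiable ℝ F) (z : E) (s : ℝ) :
    HasDerivAt (fun t => F (Φ t z)) (fderiv ℝ F (Φ s z) (b (Φ s z))) s :=
  (hF (Φ s z)).hasFDerivAt.comp_hasDerivAt s (h.deriv z s)

theorem continuous_time (h : IsFlow b Φ) (z : E) : Continuous fun t => Φ t z :=
  continuous_iff_continuousAt.2 fun s => (h.deriv z s).continuousAt

variable [FiniteDimensional ℝ E] [MeasurableSpace E] [BorelSpace E] {μ : Measure E}
  [μ.IsAddHaarMeasure]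

theorem lintegral_lintegral_comp_swap (h : IsFlow b Φ) (hb : LipschitzWith K b)
    (hM : ∀ z, ‖b z‖ ≤ M) {w g : E → ℝ≥0∞} (hw : Measurable w) (hg : Measurable g) :
    ∫⁻ z, w z * (∫⁻ s in Icc (0 : ℝ) 1, g (Φ s z)) ∂μ
      = ∫⁻ s in Icc (0 : ℝ) 1, ∫⁻ z, w z * g (Φ s z) ∂μ := by
  have hΦ := (h.continuous_uncurry hb hM).measurable
  have hm : Measurable fun p : E × ℝ => w p.1 * g (Φ p.2 p.1) :=
    (hw.comp measurable_fst).mul (hg.comp (hΦ.comp measurable_swap))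
  rw [← lintegral_lintegral_swap hm.aemeasurable]
  refine lintegral_congr fun z => ?_
  rw [lintegral_const_mul]
  exact hg.comp (hΦ.comp (measurable_id.prodMk measurable_const))

/-- Weighted `L¹` bound of the displacement of a `C¹` function by a flow. -/
theorem lintegral_mul_enorm_comp_sub_le (h : IsFlow b Φ) (hb : LipschitzWith K b)
    (hM : ∀ z, ‖b z‖ ≤ M) {F : E → ℝ} (hF : ContDiff ℝ 1 F) {w : E → ℝ≥0∞} (hw : Measurable w)
    {A : ℝ≥0∞}
    (hA : ∀ s ∈ Icc (0 : ℝ) 1, ∫⁻ z, w z * ‖fderiv ℝ F (Φ s z)‖ₑ ∂μ ≤ A) :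
    ∫⁻ z, w z * ‖F (Φ 1 z) - F z‖ₑ ∂μ ≤ ENNReal.ofReal M * A := by
  have hF1 : Continuous (fderiv ℝ F) := hF.continuous_fderiv (by norm_num)
  have hpt : ∀ z, ‖F (Φ 1 z) - F z‖ₑ
      ≤ ENNReal.ofReal M * ∫⁻ s in Icc (0 : ℝ) 1, ‖fderiv ℝ F (Φ s z)‖ₑ := fun z => by
    have hc : Continuous fun s => fderiv ℝ F (Φ s z) (b (Φ s z)) :=
      (hF1.comp (h.continuous_time z)).clm_apply (hb.continuous.comp (h.continuous_time z))
    have := enorm_sub_le_lintegral_deriv (h.hasDerivAt_comp (hF.differentiable (by norm_num)) z)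
      hc (left_mem_Icc.2 zero_le_one) (right_mem_Icc.2 zero_le_one)
    rw [h.zero] at this
    refine this.trans ?_
    have hm : Measurable fun s => ‖fderiv ℝ F (Φ s z)‖ₑ :=
      (hF1.comp (h.continuous_time z)).enorm.measurable
    rw [← lintegral_const_mul _ hm]
    refine lintegral_mono fun s => ?_
    simp only [← ofReal_norm]
    rw [← ENNReal.ofReal_mul ((norm_nonneg _).trans (hM 0))]
    apply ENNReal.ofReal_le_ofReal
    refine (ContinuousLinearMap.le_opNorm _ _).trans ?_
    rw [mul_comm]
    gcongr
    exact hM _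
  have hg : Measurable fun z => ‖fderiv ℝ F z‖ₑ := hF1.enorm.measurable
  have hm : Measurable fun z => w z * ∫⁻ s in Icc (0 : ℝ) 1, ‖fderiv ℝ F (Φ s z)‖ₑ := by
    refine hw.mul (Measurable.lintegral_prod_right' (ν := volume.restrict (Icc (0 : ℝ) 1))
      (f := fun p : E × ℝ => ‖fderiv ℝ F (Φ p.2 p.1)‖ₑ) ?_)
    exact hg.comp ((h.continuous_uncurry hb hM).measurable.comp measurable_swap)
  calc _ ≤ ∫⁻ z, ENNReal.ofReal M *
        (w z * ∫⁻ s in Icc (0 : ℝ) 1, ‖fderiv ℝ F (Φ s z)‖ₑ) ∂μ := by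
        refine lintegral_mono fun z => ?_
        calc _ ≤ _ := mul_le_mul_right (hpt z) (w z)
          _ = _ := by ring
    _ = ENNReal.ofReal M * ∫⁻ s in Icc (0 : ℝ) 1, ∫⁻ z, w z * ‖fderiv ℝ F (Φ s z)‖ₑ ∂μ := by
        rw [lintegral_const_mul _ hm, h.lintegral_lintegral_comp_swap hb hM hw hg]
    _ ≤ ENNReal.ofReal M * ∫⁻ s in Icc (0 : ℝ) 1, A := by
        gcongr _ * ?_
        exact setLIntegral_mono measurable_const hA
    _ = _ := by simp

/-- `L¹` bound of the second difference of a `C²` function moved by a measure preserving flow. -/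
theorem lintegral_enorm_second_difference_le (h : IsFlow b Φ) (hb : LipschitzWith K b)
    (hM : ∀ z, ‖b z‖ ≤ M) (hb1 : ContDiff ℝ 1 b) (hε : ∀ z, ‖fderiv ℝ b z‖ ≤ ε)
    (hmp : ∀ t, MeasurePreserving (Φ t) μ μ) {F : E → ℝ} (hF : ContDiff ℝ 2 F)
    {s : ℝ} (hs : s ∈ Icc (0 : ℝ) 1) :
    ∫⁻ z, ‖F (Φ s z) + F (Φ (1 - s) z) - F z - F (Φ 1 z)‖ₑ ∂μ
      ≤ ENNReal.ofReal (M ^ 2) * ∫⁻ z, ‖fderiv ℝ (fderiv ℝ F) z‖ₑ ∂μ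
        + ENNReal.ofReal (M * ε) * ∫⁻ z, ‖fderiv ℝ F z‖ₑ ∂μ := by
  have hM0 : 0 ≤ M := (norm_nonneg _).trans (hM 0)
  have hε0 : 0 ≤ ε := (norm_nonneg _).trans (hε 0)
  have hF1 : ContDiff ℝ 1 (fderiv ℝ F) := hF.fderiv_right (by norm_num)
  -- `g` is the rate of change of `F` along trajectories. Its own rate consists of a Hessian term of
  -- size `M²` and a term of size `M * ε` from the derivative of `b`.
  set g : E → ℝ := fun z => fderiv ℝ F z (b z) with hgdef
  have hg : ContDiff ℝ 1 g := hF1.clm_apply hb1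
  have hg1 : Continuous (fderiv ℝ g) := hg.continuous_fderiv (by norm_num)
  have hgb : Continuous fun z => fderiv ℝ g z (b z) := hg1.clm_apply hb.continuous
  have hpt : ∀ z, ‖F (Φ s z) + F (Φ (1 - s) z) - F z - F (Φ 1 z)‖ₑ
      ≤ ∫⁻ τ in Icc (0 : ℝ) 1, ‖fderiv ℝ g (Φ τ z) (b (Φ τ z))‖ₑ := fun z => by
    have := enorm_second_difference_le
      (h.hasDerivAt_comp (hF.differentiable (by norm_num)) z)
      (h.hasDerivAt_comp (hg.differentiable (by norm_num)) z)
      (hgb.comp (h.continuous_time z)) hs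
    simpa only [h.zero] using this
  have hgbound : ∀ z, ‖fderiv ℝ g z (b z)‖ₑ ≤
      ENNReal.ofReal (M ^ 2) * ‖fderiv ℝ (fderiv ℝ F) z‖ₑ
        + ENNReal.ofReal (M * ε) * ‖fderiv ℝ F z‖ₑ := fun z => by
    have e : fderiv ℝ g z (b z) = fderiv ℝ F z (fderiv ℝ b z (b z))
        + fderiv ℝ (fderiv ℝ F) z (b z) (b z) := by
      rw [hgdef, fderiv_clm_apply (hF1.differentiable (by norm_num) z)
        (hb1.differentiable (by norm_num) z)]
      simp
    simp only [← ofReal_norm]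
    rw [← ENNReal.ofReal_mul (by positivity), ← ENNReal.ofReal_mul (by positivity),
      ← ENNReal.ofReal_add (by positivity) (by positivity)]
    apply ENNReal.ofReal_le_ofReal
    rw [e, add_comm]
    refine (norm_add_le _ _).trans (add_le_add ?_ ?_)
    · calc _ ≤ ‖fderiv ℝ (fderiv ℝ F) z‖ * ‖b z‖ * ‖b z‖ :=
            ContinuousLinearMap.le_opNorm₂ _ _ _
        _ ≤ ‖fderiv ℝ (fderiv ℝ F) z‖ * M * M := by
            gcongr <;> exact hM z
        _ = _ := by ring
    · calc _ ≤ ‖fderiv ℝ F z‖ * ‖fderiv ℝ b z (b z)‖ := ContinuousLinearMap.le_opNorm _ _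
        _ ≤ ‖fderiv ℝ F z‖ * (ε * M) := by
            gcongr
            refine (ContinuousLinearMap.le_opNorm _ _).trans ?_
            gcongr
            · exact hε z
            · exact hM z
        _ = _ := by ring
  have hswap := h.lintegral_lintegral_comp_swap (μ := μ) hb hM (w := fun _ => 1)
    (g := fun z => ‖fderiv ℝ g z (b z)‖ₑ) measurable_const hgb.enorm.measurable
  simp only [one_mul] at hswap
  calc _ ≤ _ := lintegral_mono hpt
    _ = ∫⁻ τ in Icc (0 : ℝ) 1, ∫⁻ z, ‖fderiv ℝ g z (b z)‖ₑ ∂μ := by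
        rw [hswap]
        -- Invariance of the measure makes the inner integral independent of `τ`.
        refine lintegral_congr fun τ => ?_
        exact (hmp τ).lintegral_comp (f := fun z => ‖fderiv ℝ g z (b z)‖ₑ) hgb.enorm.measurable
    _ = ∫⁻ z, ‖fderiv ℝ g z (b z)‖ₑ ∂μ := by simp
    _ ≤ ∫⁻ z, (ENNReal.ofReal (M ^ 2) * ‖fderiv ℝ (fderiv ℝ F) z‖ₑ
        + ENNReal.ofReal (M * ε) * ‖fderiv ℝ F z‖ₑ) ∂μ := lintegral_mono hgbound
    _ = _ := by
        have m1 : Measurable fun z => ‖fderiv ℝ F z‖ₑ := hF1.continuous.enorm.measurable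
        have m2 : Measurable fun z => ‖fderiv ℝ (fderiv ℝ F) z‖ₑ :=
          (hF1.continuous_fderiv (by norm_num)).enorm.measurable
        rw [lintegral_add_left (m2.const_mul _), lintegral_const_mul _ m2,
          lintegral_const_mul _ m1]

/-- Fatou's lemma. Almost everywhere convergence also holds at the moved points because the flow
pulls null sets back to null sets. -/
theorem lintegral_mul_enorm_comp_sub_le_of_tendsto (h : IsFlow b Φ) (hb : LipschitzWith K b)
    (hM : ∀ z, ‖b z‖ ≤ M) (hmp : ∀ t, MeasurePreserving (Φ t) μ μ)
    {F : ℕ → E → ℝ} {f : E → ℝ} (hF : ∀ n, ContDiff ℝ 1 (F n))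
    (hlim : ∀ᵐ z ∂μ, Tendsto (fun n => F n z) atTop (𝓝 (f z)))
    {w : E → ℝ≥0∞} (hw : Measurable w) {A : ℝ≥0∞}
    (hA : ∀ n, ∀ s ∈ Icc (0 : ℝ) 1, ∫⁻ z, w z * ‖fderiv ℝ (F n) (Φ s z)‖ₑ ∂μ ≤ A)
    (hwt : ∀ᵐ z ∂μ, w z ≠ ⊤) :
    ∫⁻ z, w z * ‖f (Φ 1 z) - f z‖ₑ ∂μ ≤ ENNReal.ofReal M * A := by
  have hc := (h.lipschitz hb 1).continuous
  calc _ = ∫⁻ z, liminf (fun n => w z * ‖F n (Φ 1 z) - F n z‖ₑ) atTop ∂μ := by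
        refine lintegral_congr_ae ?_
        filter_upwards [hlim, (hmp 1).quasiMeasurePreserving.ae hlim, hwt] with z h1 h2 h3
        symm
        apply Tendsto.liminf_eq
        exact ENNReal.Tendsto.const_mul ((continuous_enorm.tendsto _).comp (h2.sub h1)) (Or.inr h3)
    _ ≤ liminf (fun n => ∫⁻ z, w z * ‖F n (Φ 1 z) - F n z‖ₑ ∂μ) atTop := by
        refine lintegral_liminf_le fun n => hw.mul ?_
        exact (((hF n).continuous.comp hc).sub (hF n).continuous).enorm.measurable
    _ ≤ _ := liminf_le_of_le (by isBoundedDefault) fun a ha => by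
        obtain ⟨n, hn⟩ := ha.exists
        exact hn.trans (h.lintegral_mul_enorm_comp_sub_le hb hM (hF n) hw (hA n))

theorem lintegral_enorm_second_difference_le_of_tendsto (h : IsFlow b Φ) (hb : LipschitzWith K b)
    (hM : ∀ z, ‖b z‖ ≤ M) (hb1 : ContDiff ℝ 1 b) (hε : ∀ z, ‖fderiv ℝ b z‖ ≤ ε)
    (hmp : ∀ t, MeasurePreserving (Φ t) μ μ)
    {F : ℕ → E → ℝ} {f : E → ℝ} (hF : ∀ n, ContDiff ℝ 2 (F n))
    (hlim : ∀ᵐ z ∂μ, Tendsto (fun n => F n z) atTop (𝓝 (f z))) {A B : ℝ≥0∞}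
    (hA : ∀ n, ∫⁻ z, ‖fderiv ℝ (F n) z‖ₑ ∂μ ≤ A)
    (hB : ∀ n, ∫⁻ z, ‖fderiv ℝ (fderiv ℝ (F n)) z‖ₑ ∂μ ≤ B)
    {s : ℝ} (hs : s ∈ Icc (0 : ℝ) 1) :
    ∫⁻ z, ‖f (Φ s z) + f (Φ (1 - s) z) - f z - f (Φ 1 z)‖ₑ ∂μ
      ≤ ENNReal.ofReal (M ^ 2) * B + ENNReal.ofReal (M * ε) * A := by
  have hc := fun t => (h.lipschitz hb t).continuous
  calc _ = ∫⁻ z, liminf (fun n =>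
        ‖F n (Φ s z) + F n (Φ (1 - s) z) - F n z - F n (Φ 1 z)‖ₑ) atTop ∂μ := by
        refine lintegral_congr_ae ?_
        filter_upwards [hlim, (hmp 1).quasiMeasurePreserving.ae hlim,
          (hmp s).quasiMeasurePreserving.ae hlim,
          (hmp (1 - s)).quasiMeasurePreserving.ae hlim] with z h1 h2 h3 h4
        symm
        apply Tendsto.liminf_eq
        exact (continuous_enorm.tendsto _).comp (((h3.add h4).sub h1).sub h2)
    _ ≤ liminf (fun n => ∫⁻ z,
        ‖F n (Φ s z) + F n (Φ (1 - s) z) - F n z - F n (Φ 1 z)‖ₑ ∂μ) atTop := by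
        refine lintegral_liminf_le fun n => ?_
        have hFc := (hF n).continuous
        exact ((((hFc.comp (hc s)).add (hFc.comp (hc (1 - s)))).sub hFc).sub
          (hFc.comp (hc 1))).enorm.measurable
    _ ≤ _ := liminf_le_of_le (by isBoundedDefault) fun a ha => by
        obtain ⟨n, hn⟩ := ha.exists
        refine hn.trans ((h.lintegral_enorm_second_difference_le hb hM hb1 hε hmp (hF n) hs).trans
          ?_)
        gcongr
        · exact hB n
        · exact hA n

end IsFlow

/-! ### Mollification of Sobolev functions -/

instance : (volume : Measure Phase).IsNegInvariant :=
  Measure.IsAddHaarMeasure.isNegInvariant_of_regular _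

/-- The convolution of `f` with the kernel `η` on phase space. -/
def mollify (η f : Phase → ℝ) (z : Phase) : ℝ := ∫ t, f t * η (z - t)

section Mollify

variable {η f g : Phase → ℝ}

theorem mollify_eq_convolution :
    mollify η f = MeasureTheory.convolution f η (ContinuousLinearMap.mul ℝ ℝ) volume := rfl

theorem contDiff_mollify (hη : ContDiff ℝ ∞ η) (hηc : HasCompactSupport η)
    (hf : LocallyIntegrable f) : ContDiff ℝ ∞ (mollify η f) := by
  rw [mollify_eq_convolution]
  exact hηc.contDiff_convolution_right _ hf hη

/-- The reflected translate `t ↦ η (z - t)` is a test function for the weak derivative. The sign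
from the reflection cancels the sign from integration by parts. -/
theorem fderiv_mollify (hη : ContDiff ℝ ∞ η) (hηc : HasCompactSupport η) {e : Phase}
    (h : HasWeakDeriv e f g) (z : Phase) : fderiv ℝ (mollify η f) z e = mollify η g z := by
  have hη1 : ContDiff ℝ 1 η := hη.of_le (by exact_mod_cast le_top)
  rw [mollify_eq_convolution, (hηc.hasFDerivAt_convolution_right
    (ContinuousLinearMap.mul ℝ ℝ) h.1 hη1 z).fderiv, convolution_precompR_apply _ h.1
      (hηc.fderiv ℝ) (hη1.continuous_fderiv one_ne_zero), convolution_mul]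
  have hψ : ContDiff ℝ ∞ fun t => η (z - t) := hη.comp (contDiff_const.sub contDiff_id)
  have hψc : HasCompactSupport fun t => η (z - t) :=
    hηc.comp_homeomorph (Homeomorph.subLeft z)
  have hd : ∀ t, fderiv ℝ (fun t => η (z - t)) t e = - fderiv ℝ η (z - t) e := fun t => by
    have := (hη1.differentiable one_ne_zero (z - t)).hasFDerivAt.comp t
      ((hasFDerivAt_const z t).sub (hasFDerivAt_id t))
    rw [show (fun t => η (z - t)) = η ∘ HSub.hSub z by rfl, this.fderiv]
    simp
  have := h.2.2 _ hψ hψc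
  simp only [hd, mul_neg, integral_neg, neg_inj] at this
  exact this

theorem mollify_eq_zero {R : ℝ} (hη : ∀ z, 1 < ‖z‖ → η z = 0) (hf : ∀ z, R < ‖z‖ → f z = 0)
    {z : Phase} (hz : R + 1 < ‖z‖) : mollify η f z = 0 := by
  rw [mollify, integral_eq_zero_of_ae]
  refine Eventually.of_forall fun t => ?_
  rcases lt_or_ge R ‖t‖ with ht | ht
  · simp [hf t ht]
  · have : 1 < ‖z - t‖ := by linarith [norm_sub_norm_le z t]
    simp [hη _ this]

/-- Jensen's inequality: `η (z - ·)` is a probability density, and `L^p` means increase with the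
exponent. -/
theorem enorm_mollify_rpow_le (hη : Continuous η) (hη0 : ∀ z, 0 ≤ η z) (hη1 : ∫ z, η z = 1)
    (hηc : HasCompactSupport η) (hg : AEStronglyMeasurable g) {p : ℝ} (hp : 1 ≤ p) (z : Phase) :
    ‖mollify η g z‖ₑ ^ p ≤ ∫⁻ t, ‖η (z - t)‖ₑ * ‖g t‖ₑ ^ p := by
  set w : Phase → ℝ≥0∞ := fun t => ‖η (z - t)‖ₑ with hw
  have hwm : Measurable w := (hη.comp (continuous_const.sub continuous_id)).enorm.measurable
  have hw1 : ∫⁻ t, w t = 1 := by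
    have e : ∫⁻ t, w t = ∫⁻ t, ‖η t‖ₑ := lintegral_sub_left_eq_self (fun t => ‖η t‖ₑ) z
    rw [e, ← ofReal_integral_norm_eq_lintegral_enorm (hη.integrable_of_hasCompactSupport hηc)]
    simp [Real.norm_of_nonneg (hη0 _), hη1]
  have hprob : IsProbabilityMeasure (volume.withDensity w) := ⟨by simp [hw1]⟩
  have hgν : AEStronglyMeasurable g (volume.withDensity w) :=
    hg.mono_ac (withDensity_absolutelyContinuous _ _)
  have key := eLpNorm'_le_eLpNorm'_of_exponent_le (one_pos) hp (volume.withDensity w) hgν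
  have hp0 : 0 < p := by linarith
  rw [eLpNorm', eLpNorm', one_div_one, ENNReal.rpow_one, one_div,
    ENNReal.le_rpow_inv_iff hp0] at key
  simp only [ENNReal.rpow_one] at key
  rw [lintegral_withDensity_eq_lintegral_mul₀ hwm.aemeasurable hg.enorm,
    lintegral_withDensity_eq_lintegral_mul₀ hwm.aemeasurable (hg.enorm.pow_const p)] at key
  refine le_trans ?_ key
  gcongr
  refine (enorm_integral_le_lintegral_enorm _).trans (le_of_eq ?_)
  refine lintegral_congr fun t => ?_
  rw [enorm_mul, mul_comm]
  rfl

/-- After Jensen, Tonelli lets the kernel integrate to one in `z`. The radius grows by one because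
the kernel lives in the unit ball. -/
theorem lintegral_enorm_mollify_rpow_le (hη : Continuous η) (hη0 : ∀ z, 0 ≤ η z)
    (hη1 : ∫ z, η z = 1) (hηs : ∀ z, 1 < ‖z‖ → η z = 0) (hg : AEStronglyMeasurable g) {p : ℝ}
    (hp : 1 ≤ p) (R : ℝ) :
    ∫⁻ z in closedBall 0 R, ‖mollify η g z‖ₑ ^ p
      ≤ ∫⁻ z in closedBall 0 (R + 1), ‖g z‖ₑ ^ p := by
  have hηc : HasCompactSupport η :=
    HasCompactSupport.intro (isCompact_closedBall 0 1) fun z hz => hηs z (by simpa using hz)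
  set G : Phase → ℝ≥0∞ := (closedBall 0 (R + 1)).indicator fun t => ‖g t‖ₑ ^ p with hG
  have hGm : AEMeasurable G := (hg.enorm.pow_const p).indicator measurableSet_closedBall
  have e1 : ∀ t, ∫⁻ z, ‖η (z - t)‖ₑ = 1 := fun t => by
    rw [lintegral_sub_right_eq_self (fun z => ‖η z‖ₑ) t,
      ← ofReal_integral_norm_eq_lintegral_enorm (hη.integrable_of_hasCompactSupport hηc)]
    simp [Real.norm_of_nonneg (hη0 _), hη1]
  calc _ ≤ ∫⁻ z in closedBall 0 R, ∫⁻ t, ‖η (z - t)‖ₑ * G t := by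
        refine setLIntegral_mono_ae' measurableSet_closedBall (Eventually.of_forall fun z hz => ?_)
        refine (enorm_mollify_rpow_le hη hη0 hη1 hηc hg hp z).trans (lintegral_mono fun t => ?_)
        by_cases ht : t ∈ closedBall (0 : Phase) (R + 1)
        · simp only [hG, indicator_of_mem ht]; exact le_rfl
        · have h1 : R + 1 < ‖t‖ := by simpa using ht
          have h2 : ‖z‖ ≤ R := by simpa using hz
          have : 1 < ‖z - t‖ := by
            rw [norm_sub_rev]; linarith [norm_sub_norm_le t z]
          simp [hηs _ this]
    _ ≤ ∫⁻ z, ∫⁻ t, ‖η (z - t)‖ₑ * G t := setLIntegral_le_lintegral _ _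
    _ = ∫⁻ t, ∫⁻ z, ‖η (z - t)‖ₑ * G t := by
        refine lintegral_lintegral_swap ?_
        refine AEMeasurable.mul ?_ hGm.comp_snd
        exact (hη.comp (continuous_fst.sub continuous_snd)).enorm.measurable.aemeasurable
    _ = ∫⁻ t, G t := by
        refine lintegral_congr fun t => ?_
        have hm : Measurable fun z => ‖η (z - t)‖ₑ :=
          (hη.comp (continuous_id.sub continuous_const)).enorm.measurable
        rw [lintegral_mul_const _ hm, e1, one_mul]
    _ = _ := lintegral_indicator measurableSet_closedBall _

end Mollify

/-- Weak derivatives are given direction by direction, so operator norms have to be recovered from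
the values on a basis. -/
theorem exists_enorm_rpow_le_sum {E F : Type*} [NormedAddCommGroup E] [NormedSpace ℝ E]
    [NormedAddCommGroup F] [NormedSpace ℝ F] {ι : Type*} [Fintype ι] (v : Module.Basis ι ℝ E) :
    ∃ C : ℝ≥0, ∀ (u : E →L[ℝ] F) (p : ℝ), 1 ≤ p →
      ‖u‖ₑ ^ p ≤ (C : ℝ≥0∞) ^ p * ∑ i, ‖u (v i)‖ₑ ^ p := by
  obtain ⟨C, hC0, hC⟩ := v.exists_opNorm_le (F := F)
  refine ⟨C.toNNReal, fun u p hp => ?_⟩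
  have hp0 : 0 < p := by linarith
  set S : ℝ := ∑ i, ‖u (v i)‖ ^ p with hS
  have hS0 : 0 ≤ S := Finset.sum_nonneg fun i _ => by positivity
  have h1 : ‖u‖ ≤ C * S ^ p⁻¹ := by
    refine hC (by positivity) fun i => ?_
    rw [Real.le_rpow_inv_iff_of_pos (norm_nonneg _) hS0 hp0]
    exact Finset.single_le_sum (f := fun i => ‖u (v i)‖ ^ p) (fun i _ => by positivity)
      (Finset.mem_univ i)
  have h2 : ‖u‖ ^ p ≤ C ^ p * S := by
    calc ‖u‖ ^ p ≤ (C * S ^ p⁻¹) ^ p := by gcongr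
      _ = C ^ p * S := by
        rw [Real.mul_rpow hC0.le (by positivity), Real.rpow_inv_rpow hS0 hp0.ne']
  have h3 : ‖u‖ₑ ^ p = ENNReal.ofReal (‖u‖ ^ p) := by
    rw [← ofReal_norm, ENNReal.ofReal_rpow_of_nonneg (norm_nonneg _) hp0.le]
  have h4 : ∑ i, ‖u (v i)‖ₑ ^ p = ENNReal.ofReal S := by
    rw [hS, ENNReal.ofReal_sum_of_nonneg fun i _ => by positivity]
    refine Finset.sum_congr rfl fun i _ => ?_
    rw [← ofReal_norm, ENNReal.ofReal_rpow_of_nonneg (norm_nonneg _) hp0.le]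
  have h5 : ((C.toNNReal : ℝ≥0) : ℝ≥0∞) ^ p = ENNReal.ofReal (C ^ p) := by
    rw [← ENNReal.ofReal_rpow_of_nonneg hC0.le hp0.le]; rfl
  rw [h3, h4, h5, ← ENNReal.ofReal_mul (by positivity)]
  exact ENNReal.ofReal_le_ofReal h2

theorem fderiv_eq_zero_of_vanish {E F : Type*} [NormedAddCommGroup E] [NormedSpace ℝ E]
    [NormedAddCommGroup F] [NormedSpace ℝ F] {u : E → F} {R : ℝ}
    (hu : ∀ z, R < ‖z‖ → u z = 0) {z : E} (hz : R < ‖z‖) : fderiv ℝ u z = 0 := by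
  have : u =ᶠ[𝓝 z] fun _ => 0 := by
    filter_upwards [(isOpen_lt continuous_const continuous_norm).mem_nhds hz] with w hw
    exact hu w hw
  rw [this.fderiv_eq]
  simp

theorem enorm_fderiv_eq_zero_of_vanish {E F : Type*} [NormedAddCommGroup E] [NormedSpace ℝ E]
    [NormedAddCommGroup F] [NormedSpace ℝ F] {u : E → F} {R : ℝ}
    (hu : ∀ z, R < ‖z‖ → u z = 0) {z : E} (hz : R < ‖z‖) : ‖fderiv ℝ u z‖ₑ = 0 := by
  rw [fderiv_eq_zero_of_vanish hu hz, ← ofReal_norm]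
  exact ENNReal.ofReal_eq_zero.2 (norm_zero (E := E →L[ℝ] F)).le

theorem lintegral_eq_setLIntegral_closedBall {E : Type*} [NormedAddCommGroup E]
    [MeasurableSpace E] [BorelSpace E] {μ : Measure E} {u : E → ℝ≥0∞} {R : ℝ}
    (hu : ∀ z, R < ‖z‖ → u z = 0) : ∫⁻ z, u z ∂μ = ∫⁻ z in closedBall 0 R, u z ∂μ := by
  rw [← lintegral_indicator measurableSet_closedBall]
  refine lintegral_congr fun z => ?_
  by_cases hz : z ∈ closedBall (0 : E) R
  · rw [indicator_of_mem hz]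
  · rw [indicator_of_notMem hz, hu z (by simpa using hz)]

/-- A smooth approximation of `f`, bounded in `W^{1,p} ∩ W^{2,1}`, supported in a fixed ball. -/
structure SmoothApprox (f : Phase → ℝ) (p R : ℝ) (A : ℝ≥0∞) (F : ℕ → Phase → ℝ) : Prop where
  contDiff : ∀ n, ContDiff ℝ ∞ (F n)
  vanish : ∀ n z, R < ‖z‖ → F n z = 0
  tendsto : ∀ᵐ z, Tendsto (fun n => F n z) atTop (𝓝 (f z))
  fderiv_rpow_le : ∀ n, ∫⁻ z, ‖fderiv ℝ (F n) z‖ₑ ^ p ≤ A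
  fderiv_le : ∀ n, ∫⁻ z, ‖fderiv ℝ (F n) z‖ₑ ≤ A
  fderiv_fderiv_le : ∀ n, ∫⁻ z, ‖fderiv ℝ (fderiv ℝ (F n)) z‖ₑ ≤ A

/-- Mollify with shrinking bumps. Derivatives of the mollification are mollified weak derivatives,
so Jensen bounds them uniformly in `n` by local norms of the weak derivatives. -/
theorem exists_smoothApprox {f : Phase → ℝ} (hsupp : HasCompactSupport f) {q : ℝ≥0∞} (hq : 3 < q)
    (hW : MemW2 f q) : ∃ (p R : ℝ) (A : ℝ≥0∞) (F : ℕ → Phase → ℝ), 3 < p ∧ 0 ≤ R ∧ A ≠ ⊤ ∧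
      SmoothApprox f p R A F := by
  obtain ⟨R, hR0, hR⟩ := exists_radius_of_hasCompactSupport hsupp
  -- The truncation keeps the exponent finite when `q = ∞` and still above `3`; on bounded sets
  -- `L^q` embeds in the smaller exponent.
  set p' : ℝ≥0∞ := min q 4 with hp'
  have hp't : p' ≠ ⊤ := ((min_le_right _ _).trans_lt (by simp : (4 : ℝ≥0∞) < ⊤)).ne
  have hp'3 : 3 < p' := lt_min hq (by norm_num)
  have hp'q : p' ≤ q := min_le_left _ _
  set p : ℝ := p'.toReal with hp
  have hp3 : 3 < p := by
    have := (ENNReal.toReal_lt_toReal (by simp) hp't).2 hp'3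
    simpa using this
  have hp1 : 1 ≤ p := by linarith
  set v := Module.finBasis ℝ Phase with hv
  choose g hg using hW.2
  choose h hh using fun e => (hg e).2.2
  have hf : LocallyIntegrable f := (hg 0).1.1
  obtain ⟨C, hC⟩ := exists_enorm_rpow_le_sum (F := ℝ) v
  obtain ⟨C', hC'⟩ := exists_enorm_rpow_le_sum (F := Phase →L[ℝ] ℝ) v
  -- The ratio of outer to inner radius is always `2`; almost everywhere convergence of the
  -- mollifications asks for a bounded ratio.
  set φ : ℕ → ContDiffBump (0 : Phase) := fun n =>
    { rIn := 1 / (2 * ((n : ℝ) + 1))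
      rOut := 1 / ((n : ℝ) + 1)
      rIn_pos := by positivity
      rIn_lt_rOut := by
        apply one_div_lt_one_div_of_lt (by positivity)
        have : (0 : ℝ) < (n : ℝ) + 1 := by positivity
        linarith } with hφ
  set η : ℕ → Phase → ℝ := fun n => (φ n).normed volume with hη
  have hηd : ∀ n, ContDiff ℝ ∞ (η n) := fun n => (φ n).contDiff_normed
  have hηc : ∀ n, HasCompactSupport (η n) := fun n => (φ n).hasCompactSupport_normed
  have hη0 : ∀ n z, 0 ≤ η n z := fun n z => (φ n).nonneg_normed z
  have hη1 : ∀ n, ∫ z, η n z = 1 := fun n => (φ n).integral_normed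
  have hηs : ∀ n z, 1 < ‖z‖ → η n z = 0 := fun n z hz => by
    by_contra hne
    have hmem : z ∈ Function.support ((φ n).normed volume) := hne
    rw [(φ n).support_normed_eq, mem_ball_zero_iff] at hmem
    have : (φ n).rOut ≤ 1 := by
      simp only [hφ]
      rw [div_le_one (by positivity)]
      linarith [Nat.cast_nonneg (α := ℝ) n]
    linarith
  -- One unit for the support of the mollified function, another for the reach of the kernel in the
  -- Jensen estimate.
  set B : Set Phase := closedBall 0 (R + 1 + 1) with hB
  have hloc : ∀ u : Phase → ℝ, LocallyIntegrable u → ∫⁻ z in B, ‖u z‖ₑ < ⊤ := fun u hu =>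
    (hu.integrableOn_isCompact (isCompact_closedBall _ _)).2
  have hlocp : ∀ u : Phase → ℝ, MemLp u q → ∫⁻ z in B, ‖u z‖ₑ ^ p < ⊤ := fun u hu => by
    have hfin : IsFiniteMeasure (volume.restrict B) :=
      isFiniteMeasure_restrict.2 (isCompact_closedBall _ _).measure_lt_top.ne
    have := (hu.restrict B).mono_exponent hp'q
    exact lintegral_rpow_enorm_lt_top_of_eLpNorm_lt_top (by positivity) hp't this.2
  have hvan : ∀ n z, R + 1 < ‖z‖ → mollify (η n) f z = 0 := fun n z hz =>
    mollify_eq_zero (hηs n) hR hz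
  have hd1 : ∀ n e z, fderiv ℝ (mollify (η n) f) z e = mollify (η n) (g e) z := fun n e z =>
    fderiv_mollify (hηd n) (hηc n) (hg e).1 z
  have hd2 : ∀ n e e' z, fderiv ℝ (fderiv ℝ (mollify (η n) f)) z e' e
      = mollify (η n) (h e e') z := fun n e e' z => by
    rw [← fderiv_mollify (hηd n) (hηc n) (hh e e').1 z]
    have hdiff : DifferentiableAt ℝ (fderiv ℝ (mollify (η n) f)) z :=
      (((contDiff_infty.1 (contDiff_mollify (hηd n) (hηc n) hf) 2).fderiv_right
        (m := 1) (by norm_num)).differentiable one_ne_zero) z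
    have e1 : mollify (η n) (g e) = fun z => fderiv ℝ (mollify (η n) f) z e :=
      funext fun z => (hd1 n e z).symm
    rw [e1, fderiv_clm_apply hdiff (differentiableAt_const _)]
    simp
  have bound1 : ∀ n (r : ℝ), 1 ≤ r → ∫⁻ z, ‖fderiv ℝ (mollify (η n) f) z‖ₑ ^ r
      ≤ (C : ℝ≥0∞) ^ r * ∑ i, ∫⁻ z in B, ‖g (v i) z‖ₑ ^ r := fun n r hr => by
    have hr0 : 0 < r := by linarith
    have hsm : ∀ e, Measurable fun z => ‖mollify (η n) (g e) z‖ₑ ^ r := fun e =>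
      ((contDiff_mollify (hηd n) (hηc n)
        (hg e).1.2.1).continuous.enorm.measurable.pow_const r)
    rw [lintegral_eq_setLIntegral_closedBall (R := R + 1) (fun z hz => by
      rw [enorm_fderiv_eq_zero_of_vanish (hvan n) hz, ENNReal.zero_rpow_of_pos hr0])]
    calc _ ≤ ∫⁻ z in closedBall 0 (R + 1),
          (C : ℝ≥0∞) ^ r * ∑ i, ‖mollify (η n) (g (v i)) z‖ₑ ^ r := by
          refine lintegral_mono fun z => ?_
          simpa only [hd1] using hC (fderiv ℝ (mollify (η n) f) z) r hr
      _ = (C : ℝ≥0∞) ^ r * ∑ i, ∫⁻ z in closedBall 0 (R + 1),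
          ‖mollify (η n) (g (v i)) z‖ₑ ^ r := by
          rw [lintegral_const_mul _ (Finset.measurable_sum _ fun i _ => hsm _),
            lintegral_finsetSum _ fun i _ => hsm _]
      _ ≤ _ := by
          refine mul_le_mul_right (Finset.sum_le_sum fun i _ => ?_) _
          exact lintegral_enorm_mollify_rpow_le (hηd n).continuous (hη0 n) (hη1 n) (hηs n)
            (hg (v i)).1.2.1.aestronglyMeasurable hr (R + 1)
  have bound2 : ∀ n, ∫⁻ z, ‖fderiv ℝ (fderiv ℝ (mollify (η n) f)) z‖ₑ
      ≤ C' * ∑ j, (C * ∑ i, ∫⁻ z in B, ‖h (v i) (v j) z‖ₑ) := fun n => by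
    have hsm : ∀ e e', Measurable fun z => ‖mollify (η n) (h e e') z‖ₑ := fun e e' =>
      ((contDiff_mollify (hηd n) (hηc n) (hh e e').1.2.1).continuous.enorm.measurable)
    rw [lintegral_eq_setLIntegral_closedBall (R := R + 1) (fun z hz =>
      enorm_fderiv_eq_zero_of_vanish (fun z hz => fderiv_eq_zero_of_vanish (hvan n) hz) hz)]
    calc _ ≤ ∫⁻ z in closedBall 0 (R + 1),
          (C' : ℝ≥0∞) * ∑ j, (C * ∑ i, ‖mollify (η n) (h (v i) (v j)) z‖ₑ) := by
          refine lintegral_mono fun z => ?_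
          have e1 := hC' (fderiv ℝ (fderiv ℝ (mollify (η n) f)) z) 1 le_rfl
          simp only [ENNReal.rpow_one] at e1
          refine e1.trans ?_
          gcongr with j
          have e2 := hC (fderiv ℝ (fderiv ℝ (mollify (η n) f)) z (v j)) 1 le_rfl
          simpa only [ENNReal.rpow_one, hd2] using e2
      _ = (C' : ℝ≥0∞) * ∑ j, (C * ∑ i, ∫⁻ z in closedBall 0 (R + 1),
          ‖mollify (η n) (h (v i) (v j)) z‖ₑ) := by
          have m1 : ∀ j, Measurable fun z => ∑ i, ‖mollify (η n) (h (v i) (v j)) z‖ₑ :=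
            fun j => Finset.measurable_sum _ fun i _ => hsm _ _
          rw [lintegral_const_mul _ (Finset.measurable_sum _ fun j _ => (m1 j).const_mul _),
            lintegral_finsetSum _ fun j _ => (m1 j).const_mul _]
          congr 1
          refine Finset.sum_congr rfl fun j _ => ?_
          rw [lintegral_const_mul _ (m1 j), lintegral_finsetSum _ fun i _ => hsm _ _]
      _ ≤ _ := by
          refine mul_le_mul_right (Finset.sum_le_sum fun j _ => mul_le_mul_right
            (Finset.sum_le_sum fun i _ => ?_) _) _
          have := lintegral_enorm_mollify_rpow_le (hηd n).continuous (hη0 n) (hη1 n) (hηs n)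
            (hh (v i) (v j)).1.2.1.aestronglyMeasurable le_rfl (R + 1)
          simpa only [ENNReal.rpow_one] using this
  refine ⟨p, R + 1, (C : ℝ≥0∞) ^ p * (∑ i, ∫⁻ z in B, ‖g (v i) z‖ₑ ^ p)
    + C * (∑ i, ∫⁻ z in B, ‖g (v i) z‖ₑ)
    + C' * ∑ j, (C * ∑ i, ∫⁻ z in B, ‖h (v i) (v j) z‖ₑ), fun n => mollify (η n) f,
    hp3, by linarith, ?_, ?_⟩
  · refine ENNReal.add_ne_top.2 ⟨ENNReal.add_ne_top.2 ⟨?_, ?_⟩, ?_⟩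
    · exact ENNReal.mul_ne_top (ENNReal.rpow_ne_top_of_nonneg (by linarith) ENNReal.coe_ne_top)
        (ENNReal.sum_ne_top.2 fun i _ => (hlocp _ (hg _).2.1).ne)
    · exact ENNReal.mul_ne_top ENNReal.coe_ne_top
        (ENNReal.sum_ne_top.2 fun i _ => (hloc _ (hg _).1.2.1).ne)
    · exact ENNReal.mul_ne_top ENNReal.coe_ne_top (ENNReal.sum_ne_top.2 fun j _ =>
        ENNReal.mul_ne_top ENNReal.coe_ne_top
          (ENNReal.sum_ne_top.2 fun i _ => (hloc _ (hh _ _).1.2.1).ne))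
  · refine ⟨fun n => contDiff_mollify (hηd n) (hηc n) hf, hvan, ?_, fun n => ?_, fun n => ?_,
      fun n => ?_⟩
    · have := ContDiffBump.ae_convolution_tendsto_right_of_locallyIntegrable (μ := volume)
        (φ := φ) (l := atTop) (K := 2) (by
          simp only [hφ]
          exact tendsto_one_div_add_atTop_nhds_zero_nat)
        (Eventually.of_forall fun n => by
          simp only [hφ]
          apply le_of_eq
          field_simp) hf
      filter_upwards [this] with z hz
      refine hz.congr fun n => ?_
      rw [convolution_lsmul_swap, mollify]
      refine integral_congr_ae (Eventually.of_forall fun t => ?_)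
      simp only [smul_eq_mul, hη, mul_comm]
    · exact (bound1 n p hp1).trans (le_self_add.trans le_self_add)
    · have := bound1 n 1 le_rfl
      simp only [ENNReal.rpow_one] at this
      exact this.trans (le_add_self.trans le_self_add)
    · exact (bound2 n).trans le_add_self

/-! ### Newtonian kernel and force of a bounded density -/

theorem volume_real_unit_ball : (volume : Measure R3).real (ball 0 1) = 4 * Real.pi / 3 := by
  have := Real.pi_pos
  rw [measureReal_def, EuclideanSpace.volume_ball_fin_three, ENNReal.ofReal_one, one_pow, one_mul,
    ENNReal.toReal_ofReal (by positivity)]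
  ring

theorem lintegral_ball_inv_norm_sq {r : ℝ} (hr : 0 ≤ r) :
    ∫⁻ w in ball (0 : R3) r, ENNReal.ofReal ((‖w‖ ^ 2)⁻¹) = ENNReal.ofReal (4 * Real.pi * r) := by
  have hone : ∀ y ∈ Ioi (0 : ℝ), y ^ 2 * (y ^ 2)⁻¹ = 1 := fun y hy =>
    mul_inv_cancel₀ (pow_ne_zero _ (ne_of_gt hy))
  have hint : IntegrableOn (fun w : R3 => (‖w‖ ^ 2)⁻¹) (ball 0 r) := by
    rw [integrableOn_fun_norm_addHaar volume (f := fun y => (y ^ 2)⁻¹)]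
    refine (integrableOn_const (C := (1 : ℝ)) (by simp)).congr_fun (fun y hy => ?_)
      measurableSet_Ioo
    simp only [finrank_euclideanSpace, Fintype.card_fin, smul_eq_mul]
    exact (hone y hy.1).symm
  rw [← ofReal_integral_eq_lintegral_ofReal hint (Eventually.of_forall fun w => by positivity)]
  congr 1
  rw [← integral_indicator measurableSet_ball]
  have e1 : (ball (0 : R3) r).indicator (fun w => (‖w‖ ^ 2)⁻¹)
      = fun w => (Iio r).indicator (fun y => (y ^ 2)⁻¹) ‖w‖ := by
    ext w
    by_cases hw : ‖w‖ < r <;> simp [indicator, hw]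
  rw [e1, integral_fun_norm_addHaar]
  have e2 : ∫ y in Ioi (0 : ℝ), y ^ (Module.finrank ℝ R3 - 1) •
      (Iio r).indicator (fun y => (y ^ 2)⁻¹) y = r := by
    rw [setIntegral_congr_fun (g := (Iio r).indicator fun _ => (1 : ℝ)) measurableSet_Ioi]
    · rw [integral_indicator measurableSet_Iio, Measure.restrict_restrict measurableSet_Iio,
        Iio_inter_Ioi]
      simp [hr]
    · intro y hy
      by_cases hyr : y < r
      · simp only [finrank_euclideanSpace, Fintype.card_fin, smul_eq_mul,
          indicator_of_mem (show y ∈ Iio r from hyr)]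
        exact hone y hy
      · simp only [indicator_of_notMem (show y ∉ Iio r from hyr), smul_zero]
  rw [e2, volume_real_unit_ball]
  simp only [finrank_euclideanSpace, Fintype.card_fin, nsmul_eq_mul, smul_eq_mul]
  push_cast
  ring

/-- The gradient of the kernel `K`. -/
def gradKernel (w : R3) : R3 := (4 * Real.pi * ‖w‖ ^ 3)⁻¹ • w

theorem norm_gradKernel (w : R3) : ‖gradKernel w‖ = (4 * Real.pi)⁻¹ * (‖w‖ ^ 2)⁻¹ := by
  have := Real.pi_pos
  rcases eq_or_ne w 0 with rfl | hw
  · simp [gradKernel]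
  · have hw' : ‖w‖ ≠ 0 := norm_ne_zero_iff.2 hw
    rw [gradKernel, norm_smul, Real.norm_of_nonneg (by positivity)]
    field_simp

theorem inv_four_pi_le_one : (4 * Real.pi)⁻¹ ≤ 1 :=
  inv_le_one_of_one_le₀ (by linarith [Real.pi_gt_three])

theorem norm_gradKernel_le (w : R3) : ‖gradKernel w‖ ≤ (‖w‖ ^ 2)⁻¹ := by
  rw [norm_gradKernel]
  exact mul_le_of_le_one_left (by positivity) inv_four_pi_le_one

theorem measurable_gradKernel : Measurable gradKernel := by
  unfold gradKernel
  fun_prop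

theorem measurable_newtonKernel : Measurable newtonKernel := by
  unfold newtonKernel
  fun_prop

/-- A bounded measurable density vanishing outside the ball of radius `R`. -/
structure BddDensity (ρ : R3 → ℝ) (M R : ℝ) : Prop where
  meas : AEStronglyMeasurable ρ volume
  nonneg : 0 ≤ M
  bound : ∀ᵐ y, ‖ρ y‖ ≤ M
  vanish : ∀ y, R < ‖y‖ → ρ y = 0

/-- The Newtonian potential of a density. -/
def newton (ρ : R3 → ℝ) (x : R3) : ℝ := ∫ y, newtonKernel (x - y) * ρ y

/-- The Newtonian force field of a density. -/
def newtonField (ρ : R3 → ℝ) (x : R3) : R3 := ∫ y, ρ y • gradKernel (x - y)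

theorem potential_eq_newton (f : Phase → ℝ) : potential f = newton (density f) := rfl

/-- The integral `∫ |ρ(y)| |x - y|⁻² dy`. -/
def rieszInt (ρ : R3 → ℝ) (x : R3) : ℝ≥0∞ :=
  ∫⁻ y, ‖ρ y‖ₑ * ENNReal.ofReal ((‖x - y‖ ^ 2)⁻¹)

namespace BddDensity

variable {ρ : R3 → ℝ} {M R : ℝ}

theorem integrable (h : BddDensity ρ M R) : Integrable ρ :=
  integrable_of_bounded_of_vanish h.meas h.bound h.vanish

/-- Split the kernel at radius `r`. Near the singularity the sup bound of the density meets
`∫_{|w|<r} |w|⁻² = 4πr`; away from it only the mass enters. Potential, force and regularization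
error are all estimated this way. -/
theorem lintegral_mul_enorm_kernel_le {F : Type*} [NormedAddCommGroup F] (h : BddDensity ρ M R)
    {k : R3 → F} {a b r : ℝ} (ha : 0 ≤ a) (hr : 0 ≤ r)
    (hk : ∀ w, ‖w‖ < r → ‖k w‖ ≤ a * (‖w‖ ^ 2)⁻¹) (hk' : ∀ w, r ≤ ‖w‖ → ‖k w‖ ≤ b) (x : R3) :
    ∫⁻ y, ‖ρ y‖ₑ * ‖k (x - y)‖ₑ
      ≤ ENNReal.ofReal (M * a * (4 * Real.pi * r)) + ENNReal.ofReal b * ∫⁻ y, ‖ρ y‖ₑ := by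
  set G : R3 → ℝ≥0∞ := (ball (0 : R3) r).indicator fun w => ENNReal.ofReal ((‖w‖ ^ 2)⁻¹) with hG
  have hGm : Measurable G := by
    refine Measurable.indicator ?_ measurableSet_ball
    fun_prop
  have hM := h.nonneg
  calc _ ≤ ∫⁻ y, (ENNReal.ofReal (M * a) * G (x - y) + ENNReal.ofReal b * ‖ρ y‖ₑ) := by
        refine lintegral_mono_ae ?_
        filter_upwards [h.bound] with y hy
        by_cases hw : ‖x - y‖ < r
        · refine le_trans ?_ le_self_add
          have hmem : x - y ∈ ball (0 : R3) r := by simpa using hw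
          rw [hG, indicator_of_mem hmem, ← ofReal_norm, ← ofReal_norm,
            ← ENNReal.ofReal_mul (norm_nonneg _), ← ENNReal.ofReal_mul (by positivity)]
          apply ENNReal.ofReal_le_ofReal
          calc _ ≤ M * (a * (‖x - y‖ ^ 2)⁻¹) := by gcongr; exact hk _ hw
            _ = _ := by ring
        · refine le_trans ?_ le_add_self
          rw [mul_comm]
          gcongr
          rw [← ofReal_norm]
          exact ENNReal.ofReal_le_ofReal (hk' _ (not_lt.1 hw))
    _ = ENNReal.ofReal (M * a) * (∫⁻ y, G (x - y)) + ENNReal.ofReal b * ∫⁻ y, ‖ρ y‖ₑ := by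
        have hm : Measurable fun y => G (x - y) := hGm.comp (measurable_const.sub measurable_id)
        rw [lintegral_add_left (hm.const_mul _), lintegral_const_mul _ hm,
          lintegral_const_mul'' _ h.meas.enorm]
    _ = _ := by
        rw [lintegral_sub_left_eq_self G x, hG, lintegral_indicator measurableSet_ball,
          lintegral_ball_inv_norm_sq hr, ← ENNReal.ofReal_mul (by positivity)]

theorem rieszInt_le (h : BddDensity ρ M R) {r : ℝ} (hr : 0 < r) (x : R3) :
    rieszInt ρ x ≤ ENNReal.ofReal (M * (4 * Real.pi * r))
      + ENNReal.ofReal ((r ^ 2)⁻¹) * ∫⁻ y, ‖ρ y‖ₑ := by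
  have := h.lintegral_mul_enorm_kernel_le (k := fun w : R3 => (‖w‖ ^ 2)⁻¹) (a := 1)
    (b := (r ^ 2)⁻¹) (r := r) zero_le_one hr.le
    (fun w _ => by rw [Real.norm_of_nonneg (by positivity), one_mul])
    (fun w hw => by rw [Real.norm_of_nonneg (by positivity)]; gcongr) x
  rw [mul_one] at this
  refine le_trans (le_of_eq ?_) this
  refine lintegral_congr fun y => ?_
  rw [← ofReal_norm (((‖x - y‖ ^ 2)⁻¹ : ℝ)), Real.norm_of_nonneg (by positivity)]

theorem rieszInt_ne_top (h : BddDensity ρ M R) (x : R3) : rieszInt ρ x ≠ ⊤ := by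
  refine ((h.rieszInt_le one_pos x).trans_lt ?_).ne
  exact ENNReal.add_lt_top.2 ⟨ENNReal.ofReal_lt_top,
    ENNReal.mul_lt_top ENNReal.ofReal_lt_top h.integrable.2⟩

theorem aestronglyMeasurable_field (h : BddDensity ρ M R) (x : R3) :
    AEStronglyMeasurable (fun y => ρ y • gradKernel (x - y)) volume :=
  h.meas.smul (measurable_gradKernel.comp (measurable_const.sub measurable_id)).aestronglyMeasurable

theorem lintegral_enorm_field_le (x : R3) :
    ∫⁻ y, ‖ρ y • gradKernel (x - y)‖ₑ ≤ rieszInt ρ x := by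
  refine lintegral_mono fun y => ?_
  rw [enorm_smul]
  gcongr
  rw [← ofReal_norm]
  exact ENNReal.ofReal_le_ofReal (norm_gradKernel_le _)

theorem integrable_field (h : BddDensity ρ M R) (x : R3) :
    Integrable fun y => ρ y • gradKernel (x - y) :=
  ⟨h.aestronglyMeasurable_field x,
    (lintegral_enorm_field_le x).trans_lt (h.rieszInt_ne_top x).lt_top⟩

theorem enorm_newtonField_le (x : R3) : ‖newtonField ρ x‖ₑ ≤ rieszInt ρ x :=
  (enorm_integral_le_lintegral_enorm _).trans (lintegral_enorm_field_le x)

theorem exists_lintegral_enorm_potential_le (h : BddDensity ρ M R) :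
    ∃ C : ℝ≥0, ∀ x, ∫⁻ y, ‖newtonKernel (x - y) * ρ y‖ₑ ≤ C := by
  have hfin : ENNReal.ofReal (M * 1 * (4 * Real.pi * 1)) + ENNReal.ofReal 1 * ∫⁻ y, ‖ρ y‖ₑ ≠ ⊤ :=
    ENNReal.add_ne_top.2 ⟨ENNReal.ofReal_ne_top,
      ENNReal.mul_ne_top ENNReal.ofReal_ne_top h.integrable.2.ne⟩
  refine ⟨(ENNReal.ofReal (M * 1 * (4 * Real.pi * 1))
    + ENNReal.ofReal 1 * ∫⁻ y, ‖ρ y‖ₑ).toNNReal, fun x => ?_⟩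
  rw [ENNReal.coe_toNNReal hfin]
  have := h.lintegral_mul_enorm_kernel_le (k := newtonKernel) (a := 1) (b := 1) (r := 1)
    zero_le_one zero_le_one (fun w hw => ?_) (fun w hw => ?_) x
  · refine le_trans (le_of_eq (lintegral_congr fun y => ?_)) this
    rw [enorm_mul, mul_comm]
  · have hpi := Real.pi_gt_three
    rw [newtonKernel, norm_neg, Real.norm_of_nonneg (by positivity), one_mul, one_div]
    rcases eq_or_ne w 0 with rfl | h0
    · simp
    · have hw0 : 0 < ‖w‖ := norm_pos_iff.2 h0
      apply inv_anti₀ (by positivity)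
      nlinarith
  · have hpi := Real.pi_gt_three
    rw [newtonKernel, norm_neg, Real.norm_of_nonneg (by positivity), one_div]
    exact inv_le_one_of_one_le₀ (by nlinarith)

theorem integrable_potential (h : BddDensity ρ M R) (x : R3) :
    Integrable fun y => newtonKernel (x - y) * ρ y := by
  obtain ⟨C, hC⟩ := h.exists_lintegral_enorm_potential_le
  exact ⟨(measurable_newtonKernel.comp
    (measurable_const.sub measurable_id)).aestronglyMeasurable.mul h.meas,
    (hC x).trans_lt ENNReal.coe_lt_top⟩

end BddDensity

/-! ### Regularized kernels and differentiability of the potential -/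

/-- The regularized norm `√(|w|² + δ²)`. -/
def regNorm (δ : ℝ) (w : R3) : ℝ := Real.sqrt (‖w‖ ^ 2 + δ ^ 2)

section Regularization

variable {δ : ℝ}

theorem regNorm_pos (hδ : 0 < δ) (w : R3) : 0 < regNorm δ w := Real.sqrt_pos.2 (by positivity)

theorem norm_le_regNorm (w : R3) : ‖w‖ ≤ regNorm δ w :=
  Real.le_sqrt_of_sq_le (by nlinarith [sq_nonneg δ])

theorem le_regNorm (w : R3) : δ ≤ regNorm δ w :=
  Real.le_sqrt_of_sq_le (by nlinarith [sq_nonneg ‖w‖])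

theorem regNorm_le (hδ : 0 < δ) (w : R3) : regNorm δ w ≤ ‖w‖ + δ :=
  Real.sqrt_le_iff.2 ⟨by positivity, by nlinarith [norm_nonneg w]⟩

theorem continuous_regNorm : Continuous (regNorm δ) := by
  unfold regNorm
  fun_prop

/-- The regularized kernel. -/
def regKernel (δ : ℝ) (w : R3) : ℝ := -(4 * Real.pi * regNorm δ w)⁻¹

/-- The gradient of the regularized kernel. -/
def regGradKernel (δ : ℝ) (w : R3) : R3 := (4 * Real.pi * regNorm δ w ^ 3)⁻¹ • w

theorem continuous_regKernel (hδ : 0 < δ) : Continuous (regKernel δ) := by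
  unfold regKernel
  refine ((continuous_const.mul continuous_regNorm).inv₀ fun w => ?_).neg
  exact (mul_pos (mul_pos four_pos Real.pi_pos) (regNorm_pos hδ w)).ne'

theorem continuous_regGradKernel (hδ : 0 < δ) : Continuous (regGradKernel δ) := by
  unfold regGradKernel
  refine ((continuous_const.mul (continuous_regNorm.pow 3)).inv₀ fun w => ?_).smul continuous_id
  exact (mul_pos (mul_pos four_pos Real.pi_pos) (pow_pos (regNorm_pos hδ w) 3)).ne'

theorem hasFDerivAt_regKernel (hδ : 0 < δ) (w : R3) :
    HasFDerivAt (regKernel δ) (innerSL ℝ (regGradKernel δ w)) w := by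
  have hN := regNorm_pos hδ w
  have hpi := Real.pi_pos
  have h1 : HasFDerivAt (fun w : R3 => ‖w‖ ^ 2 + δ ^ 2) (2 • innerSL ℝ w) w :=
    (hasStrictFDerivAt_norm_sq w).hasFDerivAt.add_const _
  have h2 := h1.sqrt (by positivity)
  have h3 := ((hasDerivAt_inv (x := 4 * Real.pi * regNorm δ w) (by positivity)).comp_hasFDerivAt w
    (h2.const_mul (4 * Real.pi))).neg
  refine h3.congr_fderiv ?_
  ext e
  have : (innerSL ℝ (regGradKernel δ w)) e = (4 * Real.pi * regNorm δ w ^ 3)⁻¹ * inner ℝ w e := by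
    rw [innerSL_apply_apply, regGradKernel, real_inner_smul_left]
  rw [this]
  change -(-((4 * Real.pi * regNorm δ w) ^ 2)⁻¹ • (4 * Real.pi) • (1 / (2 * regNorm δ w)) •
    (2 • (inner ℝ w e : ℝ))) = _
  simp only [smul_eq_mul, nsmul_eq_mul]
  push_cast
  field_simp

theorem norm_regGradKernel_le (hδ : 0 < δ) (w : R3) : ‖regGradKernel δ w‖ ≤ (δ ^ 2)⁻¹ := by
  have hN := regNorm_pos hδ w
  have hpi := Real.pi_gt_three
  rw [regGradKernel, norm_smul, Real.norm_of_nonneg (by positivity), inv_mul_le_iff₀ (by positivity)]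
  have h1 := norm_le_regNorm (δ := δ) w
  have h2 : δ ^ 2 ≤ regNorm δ w ^ 2 := by gcongr; exact le_regNorm w
  rw [← div_eq_mul_inv, le_div_iff₀ (by positivity)]
  calc ‖w‖ * δ ^ 2 ≤ regNorm δ w * regNorm δ w ^ 2 := by gcongr
    _ ≤ 4 * Real.pi * regNorm δ w ^ 3 := by nlinarith [pow_pos hN 3]

theorem abs_regKernel_le (hδ : 0 < δ) (w : R3) : ‖regKernel δ w‖ ≤ δ⁻¹ := by
  have hN := regNorm_pos hδ w
  have hpi := Real.pi_gt_three
  rw [regKernel, norm_neg, Real.norm_of_nonneg (by positivity)]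
  apply inv_anti₀ hδ
  nlinarith [le_regNorm (δ := δ) w]

theorem norm_regKernel_sub_le (hδ : 0 < δ) {w : R3} (hw : w ≠ 0) :
    ‖regKernel δ w - newtonKernel w‖ ≤ δ * (‖w‖ ^ 2)⁻¹ := by
  have hN := regNorm_pos hδ w
  have hpi := Real.pi_gt_three
  have ha : 0 < ‖w‖ := norm_pos_iff.2 hw
  have h1 := norm_le_regNorm (δ := δ) w
  have h2 := regNorm_le hδ w
  have e : regKernel δ w - newtonKernel w
      = (4 * Real.pi)⁻¹ * ((regNorm δ w - ‖w‖) / (‖w‖ * regNorm δ w)) := by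
    rw [regKernel, newtonKernel]
    field_simp
    ring
  rw [e, norm_mul, Real.norm_of_nonneg (by positivity),
    Real.norm_of_nonneg (div_nonneg (by linarith) (by positivity))]
  calc _ ≤ 1 * ((regNorm δ w - ‖w‖) / (‖w‖ * regNorm δ w)) := by
        have : 0 ≤ (regNorm δ w - ‖w‖) / (‖w‖ * regNorm δ w) :=
          div_nonneg (by linarith) (by positivity)
        gcongr
        exact inv_four_pi_le_one
    _ ≤ δ / (‖w‖ * ‖w‖) := by
        rw [one_mul]
        gcongr
        linarith
    _ = _ := by rw [div_eq_mul_inv, sq]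

theorem norm_regGradKernel_sub (w : R3) :
    ‖regGradKernel δ w - gradKernel w‖
      = (4 * Real.pi)⁻¹ * (((‖w‖ ^ 3)⁻¹ - (regNorm δ w ^ 3)⁻¹) * ‖w‖) := by
  have hpi := Real.pi_pos
  rcases eq_or_ne w 0 with rfl | hw
  · simp [regGradKernel, gradKernel]
  have ha : 0 < ‖w‖ := norm_pos_iff.2 hw
  have h3 : (regNorm δ w ^ 3)⁻¹ ≤ (‖w‖ ^ 3)⁻¹ := by
    gcongr
    exact norm_le_regNorm w
  rw [norm_sub_rev, regGradKernel, gradKernel, ← sub_smul, norm_smul, mul_inv, mul_inv (4 * Real.pi),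
    ← mul_sub, norm_mul, Real.norm_of_nonneg (by positivity),
    Real.norm_of_nonneg (sub_nonneg.2 h3)]
  ring

theorem norm_regGradKernel_sub_le (hδ : 0 < δ) (w : R3) :
    ‖regGradKernel δ w - gradKernel w‖ ≤ 1 * (‖w‖ ^ 2)⁻¹ := by
  have hN := regNorm_pos hδ w
  rw [norm_regGradKernel_sub]
  rcases eq_or_ne w 0 with rfl | hw
  · simp
  have ha : 0 < ‖w‖ := norm_pos_iff.2 hw
  have h3 : (regNorm δ w ^ 3)⁻¹ ≤ (‖w‖ ^ 3)⁻¹ := by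
    gcongr
    exact norm_le_regNorm w
  have h4 : 0 ≤ ((‖w‖ ^ 3)⁻¹ - (regNorm δ w ^ 3)⁻¹) * ‖w‖ :=
    mul_nonneg (sub_nonneg.2 h3) ha.le
  calc _ ≤ 1 * (((‖w‖ ^ 3)⁻¹ - (regNorm δ w ^ 3)⁻¹) * ‖w‖) := by
        gcongr
        exact inv_four_pi_le_one
    _ ≤ 1 * ((‖w‖ ^ 3)⁻¹ * ‖w‖) := by
        gcongr
        have : 0 ≤ (regNorm δ w ^ 3)⁻¹ := by positivity
        linarith
    _ = _ := by field_simp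

/-- Writing `N` for the regularized norm, factor `N³ - |w|³`: the linear factor is at most `δ`, the
quadratic one at most `3N²`. -/
theorem norm_regGradKernel_sub_le_of_le (hδ : 0 < δ) {r : ℝ} (hr : 0 < r) {w : R3}
    (hw : r ≤ ‖w‖) : ‖regGradKernel δ w - gradKernel w‖ ≤ 3 * δ / r ^ 3 := by
  have hN := regNorm_pos hδ w
  have ha : 0 < ‖w‖ := hr.trans_le hw
  have h1 := norm_le_regNorm (δ := δ) w
  have h2 := regNorm_le hδ w
  rw [norm_regGradKernel_sub]
  have e : ((‖w‖ ^ 3)⁻¹ - (regNorm δ w ^ 3)⁻¹) * ‖w‖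
      = (regNorm δ w - ‖w‖) * (regNorm δ w ^ 2 + regNorm δ w * ‖w‖ + ‖w‖ ^ 2)
        / (‖w‖ ^ 2 * regNorm δ w ^ 3) := by
    field_simp
    ring
  have h4 : ((‖w‖ ^ 3)⁻¹ - (regNorm δ w ^ 3)⁻¹) * ‖w‖ ≤ 3 * δ / r ^ 3 := by
    rw [e]
    calc _ ≤ δ * (3 * regNorm δ w ^ 2) / (‖w‖ ^ 2 * regNorm δ w ^ 3) := by
          gcongr
          · linarith
          · nlinarith
      _ = 3 * δ / (‖w‖ ^ 2 * regNorm δ w) := by field_simp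
      _ ≤ 3 * δ / (r ^ 2 * r) := by
          gcongr
          exact hw.trans h1
      _ = _ := by ring_nf
  have h5 : 0 ≤ ((‖w‖ ^ 3)⁻¹ - (regNorm δ w ^ 3)⁻¹) * ‖w‖ := by
    rw [e]
    have : 0 ≤ regNorm δ w - ‖w‖ := by linarith
    positivity
  calc _ ≤ 1 * (((‖w‖ ^ 3)⁻¹ - (regNorm δ w ^ 3)⁻¹) * ‖w‖) := by
        gcongr
        exact inv_four_pi_le_one
    _ ≤ _ := by rw [one_mul]; exact h4

end Regularization

namespace BddDensity

variable {ρ : R3 → ℝ} {M R δ : ℝ}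

theorem integrable_regField (h : BddDensity ρ M R) (hδ : 0 < δ) (x : R3) :
    Integrable fun y => ρ y • regGradKernel δ (x - y) :=
  h.integrable.smul_bdd (δ ^ 2)⁻¹
    ((continuous_regGradKernel hδ).comp (continuous_const.sub continuous_id)).aestronglyMeasurable
    (Eventually.of_forall fun _ => norm_regGradKernel_le hδ _)

theorem integrable_regPotential (h : BddDensity ρ M R) (hδ : 0 < δ) (x : R3) :
    Integrable fun y => regKernel δ (x - y) * ρ y :=
  h.integrable.bdd_mul (c := δ⁻¹)
    ((continuous_regKernel hδ).comp (continuous_const.sub continuous_id)).aestronglyMeasurable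
    (Eventually.of_forall fun _ => abs_regKernel_le hδ _)

theorem hasFDerivAt_regPotential (h : BddDensity ρ M R) (hδ : 0 < δ) (x : R3) :
    HasFDerivAt (fun x => ∫ y, regKernel δ (x - y) * ρ y)
      (innerSL ℝ (∫ y, ρ y • regGradKernel δ (x - y))) x := by
  rw [← ContinuousLinearMap.integral_comp_comm _ (h.integrable_regField hδ x)]
  refine hasFDerivAt_integral_of_dominated_of_fderiv_le (𝕜 := ℝ)
    (F := fun x y => regKernel δ (x - y) * ρ y)
    (F' := fun x y => innerSL ℝ (ρ y • regGradKernel δ (x - y)))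
    (bound := fun y => ‖ρ y‖ * (δ ^ 2)⁻¹) (s := univ) univ_mem
    (Eventually.of_forall fun x => (h.integrable_regPotential hδ x).1)
    (h.integrable_regPotential hδ x)
    ((innerSL ℝ).continuous.comp_aestronglyMeasurable (h.integrable_regField hδ x).1) ?_
    (h.integrable.norm.mul_const _) ?_
  · refine Eventually.of_forall fun y x _ => ?_
    rw [innerSL_apply_norm, norm_smul]
    gcongr
    exact norm_regGradKernel_le hδ _
  · refine Eventually.of_forall fun y x _ => ?_
    have h1 : HasFDerivAt (fun x => regKernel δ (x - y))
        (innerSL ℝ (regGradKernel δ (x - y))) x :=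
      ((hasFDerivAt_regKernel hδ (x - y)).comp x ((hasFDerivAt_id x).sub_const y) :)
    refine (h1.mul_const (ρ y)).congr_fderiv ?_
    rw [map_smul]

/-- The Newtonian potential of a bounded compactly supported density is differentiable. -/
theorem hasFDerivAt_newton (h : BddDensity ρ M R) (x : R3) :
    HasFDerivAt (newton ρ) (innerSL ℝ (newtonField ρ x)) x := by
  set r : ℕ → ℝ := fun n => 1 / ((n : ℝ) + 1) with hr
  have hr0 : ∀ n, 0 < r n := fun n => by positivity
  have hrlim : Tendsto r atTop (𝓝 0) := tendsto_one_div_add_atTop_nhds_zero_nat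
  -- Splitting the force error at radius `r` gives a near part of order `r` and a far part of order
  -- `3δ/r³`. The choice `δ = r⁴` makes the latter `3r`, so gradients converge uniformly; with
  -- pointwise convergence of the potentials this differentiates the limit.
  set δ : ℕ → ℝ := fun n => r n ^ 4 with hδ
  have hδ0 : ∀ n, 0 < δ n := fun n => pow_pos (hr0 n) 4
  have hδlim : Tendsto δ atTop (𝓝 0) := by simpa using hrlim.pow 4
  refine hasFDerivAt_of_tendstoUniformly (l := atTop)
    (f := fun n x => ∫ y, regKernel (δ n) (x - y) * ρ y)
    (f' := fun n x => innerSL ℝ (∫ y, ρ y • regGradKernel (δ n) (x - y)))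
    (g' := fun x => innerSL ℝ (newtonField ρ x)) ?_
    (fun n x => h.hasFDerivAt_regPotential (hδ0 n) x) ?_ x
  · set L : ℝ≥0∞ := ∫⁻ y, ‖ρ y‖ₑ with hL
    have hLt : L ≠ ⊤ := h.integrable.2.ne
    have key : ∀ n x, ‖newtonField ρ x - ∫ y, ρ y • regGradKernel (δ n) (x - y)‖ₑ
        ≤ ENNReal.ofReal (M * 1 * (4 * Real.pi * r n)) + ENNReal.ofReal (3 * r n) * L := by
      intro n x
      rw [newtonField, ← integral_sub (h.integrable_field x) (h.integrable_regField (hδ0 n) x)]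
      refine (enorm_integral_le_lintegral_enorm _).trans ?_
      have := h.lintegral_mul_enorm_kernel_le (a := 1) (b := 3 * r n) (r := r n)
        (k := fun w => regGradKernel (δ n) w - gradKernel w) zero_le_one (hr0 n).le
        (fun w _ => norm_regGradKernel_sub_le (hδ0 n) w)
        (fun w hw => (norm_regGradKernel_sub_le_of_le (hδ0 n) (hr0 n) hw).trans
          (le_of_eq (by have := hr0 n; simp only [hδ]; field_simp))) x
      refine le_trans (le_of_eq (lintegral_congr fun y => ?_)) this
      rw [← smul_sub, enorm_smul, enorm_sub_rev]
    have hlim : Tendsto (fun n => ENNReal.ofReal (M * 1 * (4 * Real.pi * r n))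
        + ENNReal.ofReal (3 * r n) * L) atTop (𝓝 0) := by
      have h1 : Tendsto (fun n => ENNReal.ofReal (M * 1 * (4 * Real.pi * r n))) atTop (𝓝 0) := by
        rw [← ENNReal.ofReal_zero]
        refine ENNReal.tendsto_ofReal ?_
        simpa using (hrlim.const_mul (4 * Real.pi)).const_mul (M * 1)
      have h2 : Tendsto (fun n => ENNReal.ofReal (3 * r n) * L) atTop (𝓝 0) := by
        have : Tendsto (fun n => ENNReal.ofReal (3 * r n)) atTop (𝓝 0) := by
          rw [← ENNReal.ofReal_zero]
          refine ENNReal.tendsto_ofReal ?_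
          simpa using hrlim.const_mul 3
        simpa using ENNReal.Tendsto.mul_const this (Or.inr hLt)
      simpa using h1.add h2
    rw [EMetric.tendstoUniformly_iff]
    intro ε hε
    filter_upwards [(tendsto_order.1 hlim).2 ε hε] with n hn x
    rw [edist_eq_enorm_sub, ← map_sub]
    refine lt_of_le_of_lt ?_ hn
    refine le_trans (le_of_eq ?_) (key n x)
    rw [← ofReal_norm, innerSL_apply_norm, ofReal_norm]
  · intro x
    rw [tendsto_iff_edist_tendsto_0]
    have hlim : Tendsto (fun n => ENNReal.ofReal (δ n) * rieszInt ρ x) atTop (𝓝 0) := by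
      have : Tendsto (fun n => ENNReal.ofReal (δ n)) atTop (𝓝 0) := by
        rw [← ENNReal.ofReal_zero]
        exact ENNReal.tendsto_ofReal hδlim
      simpa using ENNReal.Tendsto.mul_const this (Or.inr (h.rieszInt_ne_top x))
    refine tendsto_of_tendsto_of_tendsto_of_le_of_le tendsto_const_nhds hlim
      (fun _ => zero_le) fun n => ?_
    simp only
    rw [edist_eq_enorm_sub, newton, ← integral_sub (h.integrable_regPotential (hδ0 n) x)
      (h.integrable_potential x)]
    refine (enorm_integral_le_lintegral_enorm _).trans ?_
    rw [rieszInt, ← lintegral_const_mul' _ _ ENNReal.ofReal_ne_top]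
    refine lintegral_mono_ae ?_
    have hne : ∀ᵐ y : R3, y ≠ x := by
      simp [ae_iff]
    filter_upwards [hne] with y hy
    rw [← sub_mul, enorm_mul]
    calc _ ≤ ENNReal.ofReal (δ n * (‖x - y‖ ^ 2)⁻¹) * ‖ρ y‖ₑ := by
          gcongr
          rw [← ofReal_norm]
          exact ENNReal.ofReal_le_ofReal
            (norm_regKernel_sub_le (hδ0 n) (sub_ne_zero.2 hy.symm))
      _ = _ := by
          rw [ENNReal.ofReal_mul (hδ0 n).le]
          ring

theorem differentiable_newton (h : BddDensity ρ M R) : Differentiable ℝ (newton ρ) :=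
  fun x => (h.hasFDerivAt_newton x).differentiableAt

theorem gradient_newton (h : BddDensity ρ M R) (x : R3) :
    gradient (newton ρ) x = newtonField ρ x := by
  rw [gradient, (h.hasFDerivAt_newton x).fderiv]
  exact (InnerProductSpace.toDual ℝ R3).symm_apply_apply _

theorem measurable_newtonField (h : BddDensity ρ M R) : Measurable (newtonField ρ) := by
  have e : newtonField ρ = fun x => (InnerProductSpace.toDual ℝ R3).symm (fderiv ℝ (newton ρ) x) :=
    funext fun x => (h.gradient_newton x).symm
  rw [e]
  exact (InnerProductSpace.toDual ℝ R3).symm.continuous.measurable.comp (measurable_fderiv ℝ _)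

end BddDensity

/-! ### Polar coordinates and the field energy identity -/

/-- Integration in polar coordinates in `ℝ³`. -/
theorem integral_polar {F : R3 → ℝ} (hF : Integrable F) :
    (∀ᵐ θ : sphere (0 : R3) 1 ∂(volume : Measure R3).toSphere,
      IntegrableOn (fun r : ℝ => r ^ 2 * F (r • (θ : R3))) (Ioi 0)) ∧
    ∫ x, F x = ∫ θ : sphere (0 : R3) 1, (∫ r in Ioi (0 : ℝ), r ^ 2 * F (r • (θ : R3)))
      ∂(volume : Measure R3).toSphere := by
  set σ := (volume : Measure R3).toSphere with hσ
  set ν := Measure.volumeIoiPow 2 with hν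
  have hmp : MeasurePreserving (homeomorphUnitSphereProd R3)
      ((volume : Measure R3).comap (↑)) (σ.prod ν) := by
    have := (volume : Measure R3).measurePreserving_homeomorphUnitSphereProd
    simpa only [finrank_euclideanSpace, Fintype.card_fin] using this
  have hemb := (homeomorphUnitSphereProd R3).measurableEmbedding
  set G : sphere (0 : R3) 1 × Ioi (0 : ℝ) → ℝ := fun p => F ((p.2 : ℝ) • (p.1 : R3)) with hG
  have hGF : ∀ x : ({0}ᶜ : Set R3), G (homeomorphUnitSphereProd R3 x) = F x := fun x => by
    have hx : ‖(x : R3)‖ ≠ 0 := norm_ne_zero_iff.2 x.2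
    simp [hG, homeomorphUnitSphereProd, smul_smul, hx]
  have hGint : Integrable G (σ.prod ν) := by
    rw [← hmp.integrable_comp_emb hemb]
    have : G ∘ homeomorphUnitSphereProd R3 = fun x : ({0}ᶜ : Set R3) => F x := funext hGF
    rw [this]
    have h2 : IntegrableOn F ({0}ᶜ : Set R3) := hF.integrableOn
    exact (integrableOn_iff_comap_subtypeVal (measurableSet_singleton _).compl).1 h2
  have hconv : ∀ u : Ioi (0 : ℝ) → ℝ, ∫ r, u r ∂ν
      = ∫ r : Ioi (0 : ℝ), (r : ℝ) ^ 2 * u r ∂(Measure.comap Subtype.val volume) := fun u => by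
    simp only [hν, Measure.volumeIoiPow, ENNReal.ofReal]
    rw [integral_withDensity_eq_integral_smul]
    · refine integral_congr_ae (Eventually.of_forall fun r => ?_)
      simp only [NNReal.smul_def, Real.coe_toNNReal _ (pow_nonneg r.2.out.le 2), smul_eq_mul]
    · exact (measurable_subtype_coe.pow_const _).real_toNNReal
  refine ⟨?_, ?_⟩
  · filter_upwards [hGint.prod_right_ae] with θ hθ
    rw [integrableOn_iff_comap_subtypeVal measurableSet_Ioi]
    simp only [hν, Measure.volumeIoiPow, ENNReal.ofReal] at hθ
    rw [integrable_withDensity_iff_integrable_smul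
      ((measurable_subtype_coe.pow_const _).real_toNNReal)] at hθ
    refine hθ.congr (Eventually.of_forall fun r => ?_)
    simp only [hG, NNReal.smul_def, Real.coe_toNNReal _ (pow_nonneg r.2.out.le 2), smul_eq_mul,
      Function.comp_apply]
  · calc ∫ x, F x = ∫ x : ({0}ᶜ : Set R3), F x ∂((volume : Measure R3).comap (↑)) := by
          rw [integral_subtype_comap (measurableSet_singleton _).compl F,
            restrict_compl_singleton]
      _ = ∫ p, G p ∂(σ.prod ν) := by
          rw [← hmp.integral_comp hemb]
          simp only [hGF]
      _ = ∫ θ, ∫ r, G (θ, r) ∂ν ∂σ := integral_prod _ hGint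
      _ = _ := by
          refine integral_congr_ae (Eventually.of_forall fun θ => ?_)
          simp only
          rw [hconv, integral_subtype_comap measurableSet_Ioi
            fun r : ℝ => r ^ 2 * F (r • (θ : R3))]

/-- The Newtonian kernel is a fundamental solution: for a function `u` vanishing at infinity,
`u(y) = -∫ ⟨∇u(x), ∇K(x - y)⟩ dx`. -/
theorem integral_inner_gradKernel {u : R3 → ℝ} {G : R3 → R3}
    (hu : ∀ x, HasFDerivAt u (innerSL ℝ (G x)) x) (hlim : Tendsto u (cocompact R3) (𝓝 0)) (y : R3)
    (hint : Integrable fun x => inner ℝ (G x) (gradKernel (x - y))) :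
    ∫ x, inner ℝ (G x) (gradKernel (x - y)) = - u y := by
  have hpi := Real.pi_pos
  have hint' : Integrable fun x => inner ℝ (G (x + y)) (gradKernel x) := by
    simpa using hint.comp_add_right y
  have e0 : ∫ x, inner ℝ (G x) (gradKernel (x - y)) = ∫ x, inner ℝ (G (x + y)) (gradKernel x) := by
    rw [← integral_add_right_eq_self (fun x => inner ℝ (G x) (gradKernel (x - y))) y]
    simp
  obtain ⟨hI, hE⟩ := integral_polar hint'
  -- The Jacobian `r²` turns `∇K` into `θ / 4π`, so along each ray the integrand is an exact
  -- derivative of `u / 4π`.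
  have hrad : ∀ (θ : sphere (0 : R3) 1), ∀ r ∈ Ioi (0 : ℝ),
      r ^ 2 * inner ℝ (G (r • (θ : R3) + y)) (gradKernel (r • (θ : R3)))
        = (4 * Real.pi)⁻¹ * inner ℝ (G (r • (θ : R3) + y)) (θ : R3) := fun θ r hr => by
    have hr' : 0 < r := hr
    have hθ : ‖(θ : R3)‖ = 1 := by simp
    rw [gradKernel, norm_smul, hθ, mul_one, Real.norm_of_nonneg hr'.le, real_inner_smul_right,
      real_inner_smul_right]
    field_simp
  have hderiv : ∀ (θ : sphere (0 : R3) 1) (r : ℝ), HasDerivAt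
      (fun r : ℝ => (4 * Real.pi)⁻¹ * u (r • (θ : R3) + y))
      ((4 * Real.pi)⁻¹ * inner ℝ (G (r • (θ : R3) + y)) (θ : R3)) r := fun θ r => by
    have h1 : HasDerivAt (fun r : ℝ => r • (θ : R3) + y) (θ : R3) r := by
      simpa using ((hasDerivAt_id r).smul_const (θ : R3)).add_const y
    have h2 := (hu (r • (θ : R3) + y)).comp_hasDerivAt r h1
    exact h2.const_mul _
  rw [e0, hE]
  have : ∀ᵐ θ : sphere (0 : R3) 1 ∂(volume : Measure R3).toSphere, ∫ r in Ioi (0 : ℝ),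
      r ^ 2 * inner ℝ (G (r • (θ : R3) + y)) (gradKernel (r • (θ : R3)))
        = - ((4 * Real.pi)⁻¹ * u y) := by
    filter_upwards [hI] with θ hθ
    rw [setIntegral_congr_fun measurableSet_Ioi (hrad θ)]
    have hθ' := hθ.congr_fun (hrad θ) measurableSet_Ioi
    have htend : Tendsto (fun r : ℝ => (4 * Real.pi)⁻¹ * u (r • (θ : R3) + y)) atTop (𝓝 0) := by
      have h1 : Tendsto (fun r : ℝ => r • (θ : R3) + y) atTop (cocompact R3) := by
        rw [← cobounded_eq_cocompact, ← comap_norm_atTop, tendsto_comap_iff]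
        refine tendsto_atTop_mono (f := fun r : ℝ => r - ‖y‖) (fun r => ?_)
          (tendsto_atTop_add_const_right _ _ tendsto_id)
        have hθ1 : ‖(θ : R3)‖ = 1 := by simp
        have h2 : r ≤ ‖r • (θ : R3)‖ := by
          rw [norm_smul, hθ1, mul_one]; exact Real.le_norm_self r
        have h3 := norm_sub_norm_le (r • (θ : R3)) (-y)
        rw [norm_neg, sub_neg_eq_add] at h3
        simp only [Function.comp_apply]
        linarith
      simpa using (hlim.comp h1).const_mul (4 * Real.pi)⁻¹
    -- Fundamental theorem of calculus along the ray, from the value at `y` for `r = 0` to zero at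
    -- infinity.
    rw [integral_Ioi_of_hasDerivAt_of_tendsto' (fun r _ => hderiv θ r) hθ' htend]
    simp
  -- The sphere has area `3 · (4π/3) = 4π`, which cancels the factor `(4π)⁻¹`.
  rw [integral_congr_ae this, integral_const, Measure.toSphere_real_apply_univ,
    volume_real_unit_ball]
  simp only [finrank_euclideanSpace, Fintype.card_fin, smul_eq_mul]
  push_cast
  field_simp

namespace BddDensity

variable {ρ : R3 → ℝ} {M R : ℝ}

theorem rieszInt_le_of_norm_ge (h : BddDensity ρ M R) (hR : 0 ≤ R) {x : R3}
    (hx : 2 * R + 1 ≤ ‖x‖) :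
    rieszInt ρ x ≤ ENNReal.ofReal (4 * (‖x‖ ^ 2)⁻¹) * ∫⁻ y, ‖ρ y‖ₑ := by
  rw [rieszInt, ← lintegral_const_mul'' _ h.meas.enorm]
  refine lintegral_mono fun y => ?_
  rcases lt_or_ge R ‖y‖ with hy | hy
  · simp [h.vanish y hy]
  · rw [mul_comm]
    gcongr
    have h1 : ‖x‖ / 2 ≤ ‖x - y‖ := by linarith [norm_sub_norm_le x y]
    have hx0 : 0 < ‖x‖ := by linarith
    calc (‖x - y‖ ^ 2)⁻¹ ≤ ((‖x‖ / 2) ^ 2)⁻¹ := by gcongr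
      _ = _ := by field_simp; norm_num

/-- With quadratic decay, the square is dominated by a multiple of the integrable function `(1 +
|x|)⁻⁴`. This is what justifies Fubini in the energy identity. -/
theorem exists_rieszInt_le (h : BddDensity ρ M R) (hR : 0 ≤ R) :
    ∃ C : ℝ, 0 ≤ C ∧ ∀ x, rieszInt ρ x ≤ ENNReal.ofReal (C * ((1 + ‖x‖) ^ 2)⁻¹) := by
  set L : ℝ := (∫⁻ y, ‖ρ y‖ₑ).toReal with hL
  have hL' : ∫⁻ y, ‖ρ y‖ₑ = ENNReal.ofReal L := (ENNReal.ofReal_toReal h.integrable.2.ne).symm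
  have hL0 : 0 ≤ L := ENNReal.toReal_nonneg
  have hpi := Real.pi_pos
  have hM := h.nonneg
  set D : ℝ := M * (4 * Real.pi * 1) + L with hD
  have hD0 : 0 ≤ D := by positivity
  refine ⟨D * (2 * R + 2) ^ 2 + 16 * L, by positivity, fun x => ?_⟩
  rcases le_total (2 * R + 1) ‖x‖ with hx | hx
  · refine (h.rieszInt_le_of_norm_ge hR hx).trans ?_
    rw [hL', ← ENNReal.ofReal_mul (by positivity)]
    apply ENNReal.ofReal_le_ofReal
    have hx1 : 1 ≤ ‖x‖ := by linarith
    have h1 : (‖x‖ ^ 2)⁻¹ ≤ 4 * ((1 + ‖x‖) ^ 2)⁻¹ := by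
      rw [← div_eq_mul_inv, le_div_iff₀ (by positivity), inv_mul_le_iff₀ (by positivity)]
      nlinarith
    calc 4 * (‖x‖ ^ 2)⁻¹ * L ≤ 4 * (4 * ((1 + ‖x‖) ^ 2)⁻¹) * L := by gcongr
      _ = (16 * L) * ((1 + ‖x‖) ^ 2)⁻¹ := by ring
      _ ≤ _ := by
          gcongr
          have : 0 ≤ D * (2 * R + 2) ^ 2 := by positivity
          linarith
  · refine (h.rieszInt_le one_pos x).trans ?_
    rw [hL', ← ENNReal.ofReal_mul (by positivity), ← ENNReal.ofReal_add (by positivity)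
      (by positivity)]
    apply ENNReal.ofReal_le_ofReal
    rw [← div_eq_mul_inv, le_div_iff₀ (by positivity)]
    simp only [one_pow, inv_one, one_mul]
    calc D * (1 + ‖x‖) ^ 2 ≤ D * (2 * R + 2) ^ 2 := by
          have : 1 + ‖x‖ ≤ 2 * R + 2 := by linarith
          gcongr
      _ ≤ _ := by linarith

theorem lintegral_rieszInt_sq_lt_top (h : BddDensity ρ M R) (hR : 0 ≤ R) :
    ∫⁻ x, rieszInt ρ x * rieszInt ρ x < ⊤ := by
  obtain ⟨C, hC0, hC⟩ := h.exists_rieszInt_le hR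
  have hint := (integrable_one_add_norm (μ := (volume : Measure R3)) (r := 4)
    (by simp; norm_num)).const_mul (C ^ 2)
  refine lt_of_le_of_lt (lintegral_mono fun x => ?_) hint.2
  refine (mul_le_mul' (hC x) (hC x)).trans ?_
  rw [← ENNReal.ofReal_mul (by positivity), ← ofReal_norm]
  apply ENNReal.ofReal_le_ofReal
  have h1 : (1 + ‖x‖) ^ (-4 : ℝ) = ((1 + ‖x‖) ^ 4)⁻¹ := by
    rw [Real.rpow_neg (by positivity)]
    norm_cast
  simp only [h1]
  rw [Real.norm_of_nonneg (by positivity)]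
  apply le_of_eq
  field_simp

theorem tendsto_newton_cocompact (h : BddDensity ρ M R) (hR : 0 ≤ R) :
    Tendsto (newton ρ) (cocompact R3) (𝓝 0) := by
  set L : ℝ := ∫ y, ‖ρ y‖ with hL
  have hL0 : 0 ≤ L := integral_nonneg fun _ => norm_nonneg _
  have hnorm : Tendsto (fun x : R3 => ‖x‖) (cocompact R3) atTop := tendsto_norm_cocompact_atTop
  have hlim : Tendsto (fun x : R3 => 2 * L * ‖x‖⁻¹) (cocompact R3) (𝓝 0) := by
    simpa using (tendsto_inv_atTop_zero.comp hnorm).const_mul (2 * L)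
  refine squeeze_zero_norm' ?_ hlim
  filter_upwards [hnorm.eventually_ge_atTop (2 * R + 1)] with x hx
  have hx0 : 0 < ‖x‖ := by linarith
  have hpi := Real.pi_gt_three
  rw [newton, hL]
  have : 2 * (∫ y, ‖ρ y‖) * ‖x‖⁻¹ = ∫ y, 2 * ‖x‖⁻¹ * ‖ρ y‖ := by
    rw [integral_const_mul]; ring
  rw [this]
  refine norm_integral_le_of_norm_le (h.integrable.norm.const_mul _)
    (Eventually.of_forall fun y => ?_)
  rcases lt_or_ge R ‖y‖ with hy | hy
  · simp [h.vanish y hy]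
  · rw [norm_mul]
    gcongr
    have h1 : ‖x‖ / 2 ≤ ‖x - y‖ := by linarith [norm_sub_norm_le x y]
    have h2 : 0 < ‖x - y‖ := by linarith
    rw [newtonKernel, norm_neg, Real.norm_of_nonneg (by positivity), one_div]
    calc (4 * Real.pi * ‖x - y‖)⁻¹ ≤ (‖x‖ / 2)⁻¹ := by
          apply inv_anti₀ (by positivity)
          nlinarith
      _ = _ := by field_simp

/-- The energy identity `∫ |∇φ|² = - ∫ φ ρ`. -/
theorem integral_norm_newtonField_sq (h : BddDensity ρ M R) (hR : 0 ≤ R) :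
    ∫ x, ‖newtonField ρ x‖ ^ 2 = - ∫ y, newton ρ y * ρ y := by
  -- One factor of `|∇φ|²` is expanded as `∫ ρ(y) ∇K(x - y) dy`. After exchanging the integrals, the
  -- representation formula for `u = φ` evaluates the `x`-integral as `-φ(y)`.
  set T : R3 × R3 → ℝ := fun p =>
    ρ p.2 * inner ℝ (newtonField ρ p.1) (gradKernel (p.1 - p.2)) with hT
  have hTm : AEStronglyMeasurable T (volume.prod volume) := by
    refine h.meas.comp_snd.mul ?_
    exact ((h.measurable_newtonField.comp measurable_fst).inner
      (measurable_gradKernel.comp (measurable_fst.sub measurable_snd))).aestronglyMeasurable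
  have hTint : Integrable T (volume.prod volume) := by
    refine ⟨hTm, ?_⟩
    rw [HasFiniteIntegral, lintegral_prod _ hTm.enorm]
    refine lt_of_le_of_lt (lintegral_mono fun x => ?_) (h.lintegral_rieszInt_sq_lt_top hR)
    calc ∫⁻ y, ‖T (x, y)‖ₑ
        ≤ ∫⁻ y, ‖newtonField ρ x‖ₑ * (‖ρ y‖ₑ * ENNReal.ofReal ((‖x - y‖ ^ 2)⁻¹)) := by
          refine lintegral_mono fun y => ?_
          simp only [hT]
          rw [enorm_mul]
          calc _ ≤ ‖ρ y‖ₑ * (‖newtonField ρ x‖ₑ * ‖gradKernel (x - y)‖ₑ) := by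
                gcongr
                simp only [← ofReal_norm]
                rw [← ENNReal.ofReal_mul (norm_nonneg _)]
                exact ENNReal.ofReal_le_ofReal (norm_inner_le_norm _ _)
            _ ≤ ‖ρ y‖ₑ * (‖newtonField ρ x‖ₑ * ENNReal.ofReal ((‖x - y‖ ^ 2)⁻¹)) := by
                gcongr
                rw [← ofReal_norm]
                exact ENNReal.ofReal_le_ofReal (norm_gradKernel_le _)
            _ = _ := by ring
      _ = ‖newtonField ρ x‖ₑ * rieszInt ρ x := by
          rw [rieszInt, lintegral_const_mul']
          rw [← ofReal_norm]
          exact ENNReal.ofReal_ne_top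
      _ ≤ _ := by
          gcongr
          exact enorm_newtonField_le x
  calc ∫ x, ‖newtonField ρ x‖ ^ 2 = ∫ x, ∫ y, T (x, y) := by
        refine integral_congr_ae (Eventually.of_forall fun x => ?_)
        simp only
        rw [← real_inner_self_eq_norm_sq]
        have := integral_inner (𝕜 := ℝ) (h.integrable_field x) (newtonField ρ x)
        rw [show inner ℝ (newtonField ρ x) (newtonField ρ x)
          = inner ℝ (newtonField ρ x) (∫ y, ρ y • gradKernel (x - y)) from rfl, ← this]
        refine integral_congr_ae (Eventually.of_forall fun y => ?_)
        simp only [hT, real_inner_smul_right]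
    _ = ∫ y, ∫ x, T (x, y) := integral_integral_swap hTint
    _ = ∫ y, -(newton ρ y * ρ y) := by
        refine integral_congr_ae ?_
        filter_upwards [hTint.prod_left_ae] with y hy
        simp only [hT] at hy ⊢
        -- Fubini yields integrability of the slice only with the factor `ρ y`, which can be removed
        -- when it is nonzero.
        rcases eq_or_ne (ρ y) 0 with h0 | h0
        · simp [h0]
        · rw [integral_const_mul, integral_inner_gradKernel h.hasFDerivAt_newton
            (h.tendsto_newton_cocompact hR) y]
          · ring
          · exact (integrable_const_mul_iff (isUnit_iff_ne_zero.2 h0) _).1 hy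
    _ = _ := integral_neg _

end BddDensity

/-! ### Phase space densities and the energy increment -/

/-- A bounded measurable phase space density vanishing outside the ball of radius `A`. -/
structure BddPhase (f : Phase → ℝ) (M A : ℝ) : Prop where
  meas : AEStronglyMeasurable f volume
  nonneg : 0 ≤ M
  radius_nonneg : 0 ≤ A
  bound : ∀ᵐ z, ‖f z‖ ≤ M
  vanish : ∀ z, A < ‖z‖ → f z = 0

namespace BddPhase

variable {f g : Phase → ℝ} {M A : ℝ}

theorem integrable (h : BddPhase f M A) : Integrable f :=
  integrable_of_bounded_of_vanish h.meas h.bound h.vanish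

theorem integrable_prod (h : BddPhase f M A) :
    Integrable f ((volume : Measure R3).prod (volume : Measure R3)) := h.integrable

theorem integrable_mul (h : BddPhase f M A) {a : Phase → ℝ} {c : ℝ}
    (ha : AEStronglyMeasurable a volume) (hc : ∀ z, ‖z‖ ≤ A → ‖a z‖ ≤ c) :
    Integrable fun z => a z * f z := by
  refine (h.integrable.norm.const_mul c).mono' (ha.mul h.meas) (Eventually.of_forall fun z => ?_)
  rcases lt_or_ge A ‖z‖ with hz | hz
  · simp [h.vanish z hz]
  · rw [norm_mul]
    gcongr
    exact hc z hz

theorem integrable_continuous_mul (h : BddPhase f M A) {a : Phase → ℝ} (ha : Continuous a) :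
    Integrable fun z => a z * f z := by
  obtain ⟨c, hc⟩ := (isCompact_closedBall (0 : Phase) A).exists_bound_of_continuousOn
    ha.continuousOn
  exact h.integrable_mul ha.aestronglyMeasurable fun z hz => hc z (by simpa using hz)

theorem volume_real_closedBall (hA : 0 ≤ A) :
    (volume : Measure R3).real (closedBall 0 A) = 4 * Real.pi / 3 * A ^ 3 := by
  have := Real.pi_pos
  rw [measureReal_def, EuclideanSpace.volume_closedBall_fin_three, ENNReal.toReal_mul,
    ENNReal.toReal_pow, ENNReal.toReal_ofReal hA, ENNReal.toReal_ofReal (by positivity)]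
  ring

/-- The norm on phase space is the maximum of the two Euclidean norms, so position and velocity are
confined separately to balls of radius `A`; the constant is `M` times the volume of the velocity
ball. -/
theorem bddDensity (h : BddPhase f M A) :
    BddDensity (density f) (M * (4 * Real.pi / 3 * A ^ 3)) A where
  meas := h.integrable_prod.1.integral_prod_right'
  nonneg := by
    have := h.nonneg
    have := h.radius_nonneg
    have := Real.pi_pos
    positivity
  bound := by
    have hb : ∀ᵐ z ∂((volume : Measure R3).prod (volume : Measure R3)), ‖f z‖ ≤ M := h.bound
    filter_upwards [Measure.ae_ae_of_ae_prod hb] with x hx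
    rw [density, ← setIntegral_eq_integral_of_forall_compl_eq_zero (s := closedBall 0 A),
      ← volume_real_closedBall h.radius_nonneg]
    · refine norm_setIntegral_le_of_norm_le_const_ae
        (isCompact_closedBall _ _).measure_lt_top ?_
      exact ae_restrict_of_ae hx
    · intro v hv
      refine h.vanish _ (lt_of_lt_of_le (by simpa using hv) (le_max_right _ _))
  vanish x hx := by
    rw [density]
    refine integral_eq_zero_of_ae (Eventually.of_forall fun v => ?_)
    exact h.vanish _ (lt_of_lt_of_le hx (le_max_left _ _))

theorem lintegral_mul_enorm_density_le (h : Integrable f)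
    {w : R3 → ℝ≥0∞} (hw : Measurable w) :
    ∫⁻ x, ‖density f x‖ₑ * w x ≤ ∫⁻ z : Phase, w z.1 * ‖f z‖ₑ := by
  have hm : AEMeasurable (fun z : R3 × R3 => w z.1 * ‖f z‖ₑ)
      ((volume : Measure R3).prod (volume : Measure R3)) :=
    (hw.comp measurable_fst).aemeasurable.mul h.1.enorm
  have hm' : ∀ᵐ x, AEMeasurable (fun v => ‖f (x, v)‖ₑ) (volume : Measure R3) := by
    have : Integrable f ((volume : Measure R3).prod (volume : Measure R3)) := h
    filter_upwards [this.prod_right_ae] with x hx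
    exact hx.1.enorm
  calc _ ≤ ∫⁻ x, ∫⁻ v, w x * ‖f (x, v)‖ₑ := by
        refine lintegral_mono_ae ?_
        filter_upwards [hm'] with x hx
        rw [lintegral_const_mul'' _ hx, mul_comm]
        gcongr
        exact enorm_integral_le_lintegral_enorm _
    _ = _ := (lintegral_prod _ hm).symm

theorem lintegral_enorm_density_le (h : Integrable f) :
    ∫⁻ x, ‖density f x‖ₑ ≤ ∫⁻ z, ‖f z‖ₑ := by
  simpa using lintegral_mul_enorm_density_le h (w := fun _ => 1) measurable_const

/-- The force field is bounded by a constant times the square of the size of the support. -/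
theorem norm_newtonField_le (h : BddPhase f M A) (hA : 0 < A) {L : ℝ} (hL : ∫ z, ‖f z‖ ≤ L)
    (x : R3) :
    ‖newtonField (density f) x‖ ≤ (M * (16 * Real.pi ^ 2 / 3) + L) * A ^ 2 := by
  have hM := h.nonneg
  have hpi := Real.pi_pos
  have hL0 : 0 ≤ L := (integral_nonneg fun _ => norm_nonneg _).trans hL
  have h1 : ‖newtonField (density f) x‖ₑ
      ≤ ENNReal.ofReal ((M * (16 * Real.pi ^ 2 / 3) + L) * A ^ 2) := by
    -- Splitting at radius `1/A` balances the near part, of order `A³ · A⁻¹`, with the far part, of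
    -- order `A²`.
    refine (BddDensity.enorm_newtonField_le x).trans
      ((h.bddDensity.rieszInt_le (inv_pos.2 hA) x).trans ?_)
    have hL' : ∫⁻ x, ‖density f x‖ₑ ≤ ENNReal.ofReal L := by
      refine (lintegral_enorm_density_le h.integrable).trans ?_
      rw [← ofReal_integral_norm_eq_lintegral_enorm h.integrable]
      exact ENNReal.ofReal_le_ofReal hL
    calc _ ≤ ENNReal.ofReal (M * (4 * Real.pi / 3 * A ^ 3) * (4 * Real.pi * A⁻¹))
          + ENNReal.ofReal (((A⁻¹) ^ 2)⁻¹) * ENNReal.ofReal L := by gcongr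
      _ = _ := by
          rw [← ENNReal.ofReal_mul (by positivity), ← ENNReal.ofReal_add (by positivity)
            (by positivity)]
          congr 1
          field_simp
          ring
  rw [← ofReal_norm] at h1
  exact (ENNReal.ofReal_le_ofReal_iff (by positivity)).1 h1

/-- Reduces the force difference to a weighted `L¹` bound on phase space, where the flow estimates
apply. -/
theorem newtonField_sub_le (hf : BddPhase f M A) (hg : BddPhase g M A) (x : R3) {Q : ℝ}
    (hQ0 : 0 ≤ Q)
    (hQ : ∫⁻ z : Phase, ENNReal.ofReal ((‖x - z.1‖ ^ 2)⁻¹) * ‖f z - g z‖ₑ ≤ ENNReal.ofReal Q) :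
    ‖newtonField (density f) x - newtonField (density g) x‖ ≤ Q := by
  have hd : ∀ᵐ y, density f y - density g y = density (fun z => f z - g z) y := by
    filter_upwards [hf.integrable_prod.prod_right_ae, hg.integrable_prod.prod_right_ae]
      with y h1 h2
    exact (integral_sub h1 h2).symm
  have h1 : ‖newtonField (density f) x - newtonField (density g) x‖ₑ ≤ ENNReal.ofReal Q := by
    rw [newtonField, newtonField, ← integral_sub (hf.bddDensity.integrable_field x)
      (hg.bddDensity.integrable_field x)]
    refine (enorm_integral_le_lintegral_enorm _).trans ?_
    refine le_trans (lintegral_mono_ae ?_) ((lintegral_mul_enorm_density_le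
      (hf.integrable.sub hg.integrable)
      (w := fun y => ENNReal.ofReal ((‖x - y‖ ^ 2)⁻¹)) (by fun_prop)).trans hQ)
    filter_upwards [hd] with y hy
    rw [← sub_smul, enorm_smul, hy]
    refine mul_le_mul_right ?_ _
    rw [← ofReal_norm]
    exact ENNReal.ofReal_le_ofReal (norm_gradKernel_le _)
  rw [← ofReal_norm] at h1
  exact (ENNReal.ofReal_le_ofReal_iff hQ0).1 h1

theorem integral_fst_mul (h : BddPhase f M A) {u : R3 → ℝ} (hu : Continuous u) :
    ∫ z : Phase, u z.1 * f z = ∫ x, u x * density f x := by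
  have hint : Integrable (fun z : R3 × R3 => u z.1 * f z)
      ((volume : Measure R3).prod (volume : Measure R3)) :=
    h.integrable_continuous_mul (hu.comp continuous_fst)
  calc _ = ∫ x, ∫ v, u x * f (x, v) := integral_prod _ hint
    _ = _ := by simp only [integral_const_mul, density]

/-- Exhibits the interaction energy as a bilinear pairing, the source of the exact midpoint formula.
-/
theorem energy_eq (h : BddPhase f M A) :
    energy f = (1 / 2) * (∫ z : Phase, ‖z.2‖ ^ 2 * f z)
      + (1 / 2) * ∫ z : Phase, newton (density f) z.1 * f z := by
  have hd := h.bddDensity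
  rw [energy, potential_eq_newton, h.integral_fst_mul hd.differentiable_newton.continuous]
  simp only [hd.gradient_newton]
  rw [hd.integral_norm_newtonField_sq h.radius_nonneg]
  ring

end BddPhase

theorem newtonKernel_neg (w : R3) : newtonKernel (-w) = newtonKernel w := by
  simp [newtonKernel]

/-- Symmetry of the Newtonian interaction. -/
theorem integral_newton_mul_comm {ρ σ : R3 → ℝ} {M M' R R' : ℝ} (hρ : BddDensity ρ M R)
    (hσ : BddDensity σ M' R') :
    ∫ x, newton ρ x * σ x = ∫ x, newton σ x * ρ x := by
  have hm : AEStronglyMeasurable (fun p : R3 × R3 => newtonKernel (p.1 - p.2) * ρ p.2 * σ p.1)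
      ((volume : Measure R3).prod (volume : Measure R3)) :=
    ((measurable_newtonKernel.comp (measurable_fst.sub measurable_snd)).aestronglyMeasurable.mul
      hρ.meas.comp_snd).mul hσ.meas.comp_fst
  have hint : Integrable (fun p : R3 × R3 => newtonKernel (p.1 - p.2) * ρ p.2 * σ p.1)
      ((volume : Measure R3).prod (volume : Measure R3)) := by
    refine ⟨hm, ?_⟩
    rw [HasFiniteIntegral, lintegral_prod _ hm.enorm]
    obtain ⟨C, hC⟩ := hρ.exists_lintegral_enorm_potential_le
    calc _ ≤ ∫⁻ x, C * ‖σ x‖ₑ := by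
          refine lintegral_mono fun x => ?_
          simp only [enorm_mul (_ * _) (σ x)]
          rw [lintegral_mul_const' _ _ (by rw [← ofReal_norm]; exact ENNReal.ofReal_ne_top)]
          gcongr
          exact hC x
      _ = C * ∫⁻ x, ‖σ x‖ₑ := lintegral_const_mul'' _ hσ.meas.enorm
      _ < ⊤ := ENNReal.mul_lt_top ENNReal.coe_lt_top hσ.integrable.2
  calc _ = ∫ x, ∫ y, newtonKernel (x - y) * ρ y * σ x := by
        simp only [newton, integral_mul_const]
    _ = ∫ y, ∫ x, newtonKernel (x - y) * ρ y * σ x := integral_integral_swap hint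
    _ = _ := by
        refine integral_congr_ae (Eventually.of_forall fun y => ?_)
        simp only [newton]
        rw [← integral_mul_const]
        refine integral_congr_ae (Eventually.of_forall fun x => ?_)
        simp only
        rw [← newtonKernel_neg (y - x), neg_sub]
        ring

/-- The energy difference of two densities, through the mean of their particle energies. -/
theorem energy_sub_energy {f g : Phase → ℝ} {M A : ℝ} (hf : BddPhase f M A)
    (hg : BddPhase g M A) :
    energy g - energy f =
      (∫ z : Phase, ((1 / 2) * ‖z.2‖ ^ 2
        + (1 / 2) * (newton (density f) z.1 + newton (density g) z.1)) * g z)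
      - ∫ z : Phase, ((1 / 2) * ‖z.2‖ ^ 2
        + (1 / 2) * (newton (density f) z.1 + newton (density g) z.1)) * f z := by
  have hcf := hf.bddDensity.differentiable_newton.continuous
  have hcg := hg.bddDensity.differentiable_newton.continuous
  have expand : ∀ k : Phase → ℝ, BddPhase k M A →
      ∫ z : Phase, ((1 / 2) * ‖z.2‖ ^ 2
        + (1 / 2) * (newton (density f) z.1 + newton (density g) z.1)) * k z
      = (1 / 2) * (∫ z : Phase, ‖z.2‖ ^ 2 * k z)
        + ((1 / 2) * (∫ z : Phase, newton (density f) z.1 * k z)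
        + (1 / 2) * ∫ z : Phase, newton (density g) z.1 * k z) := fun k hk => by
    have i1 : Integrable fun z : Phase => ‖z.2‖ ^ 2 * k z :=
      hk.integrable_continuous_mul (continuous_snd.norm.pow 2)
    have i2 : Integrable fun z : Phase => newton (density f) z.1 * k z :=
      hk.integrable_continuous_mul (hcf.comp continuous_fst)
    have i3 : Integrable fun z : Phase => newton (density g) z.1 * k z :=
      hk.integrable_continuous_mul (hcg.comp continuous_fst)
    have i23 : Integrable fun z : Phase => (1 / 2) * (newton (density f) z.1 * k z)
        + (1 / 2) * (newton (density g) z.1 * k z) := (i2.const_mul _).add (i3.const_mul _)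
    rw [← integral_const_mul, ← integral_const_mul, ← integral_const_mul,
      ← integral_add (i2.const_mul _) (i3.const_mul _),
      ← integral_add (i1.const_mul _) i23]
    refine integral_congr_ae (Eventually.of_forall fun z => ?_)
    ring
  -- By symmetry of the interaction the two cross terms cancel, leaving the two self-energies.
  rw [expand f hf, expand g hg, hf.energy_eq, hg.energy_eq, hg.integral_fst_mul hcf,
    hf.integral_fst_mul hcg, integral_newton_mul_comm hf.bddDensity hg.bddDensity]
  ring

/-! ### Stability of the force under transport -/

/-- In polar coordinates the radial power is `2 - 2s`, which exceeds `-1` precisely for `s < 3/2`.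
-/
theorem lintegral_ball_inv_norm_sq_rpow_lt_top {s : ℝ} (hs0 : 0 < s) (hs : s < 3 / 2) :
    ∫⁻ w in ball (0 : R3) 1, ENNReal.ofReal ((‖w‖ ^ 2)⁻¹) ^ s < ⊤ := by
  have hint : IntegrableOn (fun w : R3 => ‖w‖ ^ (-(2 * s))) (ball 0 1) := by
    rw [integrableOn_fun_norm_addHaar volume (f := fun y : ℝ => y ^ (-(2 * s)))]
    have h1 : IntegrableOn (fun y : ℝ => y ^ (2 - 2 * s)) (Ioo 0 1) := by
      rw [intervalIntegral.integrableOn_Ioo_rpow_iff one_pos]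
      linarith
    refine h1.congr_fun (fun y hy => ?_) measurableSet_Ioo
    simp only [finrank_euclideanSpace, Fintype.card_fin, smul_eq_mul]
    rw [sub_eq_add_neg, Real.rpow_add hy.1]
    norm_num
  refine lt_of_le_of_lt (lintegral_mono fun w => ?_) hint.2
  rw [ENNReal.ofReal_rpow_of_nonneg (by positivity) hs0.le, ← ofReal_norm,
    Real.norm_of_nonneg (by positivity)]
  apply ENNReal.ofReal_le_ofReal
  simp only
  rw [Real.rpow_neg (norm_nonneg _), Real.rpow_mul (norm_nonneg _), Real.inv_rpow (by positivity),
    Real.rpow_two]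

/-- The singularity is confined to the unit ball around `x`, whose contribution is translation
invariant; elsewhere the weight is at most one. Velocities contribute only a volume factor. -/
theorem exists_lintegral_weight_rpow_le {s : ℝ} (hs0 : 0 < s) (hs : s < 3 / 2) (A : ℝ) :
    ∃ Q : ℝ≥0, ∀ x : R3, ∫⁻ z in closedBall (0 : Phase) A,
      ENNReal.ofReal ((‖x - z.1‖ ^ 2)⁻¹) ^ s ≤ Q := by
  set B : Set R3 := closedBall 0 A with hB
  set k : R3 → ℝ≥0∞ := fun w => ENNReal.ofReal ((‖w‖ ^ 2)⁻¹) ^ s with hk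
  have hkm : Measurable k := by
    simp only [hk]
    fun_prop
  have hBt : (volume : Measure R3) B < ⊤ := (isCompact_closedBall _ _).measure_lt_top
  set T : ℝ≥0∞ := volume B * ((∫⁻ w in ball (0 : R3) 1, k w) + volume B) with hT
  have hTt : T ≠ ⊤ := ENNReal.mul_ne_top hBt.ne
    (ENNReal.add_ne_top.2 ⟨(lintegral_ball_inv_norm_sq_rpow_lt_top hs0 hs).ne, hBt.ne⟩)
  refine ⟨T.toNNReal, fun x => ?_⟩
  rw [ENNReal.coe_toNNReal hTt]
  have hkx : Measurable fun y => k (x - y) := hkm.comp (measurable_const.sub measurable_id)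
  have e1 : (volume : Measure Phase).restrict (closedBall 0 A)
      = ((volume : Measure R3).restrict B).prod ((volume : Measure R3).restrict B) := by
    rw [Measure.prod_restrict, hB, closedBall_prod_same]
    rfl
  have e2 : ∫⁻ y in B, k (x - y) ≤ (∫⁻ w in ball (0 : R3) 1, k w) + volume B := by
    calc ∫⁻ y in B, k (x - y)
        ≤ ∫⁻ y in B, ((ball (0 : R3) 1).indicator k (x - y) + 1) := by
          refine lintegral_mono fun y => ?_
          by_cases hy : x - y ∈ ball (0 : R3) 1
          · rw [indicator_of_mem hy]
            exact le_self_add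
          · refine le_trans ?_ le_add_self
            have h1 : 1 ≤ ‖x - y‖ := by simpa using hy
            refine ENNReal.rpow_le_one (ENNReal.ofReal_le_one.2 ?_) hs0.le
            exact inv_le_one_of_one_le₀ (one_le_pow₀ h1)
      _ = (∫⁻ y in B, (ball (0 : R3) 1).indicator k (x - y)) + volume B := by
          rw [lintegral_add_right _ measurable_const]
          simp
      _ ≤ (∫⁻ y, (ball (0 : R3) 1).indicator k (x - y)) + volume B := by
          exact add_le_add_left (setLIntegral_le_lintegral _ _) _
      _ = _ := by
          rw [lintegral_sub_left_eq_self ((ball (0 : R3) 1).indicator k) x,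
            lintegral_indicator measurableSet_ball]
  calc _ = ∫⁻ z, k (x - z.1)
        ∂(((volume : Measure R3).restrict B).prod ((volume : Measure R3).restrict B)) := by
        rw [e1]
    _ = ∫⁻ y in B, ∫⁻ _ in B, k (x - y) :=
        lintegral_prod _ (hkx.comp measurable_fst).aemeasurable
    _ = (∫⁻ y in B, k (x - y)) * volume B := by
        simp only [lintegral_const, Measure.restrict_apply_univ]
        rw [lintegral_mul_const _ hkx]
    _ ≤ T := by
        rw [hT, mul_comm]
        gcongr

/-- Moving `f` by a measure preserving flow of speed at most `m ≤ 1` changes the Newtonian force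
by at most a constant times `m`. -/
theorem SmoothApprox.exists_lintegral_weight_le {f : Phase → ℝ} {p R : ℝ} {A : ℝ≥0∞}
    {F : ℕ → Phase → ℝ} (h : SmoothApprox f p R A F) (hp : 3 < p) (hA : A ≠ ⊤) :
    ∃ Q : ℝ≥0, ∀ (b : Phase → Phase) (Φ : ℝ → Phase → Phase) (K : ℝ≥0) (m : ℝ),
      IsFlow b Φ → LipschitzWith K b → (∀ z, ‖b z‖ ≤ m) → m ≤ 1 →
      (∀ t, MeasurePreserving (Φ t) volume volume) → ∀ x : R3,
      ∫⁻ z : Phase, ENNReal.ofReal ((‖x - z.1‖ ^ 2)⁻¹) * ‖f (Φ 1 z) - f z‖ₑ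
        ≤ ENNReal.ofReal m * Q := by
  have hp1 : 1 < p := by linarith
  have hpq : (p / (p - 1)).HolderConjugate p := (Real.HolderConjugate.conjExponent hp1).symm
  set s : ℝ := p / (p - 1) with hs
  have hs0 : 0 < s := hpq.pos
  -- The conjugate exponent is below `3/2` precisely because `p > 3`.
  have hs32 : s < 3 / 2 := by
    rw [hs, div_lt_div_iff₀ (by linarith) (by norm_num)]
    linarith
  obtain ⟨Q, hQ⟩ := exists_lintegral_weight_rpow_le hs0 hs32 (R + 1)
  have hfin : (Q : ℝ≥0∞) ^ (1 / s) * A ^ (1 / p) ≠ ⊤ :=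
    ENNReal.mul_ne_top (ENNReal.rpow_ne_top_of_nonneg (by positivity) ENNReal.coe_ne_top)
      (ENNReal.rpow_ne_top_of_nonneg (by positivity) hA)
  refine ⟨((Q : ℝ≥0∞) ^ (1 / s) * A ^ (1 / p)).toNNReal, fun b Φ K m hΦ hb hm hm1 hmp x => ?_⟩
  rw [ENNReal.coe_toNNReal hfin]
  have hm0 : 0 ≤ m := (norm_nonneg _).trans (hm 0)
  have hF1 : ∀ n, ContDiff ℝ 1 (F n) := fun n => contDiff_infty.1 (h.contDiff n) 1
  refine hΦ.lintegral_mul_enorm_comp_sub_le_of_tendsto hb hm hmp hF1 h.tendsto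
    (w := fun z : Phase => ENNReal.ofReal ((‖x - z.1‖ ^ 2)⁻¹)) (by fun_prop) (fun n t ht => ?_)
    (Eventually.of_forall fun _ => ENNReal.ofReal_ne_top)
  have hc : Continuous fun z => fderiv ℝ (F n) (Φ t z) :=
    ((hF1 n).continuous_fderiv one_ne_zero).comp (hΦ.lipschitz hb t).continuous
  -- Since `m ≤ 1`, the moved support stays in the ball of radius `R + 1` for times in `[0, 1]`.
  rw [lintegral_eq_setLIntegral_closedBall (R := R + 1)]
  · refine (ENNReal.lintegral_mul_le_Lp_mul_Lq _ hpq (by fun_prop)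
      hc.enorm.measurable.aemeasurable).trans ?_
    gcongr
    · exact hQ x
    · refine (setLIntegral_le_lintegral _ _).trans ?_
      have := (hmp t).lintegral_comp (f := fun z => ‖fderiv ℝ (F n) z‖ₑ ^ p)
        (((hF1 n).continuous_fderiv one_ne_zero).enorm.measurable.pow_const p)
      rw [this]
      exact h.fderiv_rpow_le n
  · intro z hz
    have : ‖fderiv ℝ (F n) (Φ t z)‖ₑ = 0 := by
      refine hΦ.comp_eq_zero hm (g := fun z => ‖fderiv ℝ (F n) z‖ₑ) (R := R)
        (fun z hz => enorm_fderiv_eq_zero_of_vanish (h.vanish n) hz) t (lt_of_le_of_lt ?_ hz)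
      rw [abs_of_nonneg ht.1]
      nlinarith [ht.1, ht.2]
    rw [this, mul_zero]

/-! ### Energy rates and the stationary equation -/

/-- The rate of change of the particle energy `|v|²/2 + φ` with `∇φ = G` along the flow of `H`. -/
def energyRate (G : R3 → R3) (H : Phase → ℝ) (z : Phase) : ℝ :=
  inner ℝ (G z.1) (gradV H z) - inner ℝ z.2 (gradX H z)

section EnergyRate

variable {H : Phase → ℝ} {ε₁ D : ℝ} {G : R3 → R3}

theorem norm_gradV_le (hH : Differentiable ℝ H) (h1 : ∀ z, ‖fderiv ℝ H z‖ ≤ ε₁) (z : Phase) :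
    ‖gradV H z‖ ≤ ε₁ :=
  (le_max_left _ _).trans (norm_hamField_le hH h1 z)

theorem norm_gradX_le (hH : Differentiable ℝ H) (h1 : ∀ z, ‖fderiv ℝ H z‖ ≤ ε₁) (z : Phase) :
    ‖gradX H z‖ ≤ ε₁ := by
  have := (le_max_right ‖(hamField H z).1‖ ‖(hamField H z).2‖).trans (norm_hamField_le hH h1 z)
  simpa [hamField] using this

theorem continuous_gradV (hH : ContDiff ℝ 2 H) : Continuous (gradV H) :=
  (contDiff_hamField hH).continuous.fst

theorem continuous_gradX (hH : ContDiff ℝ 2 H) : Continuous (gradX H) :=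
  continuous_neg_iff.1 (contDiff_hamField hH).continuous.snd

theorem norm_inner_gradV_le (hH : Differentiable ℝ H) (h1 : ∀ z, ‖fderiv ℝ H z‖ ≤ ε₁)
    (hG : ∀ x, ‖G x‖ ≤ D) (z : Phase) : ‖inner ℝ (G z.1) (gradV H z)‖ ≤ D * ε₁ := by
  have hD : 0 ≤ D := (norm_nonneg _).trans (hG 0)
  refine (norm_inner_le_norm _ _).trans ?_
  gcongr
  · exact hG _
  · exact norm_gradV_le hH h1 z

theorem norm_inner_gradX_le (hH : Differentiable ℝ H) (h1 : ∀ z, ‖fderiv ℝ H z‖ ≤ ε₁)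
    {A : ℝ} {z : Phase} (hz : ‖z‖ ≤ A) : ‖inner ℝ z.2 (gradX H z)‖ ≤ A * ε₁ := by
  have hA : 0 ≤ A := (norm_nonneg _).trans hz
  refine (norm_inner_le_norm _ _).trans ?_
  gcongr
  · exact (norm_snd_le z).trans hz
  · exact norm_gradX_le hH h1 z

theorem norm_energyRate_le (hH : Differentiable ℝ H) (h1 : ∀ z, ‖fderiv ℝ H z‖ ≤ ε₁)
    (hG : ∀ x, ‖G x‖ ≤ D) {A : ℝ} {z : Phase} (hz : ‖z‖ ≤ A) :
    ‖energyRate G H z‖ ≤ ε₁ * (D + A) := by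
  refine (norm_sub_le _ _).trans ?_
  have e1 := norm_inner_gradV_le hH h1 hG z
  have e2 := norm_inner_gradX_le hH h1 hz
  linarith

theorem measurable_inner_gradV (hH : ContDiff ℝ 2 H) (hG : Measurable G) :
    Measurable fun z : Phase => (inner ℝ (G z.1) (gradV H z) : ℝ) :=
  (hG.comp measurable_fst).inner (continuous_gradV hH).measurable

theorem continuous_inner_gradX (hH : ContDiff ℝ 2 H) :
    Continuous fun z : Phase => (inner ℝ z.2 (gradX H z) : ℝ) :=
  continuous_snd.inner (continuous_gradX hH)

theorem measurable_energyRate (hH : ContDiff ℝ 2 H) (hG : Measurable G) :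
    Measurable (energyRate G H) :=
  (measurable_inner_gradV hH hG).sub (continuous_inner_gradX hH).measurable

/-- The weak stationary equation, tested with a Hamiltonian `H` which need not be compactly
supported. -/
theorem IsStationary.integral_energyRate {f : Phase → ℝ} {M A : ℝ} (hst : IsStationary f)
    (hf : BddPhase f M A) (hH : ContDiff ℝ 2 H) (h1 : ∀ z, ‖fderiv ℝ H z‖ ≤ ε₁)
    (hG : ∀ x, ‖newtonField (density f) x‖ ≤ D) :
    ∫ z, energyRate (newtonField (density f)) H z * f z = 0 := by
  have hHd := hH.differentiable (by norm_num)
  have hA := hf.radius_nonneg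
  -- The cutoff equals one on a neighbourhood of the ball containing the support of `f`, so `χ H` is
  -- an admissible test function with the same gradient as `H` wherever `f` is nonzero.
  let χ : ContDiffBump (0 : Phase) :=
    ⟨A + 1, A + 2, by linarith, by linarith⟩
  have hψ : ContDiff ℝ 1 fun z => χ z * H z :=
    χ.contDiff.mul (hH.of_le (by norm_num))
  have hψc : HasCompactSupport fun z => χ z * H z := χ.hasCompactSupport.mul_right
  have hψd : Differentiable ℝ fun z => χ z * H z := hψ.differentiable one_ne_zero
  have hloc : ∀ z, ‖z‖ ≤ A → fderiv ℝ (fun z => χ z * H z) z = fderiv ℝ H z := fun z hz => by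
    apply Filter.EventuallyEq.fderiv_eq
    have hmem : z ∈ ball (0 : Phase) (A + 1) := by
      rw [mem_ball_zero_iff]; linarith
    filter_upwards [isOpen_ball.mem_nhds hmem] with w hw
    rw [χ.one_of_mem_closedBall (ball_subset_closedBall hw), one_mul]
  have hX : ∀ z, ‖z‖ ≤ A → gradX (fun z => χ z * H z) z = gradX H z := fun z hz =>
    ext_inner_right ℝ fun e => by rw [inner_gradX (hψd z), inner_gradX (hHd z), hloc z hz]
  have hV : ∀ z, ‖z‖ ≤ A → gradV (fun z => χ z * H z) z = gradV H z := fun z hz =>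
    ext_inner_right ℝ fun e => by rw [inner_gradV (hψd z), inner_gradV (hHd z), hloc z hz]
  have key := hst _ hψ hψc
  have e1 : ∀ z : Phase, inner ℝ z.2 (gradX (fun z => χ z * H z) z) * f z
      = inner ℝ z.2 (gradX H z) * f z := fun z => by
    rcases lt_or_ge A ‖z‖ with hz | hz
    · simp [hf.vanish z hz]
    · rw [hX z hz]
  have e2 : ∀ z : Phase, inner ℝ (gradient (potential f) z.1) (gradV (fun z => χ z * H z) z) * f z
      = inner ℝ (newtonField (density f) z.1) (gradV H z) * f z := fun z => by
    rcases lt_or_ge A ‖z‖ with hz | hz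
    · simp [hf.vanish z hz]
    · rw [hV z hz, potential_eq_newton, hf.bddDensity.gradient_newton]
  simp only [e1, e2] at key
  have i1 : Integrable fun z : Phase => inner ℝ z.2 (gradX H z) * f z :=
    hf.integrable_continuous_mul (continuous_inner_gradX hH)
  have i2 : Integrable fun z : Phase => inner ℝ (newtonField (density f) z.1) (gradV H z) * f z :=
    hf.integrable_mul (measurable_inner_gradV hH
      hf.bddDensity.measurable_newtonField).aestronglyMeasurable
      fun z _ => norm_inner_gradV_le hHd h1 hG z
  have : ∀ z, energyRate (newtonField (density f)) H z * f z
      = inner ℝ (newtonField (density f) z.1) (gradV H z) * f z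
        - inner ℝ z.2 (gradX H z) * f z := fun z => by rw [energyRate, sub_mul]
  simp only [this]
  rw [integral_sub i2 i1]
  linarith

end EnergyRate

/-! ### Pairings with transported densities -/

theorem norm_integral_mul_le_of_lintegral_le {E : Type*} [NormedAddCommGroup E]
    [MeasurableSpace E] {μ : Measure E} {a k : E → ℝ} {A c x : ℝ} (hc0 : 0 ≤ c) (hx0 : 0 ≤ x)
    (ha : ∀ z, ‖z‖ ≤ A → ‖a z‖ ≤ c) (hk : ∀ z, A < ‖z‖ → k z = 0)
    (hx : ∫⁻ z, ‖k z‖ₑ ∂μ ≤ ENNReal.ofReal x) : ‖∫ z, a z * k z ∂μ‖ ≤ c * x := by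
  rw [← ENNReal.ofReal_le_ofReal_iff (by positivity), ofReal_norm]
  refine (enorm_integral_le_lintegral_enorm _).trans ?_
  calc _ ≤ ∫⁻ z, ENNReal.ofReal c * ‖k z‖ₑ ∂μ := by
        refine lintegral_mono fun z => ?_
        rcases lt_or_ge A ‖z‖ with hz | hz
        · simp [hk z hz]
        · rw [enorm_mul]
          gcongr
          rw [← ofReal_norm]
          exact ENNReal.ofReal_le_ofReal (ha z hz)
    _ = ENNReal.ofReal c * ∫⁻ z, ‖k z‖ₑ ∂μ := lintegral_const_mul' _ _ ENNReal.ofReal_ne_top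
    _ ≤ _ := by
        rw [ENNReal.ofReal_mul hc0]
        gcongr

/-- The domination is over times within distance one of `s ∈ [0, 1]`, hence `|t| ≤ 2`; trajectories
from the support of `f` then stay in the ball of radius `R + M * 2`. -/
theorem IsFlow.hasDerivAt_integral_comp_mul {E : Type*} [NormedAddCommGroup E] [NormedSpace ℝ E]
    [FiniteDimensional ℝ E] [MeasurableSpace E] [BorelSpace E] {μ : Measure E}
    {b : E → E} {Φ : ℝ → E → E} {K : ℝ≥0} {M R c : ℝ} (h : IsFlow b Φ) (hb : LipschitzWith K b)
    (hM : ∀ z, ‖b z‖ ≤ M) {u f : E → ℝ} (hu : Differentiable ℝ u) (hf : Integrable f μ)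
    (hR : ∀ z, R < ‖z‖ → f z = 0)
    (hc : ∀ w, ‖w‖ ≤ R + M * 2 → ‖fderiv ℝ u w (b w)‖ ≤ c) {s : ℝ} (hs : s ∈ Icc (0 : ℝ) 1) :
    HasDerivAt (fun t => ∫ z, u (Φ t z) * f z ∂μ)
      (∫ z, fderiv ℝ u (Φ s z) (b (Φ s z)) * f z ∂μ) s := by
  have hM0 : 0 ≤ M := (norm_nonneg _).trans (hM 0)
  have hprop : ProperSpace E := FiniteDimensional.proper_real E
  have hΦc := fun t => (h.lipschitz hb t).continuous
  have hm : ∀ t, AEStronglyMeasurable (fun z => u (Φ t z) * f z) μ := fun t =>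
    (hu.continuous.comp (hΦc t)).aestronglyMeasurable.mul hf.1
  refine (hasDerivAt_integral_of_dominated_loc_of_deriv_le (𝕜 := ℝ)
    (F := fun t z => u (Φ t z) * f z)
    (F' := fun t z => fderiv ℝ u (Φ t z) (b (Φ t z)) * f z) (bound := fun z => c * ‖f z‖)
    (ball_mem_nhds s one_pos) (Eventually.of_forall hm) ?_ ?_ ?_ (hf.norm.const_mul c) ?_).2
  · obtain ⟨C, hC⟩ := (isCompact_closedBall (0 : E) R).exists_bound_of_continuousOn
      (hu.continuous.comp (hΦc s)).continuousOn
    refine (hf.norm.const_mul C).mono' (hm s) (Eventually.of_forall fun z => ?_)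
    rcases lt_or_ge R ‖z‖ with hz | hz
    · simp [hR z hz]
    · rw [norm_mul]
      gcongr
      exact hC z (by simpa using hz)
  · refine AEStronglyMeasurable.mul ?_ hf.1
    have hmeas : Measurable fun w => fderiv ℝ u w (b w) :=
      (isBoundedBilinearMap_apply (𝕜 := ℝ)).continuous.measurable.comp
        ((measurable_fderiv ℝ u).prodMk hb.continuous.measurable)
    exact (hmeas.comp (hΦc s).measurable).aestronglyMeasurable
  · refine Eventually.of_forall fun z t ht => ?_
    rcases lt_or_ge R ‖z‖ with hz | hz
    · simp [hR z hz]
    · rw [norm_mul]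
      gcongr
      apply hc
      have h1 := h.norm_sub_self_le hM t z
      have h2 := norm_sub_norm_le (Φ t z) z
      have h3 : |t| ≤ 2 := by
        rw [mem_ball, Real.dist_eq] at ht
        have := abs_sub_abs_le_abs_sub t s
        have h4 : |s| ≤ 1 := abs_le.2 ⟨by linarith [hs.1], hs.2⟩
        linarith
      have h5 : M * |t| ≤ M * 2 := by gcongr
      linarith
  · exact Eventually.of_forall fun z t _ => (h.hasDerivAt_comp hu z t).mul_const _

/-- If `g'(s) + g'(1 - s)` is bounded by `B` on `[0, 1]`, then `2 |g(1) - g(0)| ≤ B`. -/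
theorem two_mul_abs_sub_le_of_symm_deriv {g g' : ℝ → ℝ} {B : ℝ}
    (hg : ∀ s ∈ Icc (0 : ℝ) 1, HasDerivAt g (g' s) s)
    (hB : ∀ s ∈ Icc (0 : ℝ) 1, |g' s + g' (1 - s)| ≤ B) : 2 * |g 1 - g 0| ≤ B := by
  -- The antisymmetrized function `g s - g (1 - s)` increases by twice `g 1 - g 0` over the
  -- interval.
  have hd : ∀ s ∈ Icc (0 : ℝ) 1, HasDerivWithinAt (fun s => g s - g (1 - s))
      (g' s + g' (1 - s)) (Icc 0 1) s := fun s hs => by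
    have h1 := hg (1 - s) ⟨by linarith [hs.2], by linarith [hs.1]⟩
    have h2 := h1.comp_const_sub 1 s
    exact ((hg s hs).sub h2).hasDerivWithinAt.congr_deriv (by ring)
  have := (convex_Icc (0 : ℝ) 1).norm_image_sub_le_of_norm_hasDerivWithin_le hd hB
    (left_mem_Icc.2 zero_le_one) (right_mem_Icc.2 zero_le_one)
  simp only [sub_zero, sub_self, norm_one, mul_one, Real.norm_eq_abs] at this
  calc 2 * |g 1 - g 0| = |2 * (g 1 - g 0)| := by rw [abs_mul, abs_two]
    _ = |g 1 - g 0 - (g 0 - g 1)| := by congr 1; ring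
    _ ≤ B := this

theorem BddPhase.comp_flow {f : Phase → ℝ} {M R m t : ℝ} (hf : BddPhase f M R)
    {b : Phase → Phase} {Φ : ℝ → Phase → Phase} (h : IsFlow b Φ) (hm : ∀ z, ‖b z‖ ≤ m)
    (hmp : MeasurePreserving (Φ t) volume volume) (ht : |t| ≤ 1) :
    BddPhase (fun z => f (Φ t z)) M (R + m) where
  meas := hf.meas.comp_measurePreserving hmp
  nonneg := hf.nonneg
  radius_nonneg := add_nonneg hf.radius_nonneg ((norm_nonneg _).trans (hm 0))
  bound := hmp.quasiMeasurePreserving.ae hf.bound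
  vanish z hz := by
    have hm0 : 0 ≤ m := (norm_nonneg _).trans (hm 0)
    refine h.comp_eq_zero hm hf.vanish t (lt_of_le_of_lt ?_ hz)
    have := mul_le_mul_of_nonneg_left ht hm0
    linarith

theorem BddPhase.mono_radius {f : Phase → ℝ} {M R R' : ℝ} (hf : BddPhase f M R) (h : R ≤ R') :
    BddPhase f M R' :=
  ⟨hf.meas, hf.nonneg, hf.radius_nonneg.trans h, hf.bound, fun z hz => hf.vanish z (h.trans_lt hz)⟩

theorem IsFlow.integral_comp_mul_eq {E : Type*} [NormedAddCommGroup E] [NormedSpace ℝ E]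
    [MeasurableSpace E] [BorelSpace E] {μ : Measure E} {b : E → E}
    {Φ : ℝ → E → E} {K : ℝ≥0} (h : IsFlow b Φ) (hb : LipschitzWith K b) {s : ℝ}
    (hmp : MeasurePreserving (Φ s) μ μ) (k f : E → ℝ) :
    ∫ z, k (Φ s z) * f z ∂μ = ∫ z, k z * f (Φ (-s) z) ∂μ := by
  rw [← hmp.integral_comp (h.homeomorph hb s).measurableEmbedding fun z => k z * f (Φ (-s) z)]
  simp only [h.neg_apply_apply hb]

/-- The one-particle energy in the mean of the fields generated by `f` and `g`. -/
def meanParticleEnergy (f g : Phase → ℝ) (z : Phase) : ℝ :=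
  (1 / 2) * ‖z.2‖ ^ 2 + (1 / 2) * (newton (density f) z.1 + newton (density g) z.1)

theorem hasFDerivAt_meanParticleEnergy {f g : Phase → ℝ} {M A : ℝ} (hf : BddPhase f M A)
    (hg : BddPhase g M A) (z : Phase) :
    HasFDerivAt (meanParticleEnergy f g)
      ((1 / 2 : ℝ) • ((2 : ℝ) • (innerSL ℝ z.2).comp (ContinuousLinearMap.snd ℝ R3 R3))
        + (1 / 2 : ℝ) • ((innerSL ℝ (newtonField (density f) z.1)).comp
            (ContinuousLinearMap.fst ℝ R3 R3)
          + (innerSL ℝ (newtonField (density g) z.1)).comp (ContinuousLinearMap.fst ℝ R3 R3)))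
      z := by
  have h1 : HasFDerivAt (fun z : Phase => ‖z.2‖ ^ 2)
      ((2 : ℝ) • (innerSL ℝ z.2).comp (ContinuousLinearMap.snd ℝ R3 R3)) z := by
    have := (hasStrictFDerivAt_norm_sq z.2).hasFDerivAt.comp z
      (hasFDerivAt_snd (𝕜 := ℝ) (E := R3) (F := R3) (p := z))
    refine this.congr_fderiv ?_
    ext e <;> simp [two_smul]
  have h2 := (hf.bddDensity.hasFDerivAt_newton z.1).comp z
      (hasFDerivAt_fst (𝕜 := ℝ) (E := R3) (F := R3) (p := z))
  have h3 := (hg.bddDensity.hasFDerivAt_newton z.1).comp z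
      (hasFDerivAt_fst (𝕜 := ℝ) (E := R3) (F := R3) (p := z))
  exact (h1.const_mul (1 / 2)).add ((h2.add h3).const_mul (1 / 2))

/-- Each rate carries the full kinetic term, so averaging the two rates reproduces it once and
averages the forces. -/
theorem fderiv_meanParticleEnergy_hamField {f g : Phase → ℝ} {M A : ℝ} (hf : BddPhase f M A)
    (hg : BddPhase g M A) (H : Phase → ℝ) (z : Phase) :
    fderiv ℝ (meanParticleEnergy f g) z (hamField H z)
      = (1 / 2) * (energyRate (newtonField (density f)) H z
        + energyRate (newtonField (density g)) H z) := by
  rw [(hasFDerivAt_meanParticleEnergy hf hg z).fderiv]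
  simp [hamField, energyRate]
  ring

/-! ### First and third order energy estimates -/

section Estimate

variable {f H : Phase → ℝ} {Φ : ℝ → Phase → Phase} {M R D ε₁ ε₂ : ℝ}

/-- The energy difference is controlled by symmetric averages of the energy rates along the flow. -/
theorem abs_energy_sub_le_of_pairing (hf : BddPhase f M R) (hH : ContDiff ℝ 2 H)
    (hΦ : IsHamiltonianFlow H Φ) (h1 : ∀ z, ‖fderiv ℝ H z‖ ≤ ε₁)
    (h2 : ∀ z, ‖fderiv ℝ (fderiv ℝ H) z‖ ≤ ε₂)
    (hD0 : ∀ x, ‖newtonField (density f) x‖ ≤ D)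
    (hD1 : ∀ x, ‖newtonField (density fun z => f (Φ (-1) z)) x‖ ≤ D) {B : ℝ}
    (hB : ∀ s ∈ Icc (0 : ℝ) 1,
      |∫ z, (energyRate (newtonField (density f)) H z
          + energyRate (newtonField (density fun z => f (Φ (-1) z))) H z)
        * (f (Φ (-s) z) + f (Φ (-(1 - s)) z))| ≤ B) :
    4 * |energy (fun z => f (Φ (-1) z)) - energy f| ≤ B := by
  have hHd := hH.differentiable (by norm_num)
  have hb := lipschitzWith_hamField hH h2
  have hbd := norm_hamField_le hHd h1
  have hmp := hΦ.measurePreserving hH h1 h2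
  have hε : 0 ≤ ε₁ := (norm_nonneg _).trans (h1 0)
  have hfs : ∀ s ∈ Icc (0 : ℝ) 1, BddPhase (fun z => f (Φ (-s) z)) M (R + ε₁) := fun s hs =>
    hf.comp_flow hΦ.isFlow hbd (hmp _) (by rw [abs_neg, abs_of_nonneg hs.1]; exact hs.2)
  have hf' := hf.mono_radius (le_add_of_nonneg_right hε)
  have hg' := hfs 1 ⟨zero_le_one, le_rfl⟩
  set g : Phase → ℝ := fun z => f (Φ (-1) z) with hg
  set a : Phase → ℝ := fun z => energyRate (newtonField (density f)) H z
    + energyRate (newtonField (density g)) H z with ha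
  have ham : Measurable a :=
    (measurable_energyRate hH hf.bddDensity.measurable_newtonField).add
      (measurable_energyRate hH hg'.bddDensity.measurable_newtonField)
  have hab : ∀ A, ∀ z, ‖z‖ ≤ A → ‖a z‖ ≤ 2 * (ε₁ * (D + A)) := fun A z hz => by
    refine (norm_add_le _ _).trans ?_
    have e1 := norm_energyRate_le hHd h1 hD0 hz
    have e2 := norm_energyRate_le hHd h1 hD1 hz
    linarith
  have hder : ∀ s ∈ Icc (0 : ℝ) 1,
      HasDerivAt (fun t => ∫ z, meanParticleEnergy f g (Φ t z) * f z)
        ((1 / 2) * ∫ z, a z * f (Φ (-s) z)) s := fun s hs => by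
    have := hΦ.isFlow.hasDerivAt_integral_comp_mul (μ := volume) hb hbd
      (fun z => (hasFDerivAt_meanParticleEnergy hf' hg' z).differentiableAt) hf.integrable hf.vanish
      (c := ε₁ * (D + (R + ε₁ * 2))) (fun w hw => by
        rw [fderiv_meanParticleEnergy_hamField hf' hg', norm_mul]
        have := hab _ w hw
        rw [show ‖(1 / 2 : ℝ)‖ = 1 / 2 by norm_num]
        linarith) hs
    refine this.congr_deriv ?_
    rw [← hΦ.isFlow.integral_comp_mul_eq hb (hmp s), ← integral_const_mul]
    simp only [fderiv_meanParticleEnergy_hamField hf' hg', ha, mul_assoc]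
  -- The factor `1/2` in the derivative halves `B`, and symmetrization doubles the increment:
  -- together they give the `4` of the conclusion.
  have key := two_mul_abs_sub_le_of_symm_deriv hder (B := B / 2) fun s hs => by
    have hs' : 1 - s ∈ Icc (0 : ℝ) 1 := ⟨by linarith [hs.2], by linarith [hs.1]⟩
    rw [← mul_add, ← integral_add
      ((hfs s hs).integrable_mul ham.aestronglyMeasurable (hab _))
      ((hfs _ hs').integrable_mul ham.aestronglyMeasurable (hab _))]
    simp only [← mul_add]
    rw [abs_mul, abs_of_pos (by norm_num : (0 : ℝ) < 1 / 2)]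
    have := hB s hs
    linarith
  have e : energy g - energy f = (∫ z, meanParticleEnergy f g (Φ 1 z) * f z)
      - ∫ z, meanParticleEnergy f g (Φ 0 z) * f z := by
    rw [hΦ.isFlow.integral_comp_mul_eq hb (hmp 1), energy_sub_energy hf' hg']
    simp only [hΦ.isFlow.zero]
    rfl
  rw [e]
  linarith

theorem lintegral_enorm_comp_eq (hf : BddPhase f M R) {Φ : Phase → Phase}
    (hmp : MeasurePreserving Φ volume volume) :
    ∫⁻ z, ‖f (Φ z)‖ₑ = ENNReal.ofReal (∫ z, ‖f z‖) := by
  rw [ofReal_integral_norm_eq_lintegral_enorm hf.integrable]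
  have h1 := hf.meas.enorm
  conv_rhs => rw [← hmp.map_eq]
  rw [lintegral_map' (by rw [hmp.map_eq]; exact h1) hmp.aemeasurable]

theorem norm_newtonField_comp_flow_le (hf : BddPhase f M R) (hH : ContDiff ℝ 2 H)
    (hΦ : IsHamiltonianFlow H Φ) (h1 : ∀ z, ‖fderiv ℝ H z‖ ≤ ε₁)
    (h2 : ∀ z, ‖fderiv ℝ (fderiv ℝ H) z‖ ≤ ε₂) {t : ℝ} (ht : |t| ≤ 1) (x : R3) :
    ‖newtonField (density fun z => f (Φ t z)) x‖
      ≤ (M * (16 * Real.pi ^ 2 / 3) + ∫ z, ‖f z‖) * (R + 1 + ε₁) ^ 2 := by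
  have hε : 0 ≤ ε₁ := (norm_nonneg _).trans (h1 0)
  have hR := hf.radius_nonneg
  have hmp := hΦ.measurePreserving hH h1 h2 t
  have hg := hf.comp_flow hΦ.isFlow (norm_hamField_le (hH.differentiable (by norm_num)) h1) hmp ht
  refine (hg.mono_radius (R' := R + 1 + ε₁) (by linarith)).norm_newtonField_le (by linarith)
    (le_of_eq ?_) x
  exact hmp.integral_comp (hΦ.isFlow.homeomorph (lipschitzWith_hamField hH h2) t).measurableEmbedding
    (fun z => ‖f z‖)

/-- The crude bound, of first order in the generator. -/
theorem abs_energy_sub_le_of_grad (hf : BddPhase f M R) (hH : ContDiff ℝ 2 H)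
    (hΦ : IsHamiltonianFlow H Φ) (h1 : ∀ z, ‖fderiv ℝ H z‖ ≤ ε₁)
    (h2 : ∀ z, ‖fderiv ℝ (fderiv ℝ H) z‖ ≤ ε₂) :
    |energy (fun z => f (Φ (-1) z)) - energy f|
      ≤ ε₁ * ((M * (16 * Real.pi ^ 2 / 3) + ∫ z, ‖f z‖) * (R + 1 + ε₁) ^ 2 + (R + 1 + ε₁))
        * ∫ z, ‖f z‖ := by
  have hHd := hH.differentiable (by norm_num)
  have hbd := norm_hamField_le hHd h1
  have hmp := hΦ.measurePreserving hH h1 h2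
  have hε : 0 ≤ ε₁ := (norm_nonneg _).trans (h1 0)
  have hR := hf.radius_nonneg
  have hM := hf.nonneg
  set L := ∫ z, ‖f z‖ with hL
  have hL0 : 0 ≤ L := integral_nonneg fun _ => norm_nonneg _
  set D := (M * (16 * Real.pi ^ 2 / 3) + L) * (R + 1 + ε₁) ^ 2 with hD
  have hDn : 0 ≤ D := by positivity
  have hD0 : ∀ x, ‖newtonField (density f) x‖ ≤ D := by
    have := norm_newtonField_comp_flow_le hf hH hΦ h1 h2 (t := 0) (by simp)
    simp only [hΦ.isFlow.zero] at this
    exact this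
  have hD1 : ∀ x, ‖newtonField (density fun z => f (Φ (-1) z)) x‖ ≤ D :=
    norm_newtonField_comp_flow_le hf hH hΦ h1 h2 (t := -1) (by simp)
  -- No cancellation here: each rate is bounded on the support, and each transported copy of `f` has
  -- `L¹` norm `L`.
  have := abs_energy_sub_le_of_pairing hf hH hΦ h1 h2 hD0 hD1
    (B := (2 * (ε₁ * (D + (R + 1 + ε₁)))) * (L + L)) fun s hs => by
    refine norm_integral_mul_le_of_lintegral_le (A := R + 1 + ε₁) (by positivity) (by positivity)
      (fun z hz => ?_) (fun z hz => ?_) ?_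
    · refine (norm_add_le _ _).trans ?_
      have e1 := norm_energyRate_le hHd h1 hD0 hz
      have e2 := norm_energyRate_le hHd h1 hD1 hz
      linarith
    · have hb1 := hf.comp_flow hΦ.isFlow hbd (hmp (-s)) (by
        rw [abs_neg, abs_of_nonneg hs.1]; exact hs.2)
      have hb2 := hf.comp_flow hΦ.isFlow hbd (hmp (-(1 - s))) (by
        rw [abs_neg, abs_of_nonneg (by linarith [hs.2])]; linarith [hs.1])
      rw [hb1.vanish z (by linarith), hb2.vanish z (by linarith), add_zero]
    · calc _ ≤ ∫⁻ z, (‖f (Φ (-s) z)‖ₑ + ‖f (Φ (-(1 - s)) z)‖ₑ) :=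
            lintegral_mono fun z => enorm_add_le _ _
        _ = _ := by
            have hm : AEMeasurable (fun z => ‖f (Φ (-s) z)‖ₑ) volume :=
              (hf.meas.comp_measurePreserving (hmp (-s))).enorm
            rw [lintegral_add_left' hm,
              lintegral_enorm_comp_eq hf (hmp _), lintegral_enorm_comp_eq hf (hmp _),
              ENNReal.ofReal_add hL0 hL0]
  linarith

/-- The third order bound, for small generators. -/
theorem abs_energy_sub_le_of_small {p R' : ℝ} {A₀ : ℝ≥0∞} {F : ℕ → Phase → ℝ} {Q : ℝ≥0}
    (hf : BddPhase f M R) (happ : SmoothApprox f p R' A₀ F) (hA₀ : A₀ ≠ ⊤) (hst : IsStationary f)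
    (hQ : ∀ (b : Phase → Phase) (Φ : ℝ → Phase → Phase) (K : ℝ≥0) (m : ℝ),
      IsFlow b Φ → LipschitzWith K b → (∀ z, ‖b z‖ ≤ m) → m ≤ 1 →
      (∀ t, MeasurePreserving (Φ t) volume volume) → ∀ x : R3,
      ∫⁻ z : Phase, ENNReal.ofReal ((‖x - z.1‖ ^ 2)⁻¹) * ‖f (Φ 1 z) - f z‖ₑ
        ≤ ENNReal.ofReal m * Q)
    (hH : ContDiff ℝ 2 H) (hΦ : IsHamiltonianFlow H Φ) (h1 : ∀ z, ‖fderiv ℝ H z‖ ≤ ε₁)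
    (h2 : ∀ z, ‖fderiv ℝ (fderiv ℝ H) z‖ ≤ ε₂) (hε₁ : ε₁ ≤ 1)
    (hst' : IsStationary fun z => f (Φ (-1) z)) :
    4 * |energy (fun z => f (Φ (-1) z)) - energy f|
      ≤ (2 * ((M * (16 * Real.pi ^ 2 / 3) + ∫ z, ‖f z‖) * (R + 2) ^ 2 + (R + 2)) + Q)
        * A₀.toReal * (ε₁ * (ε₁ * (ε₁ + ε₂))) := by
  have hHd := hH.differentiable (by norm_num)
  have hb := lipschitzWith_hamField hH h2
  have hbd := norm_hamField_le hHd h1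
  have hmp := hΦ.measurePreserving hH h1 h2
  have hε : 0 ≤ ε₁ := (norm_nonneg _).trans (h1 0)
  have hε2 : 0 ≤ ε₂ := (norm_nonneg _).trans (norm_fderiv_hamField_le hH h2 0)
  have hR := hf.radius_nonneg
  have hM := hf.nonneg
  set α := A₀.toReal with hα
  have hα0 : 0 ≤ α := ENNReal.toReal_nonneg
  have hA₀' : A₀ = ENNReal.ofReal α := (ENNReal.ofReal_toReal hA₀).symm
  set L := ∫ z, ‖f z‖ with hL
  have hL0 : 0 ≤ L := integral_nonneg fun _ => norm_nonneg _
  set D := (M * (16 * Real.pi ^ 2 / 3) + L) * (R + 2) ^ 2 with hD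
  have hDn : 0 ≤ D := by positivity
  have hD' : (M * (16 * Real.pi ^ 2 / 3) + L) * (R + 1 + ε₁) ^ 2 ≤ D := by
    have : R + 1 + ε₁ ≤ R + 2 := by linarith
    rw [hD]
    gcongr
  have hD0 : ∀ x, ‖newtonField (density f) x‖ ≤ D := fun x => by
    have := norm_newtonField_comp_flow_le hf hH hΦ h1 h2 (t := 0) (by simp) x
    simp only [hΦ.isFlow.zero] at this
    exact this.trans hD'
  have hD1 : ∀ x, ‖newtonField (density fun z => f (Φ (-1) z)) x‖ ≤ D := fun x =>
    (norm_newtonField_comp_flow_le hf hH hΦ h1 h2 (t := -1) (by simp) x).trans hD'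
  have hfs : ∀ s ∈ Icc (0 : ℝ) 1, BddPhase (fun z => f (Φ (-s) z)) M (R + 2) := fun s hs =>
    (hf.comp_flow hΦ.isFlow hbd (hmp _)
      (by rw [abs_neg, abs_of_nonneg hs.1]; exact hs.2)).mono_radius (by linarith)
  have hf' := hf.mono_radius (R' := R + 2) (by linarith)
  have hg' := hfs 1 ⟨zero_le_one, le_rfl⟩
  -- the reversed flow
  have hrev := hΦ.isFlow.reverse
  have hbr : ∀ z, ‖-hamField H z‖ ≤ ε₁ := fun z => by rw [norm_neg]; exact hbd z
  have hmpr : ∀ t, MeasurePreserving (fun z => Φ (-t) z) volume volume := fun t => hmp _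
  set g : Phase → ℝ := fun z => f (Φ (-1) z) with hg
  have hdiff : ∫⁻ z, ‖g z - f z‖ₑ ≤ ENNReal.ofReal (ε₁ * α) := by
    have := hrev.lintegral_mul_enorm_comp_sub_le_of_tendsto (μ := volume) hb.neg hbr hmpr
      (fun n => contDiff_infty.1 (happ.contDiff n) 1) happ.tendsto (w := fun _ => 1)
      measurable_const (A := A₀) (fun n s hs => ?_) (by simp)
    · rw [ENNReal.ofReal_mul hε, ← hA₀']
      simpa using this
    · simp only [one_mul]
      rw [(hmpr s).lintegral_comp (f := fun z => ‖fderiv ℝ (F n) z‖ₑ)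
        ((contDiff_infty.1 (happ.contDiff n) 1).continuous_fderiv
          (by norm_num)).enorm.measurable]
      exact happ.fderiv_le n
  have hsec : ∀ s ∈ Icc (0 : ℝ) 1,
      ∫⁻ z, ‖f (Φ (-s) z) + f (Φ (-(1 - s)) z) - f z - g z‖ₑ
        ≤ ENNReal.ofReal (ε₁ * (ε₁ + ε₂) * α) := fun s hs => by
    have := hrev.lintegral_enorm_second_difference_le_of_tendsto (μ := volume) hb.neg hbr
      (contDiff_hamField hH).neg (ε := ε₂) (fun z => by
        rw [fderiv_fun_neg, norm_neg]; exact norm_fderiv_hamField_le hH h2 z) hmpr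
      (fun n => contDiff_infty.1 (happ.contDiff n) 2) happ.tendsto happ.fderiv_le
      happ.fderiv_fderiv_le hs
    refine this.trans (le_of_eq ?_)
    rw [← add_mul, ← ENNReal.ofReal_add (by positivity) (by positivity), hA₀',
      ← ENNReal.ofReal_mul (by positivity)]
    congr 1
    ring
  have hforce : ∀ x, ‖newtonField (density f) x - newtonField (density g) x‖ ≤ ε₁ * Q := fun x => by
    rw [norm_sub_rev]
    refine hg'.newtonField_sub_le hf' x (by positivity) ?_
    rw [ENNReal.ofReal_mul hε, ENNReal.ofReal_coe_nnreal]
    exact hQ _ _ _ ε₁ hrev hb.neg hbr hε₁ hmpr x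
  set a₀ := energyRate (newtonField (density f)) H with ha₀
  set a₁ := energyRate (newtonField (density g)) H with ha₁
  have hm₀ : Measurable a₀ := measurable_energyRate hH hf.bddDensity.measurable_newtonField
  have hm₁ : Measurable a₁ := measurable_energyRate hH hg'.bddDensity.measurable_newtonField
  have hb₀ : ∀ z, ‖z‖ ≤ R + 2 → ‖a₀ z‖ ≤ ε₁ * (D + (R + 2)) := fun z hz =>
    norm_energyRate_le hHd h1 hD0 hz
  have hb₁ : ∀ z, ‖z‖ ≤ R + 2 → ‖a₁ z‖ ≤ ε₁ * (D + (R + 2)) := fun z hz =>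
    norm_energyRate_le hHd h1 hD1 hz
  have hz₀ : ∫ z, a₀ z * f z = 0 := hst.integral_energyRate hf hH h1 hD0
  have hz₁ : ∫ z, a₁ z * g z = 0 := hst'.integral_energyRate hg' hH h1 hD1
  -- The kinetic terms cancel, and the force difference supplies the second factor `ε₁`.
  have hsub : ∀ z, ‖a₀ z - a₁ z‖ ≤ ε₁ * Q * ε₁ := fun z => by
    have e : a₀ z - a₁ z
        = inner ℝ (newtonField (density f) z.1 - newtonField (density g) z.1) (gradV H z) := by
      rw [inner_sub_left]
      simp only [ha₀, ha₁, energyRate]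
      ring
    rw [e]
    exact norm_inner_gradV_le (G := fun x => newtonField (density f) x - newtonField (density g) x)
      hHd h1 hforce z
  refine abs_energy_sub_le_of_pairing hf hH hΦ h1 h2 hD0 hD1 fun s hs => ?_
  have hs' : 1 - s ∈ Icc (0 : ℝ) 1 := ⟨by linarith [hs.2], by linarith [hs.1]⟩
  have hms : AEStronglyMeasurable (fun z => a₀ z + a₁ z) volume :=
    (hm₀.add hm₁).aestronglyMeasurable
  have hbs : ∀ z, ‖z‖ ≤ R + 2 → ‖a₀ z + a₁ z‖ ≤ 2 * (ε₁ * (D + (R + 2))) := fun z hz => by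
    refine (norm_add_le _ _).trans ?_
    have e1 := hb₀ z hz
    have e2 := hb₁ z hz
    linarith
  have i₀f := hf'.integrable_mul hm₀.aestronglyMeasurable hb₀
  have i₁f := hf'.integrable_mul hm₁.aestronglyMeasurable hb₁
  have i₀g := hg'.integrable_mul hm₀.aestronglyMeasurable hb₀
  have i₁g := hg'.integrable_mul hm₁.aestronglyMeasurable hb₁
  have is := (hfs s hs).integrable_mul hms hbs
  have is' := (hfs _ hs').integrable_mul hms hbs
  have iF := hf'.integrable_mul hms hbs
  have iG := hg'.integrable_mul hms hbs
  -- Subtracting and restoring `f + g` leaves `∫ a₀ g + ∫ a₁ f`, as `∫ a₀ f = ∫ a₁ g = 0`. The same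
  -- two equations complete this remainder to a product of differences.
  have split : ∫ z, (a₀ z + a₁ z) * (f (Φ (-s) z) + f (Φ (-(1 - s)) z))
      = (∫ z, (a₀ z + a₁ z) * (f (Φ (-s) z) + f (Φ (-(1 - s)) z) - f z - g z))
        + ∫ z, (a₀ z - a₁ z) * (g z - f z) := by
    have e1 : ∫ z, (a₀ z + a₁ z) * (f (Φ (-s) z) + f (Φ (-(1 - s)) z))
        = (∫ z, (a₀ z + a₁ z) * f (Φ (-s) z)) + ∫ z, (a₀ z + a₁ z) * f (Φ (-(1 - s)) z) := by
      rw [← integral_add is is']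
      simp only [mul_add]
    have e2 : ∫ z, (a₀ z + a₁ z) * (f (Φ (-s) z) + f (Φ (-(1 - s)) z) - f z - g z)
        = (∫ z, (a₀ z + a₁ z) * f (Φ (-s) z)) + (∫ z, (a₀ z + a₁ z) * f (Φ (-(1 - s)) z))
          - (∫ z, (a₀ z + a₁ z) * f z) - ∫ z, (a₀ z + a₁ z) * g z := by
      rw [← integral_add is is', ← integral_sub (by exact is.add is') iF,
        ← integral_sub (by exact (is.add is').sub iF) iG]
      exact integral_congr_ae (Eventually.of_forall fun z => by ring)
    have e3 : ∫ z, (a₀ z - a₁ z) * (g z - f z)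
        = (∫ z, a₀ z * g z) - (∫ z, a₀ z * f z) - (∫ z, a₁ z * g z) + ∫ z, a₁ z * f z := by
      rw [← integral_sub i₀g i₀f, ← integral_sub (by exact i₀g.sub i₀f) i₁g,
        ← integral_add (by exact (i₀g.sub i₀f).sub i₁g) i₁f]
      exact integral_congr_ae (Eventually.of_forall fun z => by ring)
    have e4 : ∫ z, (a₀ z + a₁ z) * f z = (∫ z, a₀ z * f z) + ∫ z, a₁ z * f z := by
      rw [← integral_add i₀f i₁f]
      simp only [add_mul]
    have e5 : ∫ z, (a₀ z + a₁ z) * g z = (∫ z, a₀ z * g z) + ∫ z, a₁ z * g z := by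
      rw [← integral_add i₀g i₁g]
      simp only [add_mul]
    rw [e1, e2, e3, e4, e5, hz₀, hz₁]
    ring
  have b1 : ‖∫ z, (a₀ z + a₁ z) * (f (Φ (-s) z) + f (Φ (-(1 - s)) z) - f z - g z)‖
      ≤ 2 * (ε₁ * (D + (R + 2))) * (ε₁ * (ε₁ + ε₂) * α) := by
    refine norm_integral_mul_le_of_lintegral_le (A := R + 2) (by positivity) (by positivity)
      hbs (fun z hz => ?_) (hsec s hs)
    rw [(hfs s hs).vanish z hz, (hfs _ hs').vanish z hz, hf'.vanish z hz, hg'.vanish z hz]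
    simp
  have b2 : ‖∫ z, (a₀ z - a₁ z) * (g z - f z)‖ ≤ ε₁ * Q * ε₁ * (ε₁ * α) := by
    refine norm_integral_mul_le_of_lintegral_le (A := R + 2) (by positivity) (by positivity)
      (fun z _ => hsub z) (fun z hz => ?_) hdiff
    rw [hf'.vanish z hz, hg'.vanish z hz, sub_zero]
  have b3 : ε₁ * Q * ε₁ * (ε₁ * α) ≤ Q * α * (ε₁ * (ε₁ * (ε₁ + ε₂))) := by
    have : 0 ≤ Q * α * (ε₁ * (ε₁ * ε₂)) := by positivity
    linarith
  rw [split]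
  refine (abs_add_le _ _).trans ?_
  rw [Real.norm_eq_abs] at b1 b2
  linarith

/-- The energy estimate with pointwise bounds for the generator. -/
theorem exists_abs_energy_sub_le {p R' : ℝ} {A₀ : ℝ≥0∞} {F : ℕ → Phase → ℝ}
    (hf : BddPhase f M R) (happ : SmoothApprox f p R' A₀ F) (hp : 3 < p) (hA₀ : A₀ ≠ ⊤)
    (hst : IsStationary f) :
    ∃ C : ℝ≥0, ∀ (H : Phase → ℝ) (Φ : ℝ → Phase → Phase) (ε₁ ε₂ : ℝ), ContDiff ℝ 2 H →
      IsHamiltonianFlow H Φ → (∀ z, ‖fderiv ℝ H z‖ ≤ ε₁) →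
      (∀ z, ‖fderiv ℝ (fderiv ℝ H) z‖ ≤ ε₂) → IsStationary (fun z => f (Φ (-1) z)) →
      |energy (fun z => f (Φ (-1) z)) - energy f| ≤ C * ε₁ * (ε₁ + ε₂) ^ 2 := by
  obtain ⟨Q, hQ⟩ := happ.exists_lintegral_weight_le hp hA₀
  have hR := hf.radius_nonneg
  have hM := hf.nonneg
  set L := ∫ z, ‖f z‖ with hL
  have hL0 : 0 ≤ L := integral_nonneg fun _ => norm_nonneg _
  set D := M * (16 * Real.pi ^ 2 / 3) + L with hD
  have hD0 : 0 ≤ D := by positivity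
  set C₁ := (D + 1) * (R + 2) ^ 2 * L with hC₁
  set C₂ := (2 * (D * (R + 2) ^ 2 + (R + 2)) + Q) * A₀.toReal with hC₂
  have hC₁0 : 0 ≤ C₁ := by positivity
  have hC₂0 : 0 ≤ C₂ := mul_nonneg (by positivity) ENNReal.toReal_nonneg
  refine ⟨(C₁ + C₂).toNNReal, fun H Φ ε₁ ε₂ hH hΦ h1 h2 hst' => ?_⟩
  have hε : 0 ≤ ε₁ := (norm_nonneg _).trans (h1 0)
  have hε2 : 0 ≤ ε₂ := (norm_nonneg _).trans (norm_fderiv_hamField_le hH h2 0)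
  rw [Real.coe_toNNReal _ (add_nonneg hC₁0 hC₂0)]
  -- For large generators `R + 1 + ε₁ ≤ (R + 2)(ε₁ + ε₂)`, so the quadratic growth of the crude
  -- bound is affordable. For small ones `ε₁ ≤ 1` and the third order bound applies.
  rcases le_total 1 (ε₁ + ε₂) with hbig | hsmall
  · refine (abs_energy_sub_le_of_grad hf hH hΦ h1 h2).trans ?_
    have k1 : R + 1 + ε₁ ≤ (R + 2) * (ε₁ + ε₂) := by nlinarith
    have k2 : 1 ≤ (R + 2) * (ε₁ + ε₂) := by nlinarith
    calc _ ≤ ε₁ * (D * ((R + 2) * (ε₁ + ε₂)) ^ 2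
          + ((R + 2) * (ε₁ + ε₂)) * ((R + 2) * (ε₁ + ε₂))) * L := by
          gcongr
          calc R + 1 + ε₁ = (R + 1 + ε₁) * 1 := by ring
            _ ≤ _ := by gcongr
      _ = C₁ * ε₁ * (ε₁ + ε₂) ^ 2 := by rw [hC₁]; ring
      _ ≤ _ := by
          gcongr
          linarith
  · have := abs_energy_sub_le_of_small hf happ hA₀ hst hQ hH hΦ h1 h2 (by linarith) hst'
    rw [← hL, ← hD, ← hC₂] at this
    have k : C₂ * (ε₁ * (ε₁ * (ε₁ + ε₂))) ≤ C₂ * (ε₁ * (ε₁ + ε₂) ^ 2) := by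
      rw [sq]
      gcongr
      linarith
    have k' : 0 ≤ C₁ * (ε₁ * (ε₁ + ε₂) ^ 2) := by positivity
    have := abs_nonneg (energy (fun z => f (Φ (-1) z)) - energy f)
    linarith

end Estimate

/-! ### From essential suprema to pointwise bounds -/

/-- For continuous `u` the bound holds on a closed set of full measure, which is the whole space
when open sets have positive measure. -/
theorem norm_le_of_eLpNorm_top {E G : Type*} [TopologicalSpace E] [MeasurableSpace E]
    [NormedAddCommGroup G] {μ : Measure E} [μ.IsOpenPosMeasure] {u : E → G} (hu : Continuous u)
    (h : eLpNorm (fun z => ‖u z‖) ⊤ μ ≠ ⊤) (z : E) :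
    ‖u z‖ ≤ (eLpNorm (fun z => ‖u z‖) ⊤ μ).toReal := by
  rw [eLpNorm_exponent_top] at h ⊢
  have hae : ∀ᵐ z ∂μ, ‖u z‖ ≤ (eLpNormEssSup (fun z => ‖u z‖) μ).toReal := by
    filter_upwards [ae_le_eLpNormEssSup (f := fun z => ‖u z‖) (μ := μ)] with z hz
    have := ENNReal.toReal_mono h hz
    simpa using this
  have := (IsClosed.ae_eq_univ_iff_eq (μ := μ) (isClosed_le hu.norm continuous_const)).1
    (eventuallyEq_univ.2 hae)
  exact this.symm.subset (mem_univ z)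

/-- Rules out the product `0 * ⊤`, equal to `0` in `ℝ≥0∞`, on the right-hand side of the final
estimate. -/
theorem hessSup_eq_zero_of_gradSup {H : Phase → ℝ} (hH : ContDiff ℝ 2 H) (h : gradSup H = 0) :
    hessSup H = 0 := by
  have hc : Continuous (fderiv ℝ H) := hH.continuous_fderiv (by norm_num)
  have h0 : fderiv ℝ H = fun _ => 0 := funext fun z => by
    have := norm_le_of_eLpNorm_top (μ := volume) hc (by rw [← gradSup, h]; simp) z
    rw [← gradSup, h] at this
    simpa using this
  have h1 : (fun z => ‖fderiv ℝ (fderiv ℝ H) z‖) = fun _ => (0 : ℝ) := funext fun z => by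
    rw [h0, fderiv_fun_const]
    exact ContinuousLinearMap.opNorm_zero
  rw [hessSup, h1, eLpNorm_zero']

end VlasovPoisson

end

theorem proposition2p2 (f : VlasovPoisson.Phase → ℝ)
    (hsupp : HasCompactSupport f)
    (hsteady : VlasovPoisson.IsStationary f)
    (hbdd : MemLp f ∞ volume)
    (hW : ∃ q : ℝ≥0∞, 3 < q ∧ VlasovPoisson.MemW2 f q) :
    ∃ C : ℝ≥0, ∀ H : VlasovPoisson.Phase → ℝ, ContDiff ℝ 2 H →
      VlasovPoisson.IsStationary (VlasovPoisson.transport f H 1) →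
        ENNReal.ofReal
            |VlasovPoisson.energy (VlasovPoisson.transport f H 1) - VlasovPoisson.energy f| ≤
          (C : ℝ≥0∞) * VlasovPoisson.gradSup H *
            (VlasovPoisson.gradSup H + VlasovPoisson.hessSup H) ^ 2 := by
  obtain ⟨q, hq, hW⟩ := hW
  obtain ⟨p, R', A₀, F, hp, -, hA₀, happ⟩ := VlasovPoisson.exists_smoothApprox hsupp hq hW
  obtain ⟨R, hR0, hR⟩ := VlasovPoisson.exists_radius_of_hasCompactSupport hsupp
  have hf : VlasovPoisson.BddPhase f (eLpNorm f ∞ volume).toReal R := by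
    refine ⟨hbdd.1, ENNReal.toReal_nonneg, hR0, ?_, hR⟩
    have hne := hbdd.2.ne
    rw [eLpNorm_exponent_top] at hne ⊢
    filter_upwards [ae_le_eLpNormEssSup (f := f) (μ := volume)] with z hz
    simpa using ENNReal.toReal_mono hne hz
  obtain ⟨C, hC⟩ := VlasovPoisson.exists_abs_energy_sub_le hf happ hp hA₀ hsteady
  -- Adding one makes the constant nonzero, so that an infinite norm really makes the right-hand
  -- side infinite.
  refine ⟨C + 1, fun H hH hst => ?_⟩
  by_cases hex : ∃ Φ, VlasovPoisson.IsHamiltonianFlow H Φ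
  swap
  -- Without a global flow the default value is the identity, and the two energies coincide.
  · have h : VlasovPoisson.transport f H 1 = f := by
      funext z
      simp [VlasovPoisson.transport, VlasovPoisson.hamiltonianFlow, hex]
    simp [h]
  have hΦ : VlasovPoisson.IsHamiltonianFlow H (VlasovPoisson.hamiltonianFlow H) := by
    rw [VlasovPoisson.hamiltonianFlow, dif_pos hex]
    exact hex.choose_spec
  have hC0 : ((C + 1 : ℝ≥0) : ℝ≥0∞) ≠ 0 := by simp
  by_cases hg : VlasovPoisson.gradSup H = ⊤
  · simp [hg]
  by_cases hh : VlasovPoisson.hessSup H = ⊤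
  · have hg0 : VlasovPoisson.gradSup H ≠ 0 := fun h0 => by
      rw [VlasovPoisson.hessSup_eq_zero_of_gradSup hH h0] at hh
      exact ENNReal.zero_ne_top hh
    rw [hh, add_top, ENNReal.top_pow two_ne_zero, ENNReal.mul_top (mul_ne_zero hC0 hg0)]
    exact le_top
  have hH1 : ContDiff ℝ 1 (fderiv ℝ H) := hH.fderiv_right (m := 1) (by norm_num)
  have h1 := VlasovPoisson.norm_le_of_eLpNorm_top (μ := volume) hH1.continuous hg
  have h2 := VlasovPoisson.norm_le_of_eLpNorm_top (μ := volume)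
    (hH1.continuous_fderiv (by norm_num)) hh
  have key := hC H _ _ _ hH hΦ h1 h2 hst
  change |VlasovPoisson.energy (VlasovPoisson.transport f H 1) - VlasovPoisson.energy f|
    ≤ C * (VlasovPoisson.gradSup H).toReal
      * ((VlasovPoisson.gradSup H).toReal + (VlasovPoisson.hessSup H).toReal) ^ 2 at key
  refine (ENNReal.ofReal_le_ofReal key).trans ?_
  rw [ENNReal.ofReal_mul (by positivity), ENNReal.ofReal_mul (by positivity),
    ENNReal.ofReal_pow (by positivity), ENNReal.ofReal_add (by positivity) (by positivity),
    ENNReal.ofReal_toReal hg, ENNReal.ofReal_toReal hh, ENNReal.ofReal_coe_nnreal]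
  gcongr
  exact le_self_add
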